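/- **Setting.** Let $\Gamma=\bigoplus_{a=1}^m\mathbb Z\gamma^a$ be a lattice with a nondegenerate skew-symmetric integer pairing $\langle\cdot,\cdot\rangle$, $\omega^{ab}=\langle\gamma^a,\gamma^b\rangle$, and let $\Omega:\Gamma\setminus\{0\}\to\mathbb Z$ satisfy $\Omega(-\gamma)=\Omega(\gamma)$. For $\gamma=\sum_a q_a\gamma^a$ and $z,\theta\in\mathbb C^m$ put $Z_\gamma=\sum_a q_az^a$ and $\theta_\gamma=\sum_a q_a\theta^a$. The point $z$ defines a BPS structure $(\Gamma,Z,\Omega)$ if $|Z_\gamma|>\varepsilon\|\gamma\|$ whenever $\Omega(\gamma)\ne0$, for some $\varepsilon>0$ (support property), and $\sum_\gamma|\Omega(\gamma)|e^{-R|Z_\gamma|}<\infty$ for some $R>0$. Assume that $\Omega$ is *uncoupled*: $\langle\gamma,\gamma'\rangle\neq0$ implies $\Omega(\gamma)=0$ or $\Omega(\gamma')=0$ (so $\Omega$ does not jump when $z$ varies). It is *finite* if only finitely many $\Omega(\gamma)$ are nonzero. Put $\bar\Omega(\gamma)=\sum_{d\mid\gamma}d^{-2}\,\Omega(\gamma/d)$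 for $\gamma\ne 0$. Let $\sigma:\Gamma\to\mathbb C^\times$ satisfy $\sigma_\gamma\sigma_{\gamma'}=(-1)^{\langle\gamma,\gamma'\rangle}\sigma_{\gamma+\gamma'}$, and put $\mathcal X^{\rm sf}_\gamma(t)=\sigma_\gamma e^{2\pi i(\theta_\gamma-Z_\gamma/t)}$. The BPS ray of $\gamma$ is $\ell_\gamma=\{t: Z_\gamma/t\in i\mathbb R_{<0}\}$, oriented from $0$ to $\infty$. Let $D$ be the set of pairs $(z,t)$ such that $z$ defines a BPS structure and $t\in\mathbb C^\times$ lies on no ray $\ell_\gamma$ with $\Omega(\gamma)\ne0$. Fix an arbitrary $\theta\in\mathbb C^m$. The Fourier modes $\mathcal X_\gamma(z,t)$ are a solution of the TBA equations, in terms of the integer or of the rational invariants: $$\mathcal X_\gamma(t)=\mathcal X^{\rm sf}_\gamma(t)\exp\Big[\tfrac1{2\pi i}\sum_{\gamma'}\Omega(\gamma')\langle\gamma,\gamma'\rangle\int_{\ell_{\gamma'}}\tfrac{dt'}{t'}\tfrac{t}{t-t'}\log(1-\mathcal X_{\gamma'}(t'))\Big],\tag{Z}$$ $$\mathcal X_\gamma(t)=\mathcal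 X^{\rm sf}_\gamma(t)\exp\Big[\tfrac1{2\pi i}\sum_{\gamma'}\bar\Omega(\gamma')\langle\gamma,\gamma'\rangle\int_{\ell_{\gamma'}}\tfrac{dt'}{t'}\tfrac{t}{t'-t}\,\mathcal X_{\gamma'}(t')\Big],\tag{Q}$$ for all $\gamma$ and all $t\in\mathbb C^\times$ off the rays contributing to the equation of $\gamma$; the sums converge, possibly only for a fixed prescription (a limit of finite partial sums along a filter of finite sets of charges that eventually contain every given charge). The $\tau$-function equations, at fixed $t$ and $\theta$, are $$\sum_{b}\omega^{ab}\,\partial_{z^b}\log\tau=\partial_t\log\big(\mathcal X_{\gamma^a}/\mathcal X^{\rm sf}_{\gamma^a}\big),\qquad a=1,\dots,m.\tag{E}$$ Below, $\log(Z_\gamma/t)$ is the branch with argument in $(-\frac\pi2,\frac{3\pi}2)$, whose cut is the image of $\ell_\gamma$; the other logarithms in the integrals are principal, and ${\rm Li}_2(y)=-\int_0^1\log(1-ys)\frac{ds}s$. **1. Uncoupled case.** Let $V\subseteq D$ be open, let $\mathcal X$ solve (Q) for every $z$ occurring in $V$, and suppose that $$T(z,t)=\frac1{4\pi^2}\sum_{\gamma\neq0}\sigma_\gamma\bar\Omega(\gamma)e^{2\pi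 i\theta_\gamma}\Big[\int_{\ell_\gamma}\frac{dt'}{t'}\frac{t}{t'-t}\Big(1+2\pi i\frac{Z_\gamma}{t'}\Big)e^{-2\pi iZ_\gamma/t'}-\log(Z_\gamma/t)\Big]$$ converges locally uniformly on $V$, with the same prescription. Then (E) is integrable and solved by $T$: for every $t$ and every connected open $W\subseteq\mathbb C^m$ with $W\times\{t\}\subseteq V$, a function $\log\tau$ on $W$ is a holomorphic solution of (E) if and only if $\log\tau=T(\cdot,t)+c$ on $W$ for some constant $c$. The same holds with (Z) in place of (Q) and with $T$ replaced by its resummation over multiples of the charges, $$\frac1{4\pi^2}\sum_{\gamma\ne0}\Omega(\gamma)\Big[\int_{\ell_\gamma}\frac{dt'}{t'}\frac{t}{t'-t}\Big({\rm Li}_2(\mathcal X^{\rm sf}_\gamma(t'))-2\pi i\frac{Z_\gamma}{t'}\log(1-\mathcal X^{\rm sf}_\gamma(t'))\Big)-{\rm Li}_2(\sigma_\gamma e^{2\pi i\theta_\gamma})\log(Z_\gamma/t)\Big].\tag{R}$$ **2. Finite uncoupled case.** Choose $\vartheta_\gamma\in\mathbb C$ with $e^{2\pi i\vartheta_\gamma}=\sigma_\gamma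 e^{2\pi i\theta_\gamma}$; let $[x]=x-\lfloor{\rm Re}\,x\rfloor$ if ${\rm Im}\,x\ge0$ and $[x]=x+\lfloor-{\rm Re}\,x\rfloor+1$ if ${\rm Im}\,x<0$. Let $$\Upsilon(z,\eta)=\frac{e^{\frac34z^2-\zeta'(-1)}\,G(z+\eta+1)}{(2\pi)^{z/2}\,z^{z^2/2}\,\Gamma(z+\eta)^\eta},$$ with $G$ the Barnes function, $z^{z^2/2}$ principal, and $\Gamma(z+\eta)^\eta=e^{\eta\log\Gamma(z+\eta)}$ for the standard branch of $\log\Gamma$. If $\Omega(\gamma)\ne0$, then $\Upsilon(\cdot,1-[\vartheta_\gamma])$ has continuous logarithms on $\{{\rm Re}\,z>0\}$; fix any of them as $\log\Upsilon(\cdot,1-[\vartheta_\gamma])$, and set $$U(z,t)=\sum_{{\rm Re}(Z_\gamma/t)>0}\Omega(\gamma)\,\log\Upsilon\Big(\frac{Z_\gamma}t,\,1-[\vartheta_\gamma]\Big).$$ Then, for every $\theta\in\mathbb C^m$: * (Z) has a solution (for all $z$ defining a BPS structure). For every $t$, every connected open $W$ with $W\times\{t\}\subseteq D$, and every solution $\mathcal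 X$ of (Z) over $W$, a function $\log\tau$ on $W$ is a holomorphic solution of (E) if and only if $\log\tau=U(\cdot,t)+c$ on $W$ for some constant $c$. * The sum (R), which is finite, equals $U$ up to a function of $\theta$: on the part of $D$ where the set $\{\gamma:\Omega(\gamma)\neq0,\ {\rm Re}(Z_\gamma/t)>0\}$ is a given one, their difference does not depend on $(z,t)$. * If $\vartheta_\gamma\in\mathbb R$ whenever $\Omega(\gamma)\ne0$, then (Q) has a solution (for all $z$ defining a BPS structure), the series $T$ converges unconditionally and locally uniformly on $D$, and $T-U$ is likewise independent of $(z,t)$ on each such part of $D$. -/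

import Mathlib

open scoped Topology

noncomputable section

namespace BPS

/-! ### Special functions -/

/-- The dilogarithm `Li₂(y) = -∫₀¹ log(1 - y s) ds / s`, with the principal logarithm
(on the cut `y > 1` this is the value determined by `arg (1 - y s) = π`). -/
def dilog (y : ℂ) : ℂ :=
  -∫ s in (0 : ℝ)..1, Complex.log (1 - y * s) / s

/-- The branch of the logarithm on `ℂ \ i ℝ_{≤ 0}` with argument in `(-π/2, 3π/2)`. -/
def logDown (w : ℂ) : ℂ :=
  Complex.log (-Complex.I * w) + Complex.I * (Real.pi / 2)

/-- The standard branch of `log Γ` on `ℂ \ ℝ_{≤ 0}` (real on the positive real axis), by the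
Weierstrass product of `1/Γ`. -/
def logGamma (s : ℂ) : ℂ :=
  -(Real.eulerMascheroniConstant : ℂ) * s - Complex.log s
    + ∑' n : ℕ, (s / (n + 1) - Complex.log (1 + s / (n + 1)))

/-- The Barnes `G`-function, by its Weierstrass product
`G(1+x) = (2π)^{x/2} e^{-(x+(1+γ)x²)/2} ∏_{k ≥ 1} (1+x/k)^k e^{x²/(2k) - x}` at `x = s - 1`. -/
def barnesG (s : ℂ) : ℂ :=
  (2 * Real.pi : ℂ) ^ ((s - 1) / 2)
    * Complex.exp (-((s - 1) + (1 + (Real.eulerMascheroniConstant : ℂ)) * (s - 1) ^ 2) / 2)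
    * ∏' k : ℕ, ((1 + (s - 1) / (k + 1)) ^ (k + 1)
        * Complex.exp ((s - 1) ^ 2 / (2 * (k + 1)) - (s - 1)))

/-- The generalized Barnes function
`Υ(z,η) = e^{3z²/4 - ζ'(-1)} G(z+η+1) / ((2π)^{z/2} z^{z²/2} Γ(z+η)^η)`,
where `Γ(z+η)^η = exp(η log Γ(z+η))`. -/
def Upsilon (z η : ℂ) : ℂ :=
  Complex.exp (3 / 4 * z ^ 2 - deriv riemannZeta (-1)) * barnesG (z + η + 1)
    / ((2 * Real.pi : ℂ) ^ (z / 2) * z ^ (z ^ 2 / 2) * Complex.exp (η * logGamma (z + η)))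

/-- `ℓ` is a branch of `log Υ(·, η)` on the right half-plane. -/
def IsLogUpsilon (η : ℂ) (ℓ : ℂ → ℂ) : Prop :=
  ContinuousOn ℓ {w | 0 < w.re} ∧ ∀ w : ℂ, 0 < w.re → Complex.exp (ℓ w) = Upsilon w η

/-- The bracket `[x]`: `x - ⌊Re x⌋` if `Im x ≥ 0`, and `x + ⌊-Re x⌋ + 1` if `Im x < 0`. -/
def bracket (x : ℂ) : ℂ :=
  if 0 ≤ x.im then x - (⌊x.re⌋ : ℤ) else x + (⌊-x.re⌋ : ℤ) + 1

/-! ### BPS structures -/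

/-- The locally constant data of a family of BPS structures: the charge lattice `ℤ^m` (written in
a basis `γ^1, …, γ^m`), a nondegenerate skew-symmetric integer pairing with Gram matrix
`ω^{ab} = ⟨γ^a, γ^b⟩`, and the BPS indices `Ω(γ)` (with the convention `Ω(0) = 0`). -/
structure Data (m : ℕ) where
  /-- Gram matrix of the pairing. -/
  ω : Matrix (Fin m) (Fin m) ℤ
  skew : ω.transpose = -ω
  nondegenerate : ω.det ≠ 0
  /-- BPS indices. -/
  Ω : (Fin m → ℤ) → ℤ
  Ω_zero : Ω 0 = 0
  Ω_neg : ∀ γ, Ω (-γ) = Ω γ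

/-- The central charge `Z_γ = ∑ q_a z^a`, where `z^a = Z_{γ^a}`. -/
def centralCharge {m : ℕ} (z : Fin m → ℂ) (γ : Fin m → ℤ) : ℂ :=
  ∑ a, (γ a : ℂ) * z a

/-- The fibre coordinate `θ_γ = ∑ q_a θ^a`. -/
def angle {m : ℕ} (θ : Fin m → ℂ) (γ : Fin m → ℤ) : ℂ :=
  ∑ a, (γ a : ℂ) * θ a

/-- The BPS ray `{t : Z/t ∈ i ℝ_{< 0}}` of a charge with central charge `Z`. -/
def ray (Z : ℂ) : Set ℂ :=
  {t | ∃ r : ℝ, r < 0 ∧ Z / t = r * Complex.I}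

/-- `∫_ℓ F(t') dt'/t'` over the BPS ray `ℓ = i Z ℝ_{> 0}`, oriented from `0` to `∞`. -/
def rayIntegral (Z : ℂ) (F : ℂ → ℂ) : ℂ :=
  ∫ r in Set.Ioi (0 : ℝ), F (Complex.I * Z * r) / r

namespace Data

variable {m : ℕ} (B : Data m)

/-- The pairing `⟨γ, γ'⟩`. -/
def pairing (γ γ' : Fin m → ℤ) : ℤ :=
  ∑ a, ∑ b, γ a * B.ω a b * γ' b

/-- The rational invariants `Ω̄(γ) = ∑_{d ∣ γ} Ω(γ/d) / d²` (zero at `γ = 0`). -/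
def ratΩ (γ : Fin m → ℤ) : ℚ :=
  ∑ d ∈ (Finset.univ.gcd γ).natAbs.divisors, (B.Ω (fun a => γ a / (d : ℤ)) : ℚ) / (d : ℚ) ^ 2

/-- `(Γ, Z, Ω)` is a BPS structure for the central charge with coordinates `z`: support property
and convergence property. -/
def IsBPSAt (z : Fin m → ℂ) : Prop :=
  (∃ ε : ℝ, 0 < ε ∧ ∀ γ, B.Ω γ ≠ 0 → ε * ‖γ‖ < ‖centralCharge z γ‖) ∧
  (∃ R : ℝ, 0 < R ∧ Summable fun γ => |(B.Ω γ : ℝ)| * Real.exp (-R * ‖centralCharge z γ‖))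

/-- The BPS structure is uncoupled. -/
def Uncoupled : Prop :=
  ∀ γ γ', B.pairing γ γ' ≠ 0 → B.Ω γ = 0 ∨ B.Ω γ' = 0

/-- Only finitely many BPS indices are nonzero. -/
def IsFinite : Prop :=
  (Function.support B.Ω).Finite

/-- `σ` is a (nowhere zero) quadratic refinement of the pairing. -/
def IsQuadraticRefinement (σ : (Fin m → ℤ) → ℂ) : Prop :=
  (∀ γ, σ γ ≠ 0) ∧ ∀ γ γ', σ γ * σ γ' = (-1 : ℂ) ^ (B.pairing γ γ') * σ (γ + γ')

/-- The pairs `(z, t)` such that `z` defines a BPS structure and `t ∈ ℂ^×` lies on no BPS ray. -/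
def domain : Set ((Fin m → ℂ) × ℂ) :=
  {p | B.IsBPSAt p.1 ∧ p.2 ≠ 0 ∧ ∀ γ, B.Ω γ ≠ 0 → p.2 ∉ ray (centralCharge p.1 γ)}

/-- The active charges `γ` with `Re (Z_γ / t) > 0`. -/
def rightCharges (z : Fin m → ℂ) (t : ℂ) : Set (Fin m → ℤ) :=
  {γ | B.Ω γ ≠ 0 ∧ 0 < (centralCharge z γ / t).re}

end Data

/-- The semi-flat Fourier modes `σ_γ e^{2πi(θ_γ - Z_γ/t)}`. -/
def Xsf {m : ℕ} (σ : (Fin m → ℤ) → ℂ) (θ : Fin m → ℂ)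
    (γ : Fin m → ℤ) (z : Fin m → ℂ) (t : ℂ) : ℂ :=
  σ γ * Complex.exp (2 * Real.pi * Complex.I * (angle θ γ - centralCharge z γ / t))

/-- The TBA equations at `z` in terms of the rational invariants: for every charge `γ` and every
`t ∈ ℂ^×` outside the BPS rays that contribute to the equation of `γ`,
`X_γ(t) = Xsf_γ(t) exp[(1/2πi) ∑_{γ'} Ω̄(γ') ⟨γ,γ'⟩ ∫_{ℓ_{γ'}} dt'/t' · t/(t'-t) · X_{γ'}(t')]`,
the sum over charges being taken with the summation prescription `L`. -/
def SolvesTBARational {m : ℕ} (B : Data m) (σ : (Fin m → ℤ) → ℂ) (θ : Fin m → ℂ)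
    (L : SummationFilter (Fin m → ℤ)) (X : (Fin m → ℤ) → (Fin m → ℂ) → ℂ → ℂ)
    (z : Fin m → ℂ) : Prop :=
  ∀ (γ : Fin m → ℤ) (t : ℂ), t ≠ 0 →
    (∀ γ', B.ratΩ γ' ≠ 0 → B.pairing γ γ' ≠ 0 → t ∉ ray (centralCharge z γ')) →
    ∃ s : ℂ,
      HasSum (fun γ' => (B.ratΩ γ' : ℂ) * (B.pairing γ γ' : ℂ)
        * rayIntegral (centralCharge z γ') (fun t' => t / (t' - t) * X γ' z t')) s L ∧
      X γ z t = Xsf σ θ γ z t * Complex.exp (s / (2 * Real.pi * Complex.I))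

/-- The TBA equations at `z` in terms of the integer invariants:
`X_γ(t) = Xsf_γ(t) exp[(1/2πi) ∑_{γ'} Ω(γ') ⟨γ,γ'⟩ ∫_{ℓ_{γ'}} dt'/t' · t/(t-t') · log(1-X_{γ'}(t'))]`,
with the principal logarithm. -/
def SolvesTBA {m : ℕ} (B : Data m) (σ : (Fin m → ℤ) → ℂ) (θ : Fin m → ℂ)
    (L : SummationFilter (Fin m → ℤ)) (X : (Fin m → ℤ) → (Fin m → ℂ) → ℂ → ℂ)
    (z : Fin m → ℂ) : Prop :=
  ∀ (γ : Fin m → ℤ) (t : ℂ), t ≠ 0 →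
    (∀ γ', B.Ω γ' ≠ 0 → B.pairing γ γ' ≠ 0 → t ∉ ray (centralCharge z γ')) →
    ∃ s : ℂ,
      HasSum (fun γ' => (B.Ω γ' : ℂ) * (B.pairing γ γ' : ℂ)
        * rayIntegral (centralCharge z γ')
            (fun t' => t / (t - t') * Complex.log (1 - X γ' z t'))) s L ∧
      X γ z t = Xsf σ θ γ z t * Complex.exp (s / (2 * Real.pi * Complex.I))

/-- `logτ`, a function of `z ∈ W` at fixed `t` and `θ`, solves the equations of the `τ`-function,
`∑_b ω^{ab} ∂_{z^b} log τ = ∂_t log (X_{γ^a} / Xsf_{γ^a})` for all `a`. -/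
def IsLogTau {m : ℕ} (B : Data m) (σ : (Fin m → ℤ) → ℂ) (θ : Fin m → ℂ)
    (X : (Fin m → ℤ) → (Fin m → ℂ) → ℂ → ℂ) (t : ℂ) (W : Set (Fin m → ℂ))
    (logτ : (Fin m → ℂ) → ℂ) : Prop :=
  DifferentiableOn ℂ logτ W ∧ ∀ z ∈ W, ∀ a : Fin m,
    DifferentiableAt ℂ (fun s => X (Pi.single a 1) z s / Xsf σ θ (Pi.single a 1) z s) t ∧
    ∑ b, (B.ω a b : ℂ) * fderiv ℂ logτ z (Pi.single b 1)
      = logDeriv (fun s => X (Pi.single a 1) z s / Xsf σ θ (Pi.single a 1) z s) t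

/-- The `γ`-term of the integral formula for `log τ`:
`(1/4π²) σ_γ Ω̄(γ) e^{2πiθ_γ} [∫_{ℓ_γ} dt'/t' · t/(t'-t) · (1 + 2πi Z_γ/t') e^{-2πi Z_γ/t'}
  - log (Z_γ/t)]`. -/
def logTauTerm {m : ℕ} (B : Data m) (σ : (Fin m → ℤ) → ℂ) (θ : Fin m → ℂ)
    (γ : Fin m → ℤ) (p : (Fin m → ℂ) × ℂ) : ℂ :=
  1 / (4 * (Real.pi : ℂ) ^ 2) * σ γ * (B.ratΩ γ : ℂ)
    * Complex.exp (2 * Real.pi * Complex.I * angle θ γ)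
    * (rayIntegral (centralCharge p.1 γ) (fun t' => p.2 / (t' - p.2)
          * (1 + 2 * Real.pi * Complex.I * (centralCharge p.1 γ / t'))
          * Complex.exp (-2 * Real.pi * Complex.I * (centralCharge p.1 γ / t')))
        - logDown (centralCharge p.1 γ / p.2))

/-- The `γ`-term of the integral formula for `log τ` in terms of the integer invariants, i.e.
resummed over the multiples of `γ`:
`(1/4π²) Ω(γ) [∫_{ℓ_γ} dt'/t' · t/(t'-t) · (Li₂(Xsf_γ(t')) - 2πi (Z_γ/t') log(1 - Xsf_γ(t')))
  - Li₂(σ_γ e^{2πiθ_γ}) log (Z_γ/t)]`. -/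
def logTauTermResummed {m : ℕ} (B : Data m) (σ : (Fin m → ℤ) → ℂ) (θ : Fin m → ℂ)
    (γ : Fin m → ℤ) (p : (Fin m → ℂ) × ℂ) : ℂ :=
  1 / (4 * (Real.pi : ℂ) ^ 2) * (B.Ω γ : ℂ)
    * (rayIntegral (centralCharge p.1 γ) (fun t' => p.2 / (t' - p.2)
          * (dilog (Xsf σ θ γ p.1 t')
              - 2 * Real.pi * Complex.I * (centralCharge p.1 γ / t')
                * Complex.log (1 - Xsf σ θ γ p.1 t')))
        - dilog (σ γ * Complex.exp (2 * Real.pi * Complex.I * angle θ γ))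
            * logDown (centralCharge p.1 γ / p.2))

/-- The series `∑_γ f γ`, summed with the prescription `L`, converges to `T` locally uniformly
on `V`. -/
def SumsLocallyUniformly {m : ℕ} (L : SummationFilter (Fin m → ℤ))
    (f : (Fin m → ℤ) → (Fin m → ℂ) × ℂ → ℂ) (T : (Fin m → ℂ) × ℂ → ℂ)
    (V : Set ((Fin m → ℂ) × ℂ)) : Prop :=
  TendstoLocallyUniformlyOn (fun (S : Finset (Fin m → ℤ)) p => ∑ γ ∈ S, f γ p) T L.filter V

/-- `∑_{Re(Z_γ/t) > 0} Ω(γ) ℓ_γ(Z_γ/t)`; used with `ℓ_γ` a branch of `log Υ(·, 1 - [ϑ_γ])`. -/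
def barnesSum {m : ℕ} (B : Data m) (ℓ : (Fin m → ℤ) → ℂ → ℂ) (p : (Fin m → ℂ) × ℂ) : ℂ :=
  ∑ᶠ γ ∈ B.rightCharges p.1 p.2, (B.Ω γ : ℂ) * ℓ γ (centralCharge p.1 γ / p.2)

end BPS

end

namespace BPS

open Complex MeasureTheory Set Filter

noncomputable section

/-! ### Logarithms of the Gamma and Barnes functions -/

/-! Everything reduces to transforms in one complex variable. Substituting t' = iZ/u turns an
integral over the BPS ray of a charge into an integral over u > 0 in which z and t enter only
through q = -iZ/t. In the uncoupled case all coefficients in the equation of an active charge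
vanish, so the active modes are semi-flat (`SolvesTBA.eq_Xsf`). Each term of the TBA equations is
then a Stieltjes transform S(q) = ∫ φ(v)/(q+v) dv, with φ = e^{-2πv} for the rational invariants and
φ = -log(1 - y e^{-2πv}) for the integer ones. Fubini on {u < v} brings the bracket of the integral
formula into the form `tauFn φ q`.

Put J(q) = ∫ φ(v)/(q+v)² dv. Then S' = -J, while `tauFn φ` has derivative -2πqJ. Since q is linear
in z and inversely proportional to t, the t-derivative of a TBA term is 2πi times the derivative of
the matching term of log τ in the direction of a row of ω (`hasDerivAt_tbaTerm`). The Weierstrass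
convergence theorem carries this to the sums, and nondegeneracy of ω makes the solution unique up to
a constant (`isLogTau_iff_of_transform`).

In the finite case the charges γ and -γ are taken together. With w = Z_γ/t in the right half-plane,
the derivative of their joint contribution is a pair of integrals evaluated by a generalized Binet
formula (`integral_logW_add_integral_logW`), and it equals the derivative of log Υ. For the Binet
formula, integrate log(1 - e^{±2πiu})/(s-u)² along vertical half-lines starting at η. After adding
elementary terms the result does not depend on η. Comparing η = 0 with η = 1 gives the functional
equation of the digamma function; together with the asymptotics log s this determines the common
value (`binetPsi_eq_psi`). The cases Re η = 0, 1 are limits from inside the strip, on the sides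
where the principal logarithm is continuous; the bracket [ϑ] selects exactly those parameters.

For real ϑ one has |y| = 1, so log(1 - y e^{-2πv}) expands in powers under the integral. Homogeneity
of the kernel identifies the n-th power with the charge nγ, up to a constant involving log n
(`exists_hasSum_tauFn`). -/

/-- A convex neighbourhood of `0` on which the Weierstrass series converge uniformly. -/
def halfDisc (M : ℝ) : Set ℂ := {s | -(1 / 2 : ℝ) < s.re ∧ ‖s‖ < M}

lemma isOpen_halfDisc (M : ℝ) : IsOpen (halfDisc M) :=
  (isOpen_lt continuous_const continuous_re).inter (isOpen_lt continuous_norm continuous_const)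

lemma isPreconnected_halfDisc (M : ℝ) : IsPreconnected (halfDisc M) := by
  have h : halfDisc M = {s : ℂ | -(1 / 2 : ℝ) < s.re} ∩ Metric.ball 0 M := by
    ext s; simp [halfDisc]
  rw [h]
  exact ((convex_halfSpace_re_gt _).inter (convex_ball _ _)).isPreconnected

lemma half_le_norm_add {s : ℂ} (hs : -(1 / 2 : ℝ) < s.re) (n : ℕ) :
    ((n : ℝ) + 1) / 2 ≤ ‖(n : ℂ) + 1 + s‖ := by
  refine le_trans ?_ (re_le_norm _)
  have : (0 : ℝ) ≤ n := n.cast_nonneg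
  simp only [add_re, natCast_re, one_re]
  linarith

lemma one_add_div_mem_slitPlane {s : ℂ} (hs : -(1 / 2 : ℝ) < s.re) (n : ℕ) :
    1 + s / ((n : ℂ) + 1) ∈ slitPlane := by
  left
  have h : s / ((n : ℂ) + 1) = s / (((n : ℝ) + 1 : ℝ) : ℂ) := by push_cast; rfl
  rw [h, add_re, one_re, div_ofReal_re]
  have h1 : (1 : ℝ) ≤ (n : ℝ) + 1 := by have : (0 : ℝ) ≤ n := n.cast_nonneg; linarith
  have h2 : -(1 / 2 : ℝ) ≤ s.re / ((n : ℝ) + 1) := by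
    rw [le_div_iff₀ (by linarith)]; nlinarith
  linarith

lemma summable_const_div_sq (C : ℝ) : Summable fun n : ℕ => C / ((n : ℝ) + 1) ^ 2 := by
  have := (summable_nat_add_iff 1).2 (Real.summable_one_div_nat_pow.2 (one_lt_two))
  simpa [div_eq_mul_inv] using this.mul_left C

lemma natCast_add_one_add_ne_zero {s : ℂ} (hs : -(1 / 2 : ℝ) < s.re) (n : ℕ) :
    (n : ℂ) + 1 + s ≠ 0 := by
  rw [← norm_pos_iff]
  exact lt_of_lt_of_le (by positivity) (half_le_norm_add hs n)

lemma natCast_add_one_ne_zero (n : ℕ) : (n : ℂ) + 1 ≠ 0 := by exact_mod_cast n.succ_ne_zero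

lemma hasDerivAt_log_one_add_div {s : ℂ} (hs : -(1 / 2 : ℝ) < s.re) (n : ℕ) :
    HasDerivAt (fun s : ℂ => log (1 + s / ((n : ℂ) + 1))) (1 / ((n : ℂ) + 1 + s)) s := by
  have h := (((hasDerivAt_id s).div_const ((n : ℂ) + 1)).const_add 1).clog
    (one_add_div_mem_slitPlane hs n)
  have e1 := natCast_add_one_add_ne_zero hs n
  have e2 := natCast_add_one_ne_zero n
  convert! h using 1
  have : 1 + s / ((n : ℂ) + 1) ≠ 0 := slitPlane_ne_zero (one_add_div_mem_slitPlane hs n)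
  simp only [id]
  have e3 : 1 + s / ((n : ℂ) + 1) = ((n : ℂ) + 1 + s) / ((n : ℂ) + 1) := by field_simp
  rw [e3]
  field_simp

/-- The difference is s/((n+1)(n+1+s)), and n+1+s has modulus at least (n+1)/2 on the half-disc.
This one bound controls both the Gamma and the Barnes series. -/
lemma norm_inv_sub_inv_le {M : ℝ} {s : ℂ} (hs : s ∈ halfDisc M) (n : ℕ) :
    ‖1 / ((n : ℂ) + 1) - 1 / ((n : ℂ) + 1 + s)‖ ≤ 2 * M / ((n : ℝ) + 1) ^ 2 := by
  have e1 := natCast_add_one_add_ne_zero hs.1 n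
  have e2 := natCast_add_one_ne_zero n
  have h : 1 / ((n : ℂ) + 1) - 1 / ((n : ℂ) + 1 + s) = s / (((n : ℂ) + 1) * ((n : ℂ) + 1 + s)) := by
    field_simp; ring
  have h3 : ‖(n : ℂ) + 1‖ = (n : ℝ) + 1 := by
    have : (n : ℂ) + 1 = ((n + 1 : ℕ) : ℂ) := by push_cast; rfl
    rw [this, norm_natCast]; push_cast; rfl
  have hp : (0 : ℝ) < (n : ℝ) + 1 := by positivity
  rw [h, norm_div, norm_mul, h3, div_le_div_iff₀ (mul_pos hp (norm_pos_iff.2 e1)) (by positivity)]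
  have h4 := half_le_norm_add hs.1 n
  have h5 : ‖s‖ * ((n : ℝ) + 1) ^ 2 ≤ M * ((n : ℝ) + 1) ^ 2 :=
    mul_le_mul_of_nonneg_right hs.2.le (by positivity)
  have hM : 0 ≤ M := (norm_nonneg s).trans hs.2.le
  have h6 : M * ((n : ℝ) + 1) * (((n : ℝ) + 1) / 2) ≤ M * ((n : ℝ) + 1) * ‖(n : ℂ) + 1 + s‖ :=
    mul_le_mul_of_nonneg_left h4 (by positivity)
  nlinarith

lemma summable_inv_sub_inv {s : ℂ} (hs : -(1 / 2 : ℝ) < s.re) :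
    Summable fun n : ℕ => 1 / ((n : ℂ) + 1) - 1 / ((n : ℂ) + 1 + s) :=
  .of_norm_bounded (summable_const_div_sq (2 * (‖s‖ + 1)))
    fun n => norm_inv_sub_inv_le (M := ‖s‖ + 1) ⟨hs, lt_add_one _⟩ n

/-- The series `∑ (1/(n+1) - 1/(n+1+s))`. -/
def psiSeries (s : ℂ) : ℂ := ∑' n : ℕ, (1 / ((n : ℂ) + 1) - 1 / ((n : ℂ) + 1 + s))

lemma hasDerivAt_tsum_gammaTerm {s : ℂ} (hs : -(1 / 2 : ℝ) < s.re) :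
    HasDerivAt (fun s : ℂ => ∑' n : ℕ, (s / ((n : ℂ) + 1) - log (1 + s / ((n : ℂ) + 1))))
      (psiSeries s) s := by
  -- Every term vanishes at 0, so convergence there is trivial, and the summable bound on
  -- derivatives spreads it over the connected half-disc.
  refine hasDerivAt_tsum_of_isPreconnected (summable_const_div_sq (2 * (‖s‖ + 1)))
    (isOpen_halfDisc (‖s‖ + 1)) (isPreconnected_halfDisc _) (y₀ := 0) (fun n y hy => ?_)
    (fun n y hy => norm_inv_sub_inv_le hy n) ⟨by norm_num, by simp only [norm_zero]; positivity⟩ (by simp)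
    ⟨hs, lt_add_one _⟩
  exact ((hasDerivAt_id y).div_const ((n : ℂ) + 1)).sub (hasDerivAt_log_one_add_div hy.1 n)

/-- The logarithm of the `n`-th factor of the Barnes function. -/
def barnesTerm (n : ℕ) (x : ℂ) : ℂ :=
  ((n : ℂ) + 1) * log (1 + x / ((n : ℂ) + 1)) + (x ^ 2 / (2 * ((n : ℂ) + 1)) - x)

/-- (n+1)/(n+1+x) - 1 = -x/(n+1+x), so the derivative is x times that of the corresponding Gamma
term. Hence the logarithmic derivative of the Barnes function involves no new series. -/
lemma hasDerivAt_barnesTerm {x : ℂ} (hx : -(1 / 2 : ℝ) < x.re) (n : ℕ) :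
    HasDerivAt (barnesTerm n) (x * (1 / ((n : ℂ) + 1) - 1 / ((n : ℂ) + 1 + x))) x := by
  have h := ((hasDerivAt_log_one_add_div hx n).const_mul ((n : ℂ) + 1)).add
    ((((hasDerivAt_id x).pow 2).div_const (2 * ((n : ℂ) + 1))).sub (hasDerivAt_id x))
  have e1 := natCast_add_one_add_ne_zero hx n
  have e2 := natCast_add_one_ne_zero n
  convert! h using 1
  simp only [id]
  field_simp
  ring

lemma norm_deriv_barnesTerm_le {M : ℝ} {x : ℂ} (hx : x ∈ halfDisc M) (n : ℕ) :
    ‖x * (1 / ((n : ℂ) + 1) - 1 / ((n : ℂ) + 1 + x))‖ ≤ (M * (2 * M)) / ((n : ℝ) + 1) ^ 2 := by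
  rw [norm_mul, mul_div_assoc]
  exact mul_le_mul hx.2.le (norm_inv_sub_inv_le hx n) (norm_nonneg _)
    ((norm_nonneg x).trans hx.2.le)

lemma summable_barnesTerm {x : ℂ} (hx : -(1 / 2 : ℝ) < x.re) :
    Summable fun n : ℕ => barnesTerm n x :=
  summable_of_summable_hasDerivAt_of_isPreconnected (summable_const_div_sq _)
    (isOpen_halfDisc (‖x‖ + 1)) (isPreconnected_halfDisc _)
    (fun n y hy => hasDerivAt_barnesTerm hy.1 n)
    (fun n y hy => norm_deriv_barnesTerm_le hy n) (y₀ := 0) ⟨by norm_num, by simp only [norm_zero]; positivity⟩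
    (by simp [barnesTerm, summable_zero]) ⟨hx, lt_add_one _⟩

lemma hasDerivAt_tsum_barnesTerm {x : ℂ} (hx : -(1 / 2 : ℝ) < x.re) :
    HasDerivAt (fun x : ℂ => ∑' n : ℕ, barnesTerm n x) (x * psiSeries x) x := by
  have h := hasDerivAt_tsum_of_isPreconnected (summable_const_div_sq _)
    (isOpen_halfDisc (‖x‖ + 1)) (isPreconnected_halfDisc _)
    (fun n y hy => hasDerivAt_barnesTerm hy.1 n)
    (fun n y hy => norm_deriv_barnesTerm_le hy n) (y₀ := 0) ⟨by norm_num, by simp only [norm_zero]; positivity⟩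
    (by simp [barnesTerm, summable_zero]) (y := x) ⟨hx, lt_add_one _⟩
  rwa [tsum_mul_left] at h

/-- The Euler constant as a complex number. -/
def eulerC : ℂ := (Real.eulerMascheroniConstant : ℂ)

/-- The logarithm of the Barnes function `G(1 + x)`. -/
def logBarnes (x : ℂ) : ℂ :=
  log (2 * Real.pi) * (x / 2) + (-(x + (1 + eulerC) * x ^ 2) / 2) + ∑' n : ℕ, barnesTerm n x

lemma exp_logBarnes {x : ℂ} (hx : -(1 / 2 : ℝ) < x.re) : exp (logBarnes x) = barnesG (x + 1) := by
  have h2 : (2 * Real.pi : ℂ) ≠ 0 := by exact_mod_cast Real.two_pi_pos.ne'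
  have h := (summable_barnesTerm hx).hasSum.cexp.tprod_eq
  rw [logBarnes, exp_add, exp_add, ← cpow_def_of_ne_zero h2, ← h, barnesG, add_sub_cancel_right,
    eulerC]
  congr 1
  refine tprod_congr fun n => ?_
  have e : 1 + x / ((n : ℂ) + 1) ≠ 0 := slitPlane_ne_zero (one_add_div_mem_slitPlane hx n)
  -- The multiplicity n+1 is an integer, so the branch of the logarithm disappears after
  -- exponentiation.
  have e3 : exp (((n : ℂ) + 1) * log (1 + x / ((n : ℂ) + 1))) = (1 + x / ((n : ℂ) + 1)) ^ (n + 1) := by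
    have := exp_nat_mul (log (1 + x / ((n : ℂ) + 1))) (n + 1)
    rw [exp_log e] at this
    rw [← this]; push_cast; rfl
  simp only [Function.comp, barnesTerm]
  rw [exp_add, e3]

lemma hasDerivAt_logBarnes {x : ℂ} (hx : -(1 / 2 : ℝ) < x.re) :
    HasDerivAt logBarnes (log (2 * Real.pi) / 2 - (1 / 2 + (1 + eulerC) * x) + x * psiSeries x)
      x := by
  have h1 := (((hasDerivAt_id x).div_const 2).const_mul (log (2 * Real.pi)))
  have h2 := (((hasDerivAt_id x).add (((hasDerivAt_id x).pow 2).const_mul (1 + eulerC))).neg).div_const 2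
  convert! (h1.add h2).add (hasDerivAt_tsum_barnesTerm hx) using 1
  simp only [id]
  ring

/-- The logarithmic derivative of the Gamma function, by its partial fraction series. -/
def psi (s : ℂ) : ℂ := -eulerC - 1 / s + psiSeries s

lemma hasDerivAt_logGamma {s : ℂ} (hs : 0 < s.re) : HasDerivAt logGamma (psi s) s := by
  have h0 : s ∈ slitPlane := Or.inl hs
  have h := (((hasDerivAt_id s).const_mul (-eulerC)).sub (hasDerivAt_log h0)).add
    (hasDerivAt_tsum_gammaTerm (s := s) (by linarith))
  convert! h using 1
  simp [psi]

/-! ### Logarithms of the generalized Barnes function -/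

/-- The logarithm of the generalized Barnes function `Υ(w, η)`. -/
def logUpsilon (η w : ℂ) : ℂ :=
  (3 / 4 * w ^ 2 - deriv riemannZeta (-1)) + logBarnes (w + η)
    - (log (2 * Real.pi) * (w / 2) + log w * (w ^ 2 / 2) + η * logGamma (w + η))

lemma exp_logUpsilon {η w : ℂ} (hη : 0 ≤ η.re) (hw : 0 < w.re) :
    exp (logUpsilon η w) = Upsilon w η := by
  have h2 : (2 * Real.pi : ℂ) ≠ 0 := by exact_mod_cast Real.two_pi_pos.ne'
  have h0 : w ≠ 0 := by rintro rfl; simp at hw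
  rw [logUpsilon, exp_sub, exp_add, exp_add, exp_add, exp_logBarnes (by simp; linarith),
    ← cpow_def_of_ne_zero h2, ← cpow_def_of_ne_zero h0, Upsilon]

/-- The Barnes factor contributes (w+η)ψ(w+η) and the power of Γ removes ηψ(w+η). The terms linear
in w cancel because of the prefactor 3w²/4. What remains is w times the right-hand side of the
generalized Binet formula, without its factor 2π. -/
lemma hasDerivAt_logUpsilon {η w : ℂ} (hη : 0 ≤ η.re) (hw : 0 < w.re) :
    HasDerivAt (logUpsilon η) (w * (psi (w + η) - log w) - (η - 1 / 2)) w := by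
  have hx : 0 < (w + η).re := by simp; linarith
  have h0 : w ≠ 0 := by rintro rfl; simp at hw
  have hx0 : w + η ≠ 0 := fun h => by simp [h] at hx
  have hs : HasDerivAt (fun w => w + η) 1 w := (hasDerivAt_id w).add_const η
  have h1 := (((hasDerivAt_id w).pow 2).const_mul (3 / 4 : ℂ)).sub_const (deriv riemannZeta (-1))
  have h2 := (hasDerivAt_logBarnes (x := w + η) (by linarith)).comp w hs
  have h3 := ((hasDerivAt_id w).div_const 2).const_mul (log (2 * Real.pi))
  have h4 := (hasDerivAt_log (Or.inl hw : w ∈ slitPlane)).mul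
    (((hasDerivAt_id w).pow 2).div_const 2)
  have h5 := ((hasDerivAt_logGamma hx).comp w hs).const_mul η
  convert! (h1.add h2).sub ((h3.add h4).add h5) using 1
  simp only [id, psi, Pi.pow_apply]
  field_simp
  ring

lemma isLogUpsilon_logUpsilon {η : ℂ} (hη : 0 ≤ η.re) : IsLogUpsilon η (logUpsilon η) :=
  ⟨fun _ hw => (hasDerivAt_logUpsilon hη hw).continuousAt.continuousWithinAt,
    fun _ hw => exp_logUpsilon hη hw⟩

/-- Two branches of `log Υ(·, η)` differ by a constant. -/
lemma IsLogUpsilon.exists_const {η : ℂ} {l₁ l₂ : ℂ → ℂ} (h₁ : IsLogUpsilon η l₁)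
    (h₂ : IsLogUpsilon η l₂) : ∃ c : ℂ, ∀ w : ℂ, 0 < w.re → l₁ w = l₂ w + c := by
  have hpre : IsPreconnected {w : ℂ | 0 < w.re} := (convex_halfSpace_re_gt 0).isPreconnected
  -- The difference of two branches, divided by 2πi, is continuous with integer values on a
  -- connected set.
  have key : ∀ w ∈ {w : ℂ | 0 < w.re}, ∃ n : ℤ, (l₁ w - l₂ w) / (2 * Real.pi * I) = n := by
    intro w hw
    obtain ⟨n, hn⟩ := exp_eq_exp_iff_exists_int.1 ((h₁.2 w hw).trans (h₂.2 w hw).symm)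
    refine ⟨n, ?_⟩
    rw [hn, add_sub_cancel_left, mul_div_assoc, div_self two_pi_I_ne_zero, mul_one]
  have hcont : ContinuousOn (fun w => ((l₁ w - l₂ w) / (2 * Real.pi * I)).re) {w : ℂ | 0 < w.re} :=
    continuous_re.comp_continuousOn ((h₁.1.sub h₂.1).div_const _)
  have hmem1 : (1 : ℂ) ∈ {w : ℂ | 0 < w.re} := by simp
  have hconst : ∀ w ∈ {w : ℂ | 0 < w.re}, ((l₁ w - l₂ w) / (2 * Real.pi * I)).re
      = ((l₁ 1 - l₂ 1) / (2 * Real.pi * I)).re := by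
    intro w hw
    have hdisc : IsDiscrete (Set.range ((↑) : ℤ → ℝ)) := by
      rw [← image_univ]
      exact IsDiscrete.univ.image Int.isClosedEmbedding_coe_real.isInducing
    refine hpre.constant_of_mapsTo hdisc hcont ?_ hw hmem1
    intro x hx
    obtain ⟨n, hn⟩ := key x hx
    exact ⟨n, by beta_reduce; rw [hn]; simp⟩
  refine ⟨l₁ 1 - l₂ 1, fun w hw => ?_⟩
  obtain ⟨n, hn⟩ := key w hw
  obtain ⟨k, hk⟩ := key 1 hmem1
  have h := hconst w hw
  rw [hn, hk] at h
  have h' : (n : ℂ) = k := by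
    have h1 : (n : ℝ) = k := by simpa using h
    exact_mod_cast h1
  rw [← hn, ← hk, div_left_inj' two_pi_I_ne_zero] at h'
  rw [← h']; ring

/-! ### Stieltjes transforms on the slit plane -/

lemma add_ofReal_mem_slitPlane {q : ℂ} (hq : q ∈ slitPlane) {v : ℝ} (hv : 0 ≤ v) :
    q + v ∈ slitPlane := by
  rcases hq with h | h
  · left; simp; linarith
  · right; simpa using h

/-- Near a point of the slit plane, the distance to the cut is bounded below. -/
lemma exists_le_norm_add {q : ℂ} (hq : q ∈ slitPlane) :
    ∃ δ : ℝ, 0 < δ ∧ ∀ q' ∈ Metric.ball q δ, q' ∈ slitPlane ∧ ∀ v : ℝ, 0 ≤ v → δ ≤ ‖q' + v‖ := by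
  have key : ∃ δ : ℝ, 0 < δ ∧ (2 * δ ≤ q.re ∨ 2 * δ ≤ |q.im|) := by
    rcases hq with h | h
    · exact ⟨q.re / 2, by positivity, Or.inl (by linarith)⟩
    · exact ⟨|q.im| / 2, by positivity, Or.inr (by linarith)⟩
  obtain ⟨δ, hδ, h⟩ := key
  refine ⟨δ, hδ, fun q' hq' => ?_⟩
  rw [Metric.mem_ball, dist_eq_norm] at hq'
  rcases h with h | h
  · have h1 := (abs_re_le_norm (q' - q)).trans_lt hq'
    rw [sub_re, abs_lt] at h1
    refine ⟨Or.inl (by linarith), fun v hv => le_trans ?_ (re_le_norm _)⟩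
    simp; linarith
  · have h1 := (abs_im_le_norm (q' - q)).trans_lt hq'
    rw [sub_im] at h1
    have h2 := abs_sub_abs_le_abs_sub q.im q'.im
    rw [abs_sub_comm] at h2
    have h3 : δ ≤ |q'.im| := by linarith
    refine ⟨Or.inr (abs_pos.1 (hδ.trans_le h3)), fun v hv => le_trans ?_ (abs_im_le_norm _)⟩
    simpa using h3

/-- The Stieltjes transform `∫ φ(v)/(q+v) dv` over the positive half-line. -/
def stieltjes (φ : ℝ → ℂ) (q : ℂ) : ℂ := ∫ v in Ioi (0 : ℝ), φ v / (q + v)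

/-- The kernel `v/(q+v) + log (q+v)`. -/
def kernelLog (q : ℂ) (v : ℝ) : ℂ := v / (q + v) + log (q + v)

/-- The transform `∫ φ(v) (v/(q+v) + log (q+v)) dv` over the positive half-line. -/
def logStieltjes (φ : ℝ → ℂ) (q : ℂ) : ℂ := ∫ v in Ioi (0 : ℝ), φ v * kernelLog q v

lemma measurable_inv_add (q : ℂ) : Measurable fun v : ℝ => (q + v)⁻¹ :=
  (measurable_const.add measurable_ofReal).inv

lemma measurable_kernelLog (q : ℂ) : Measurable (kernelLog q) :=
  (measurable_ofReal.div (measurable_const.add measurable_ofReal)).add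
    (measurable_log.comp (measurable_const.add measurable_ofReal))

lemma abs_log_le {x δ : ℝ} (hδ : 0 < δ) (hx : δ ≤ x) : |Real.log x| ≤ x + 1 / δ := by
  have hx0 : 0 < x := hδ.trans_le hx
  rw [abs_le]
  have h1 := Real.log_le_sub_one_of_pos hx0
  have h2 := Real.log_le_sub_one_of_pos (inv_pos.2 hx0)
  rw [Real.log_inv] at h2
  have h3 : x⁻¹ ≤ 1 / δ := by rw [one_div]; exact inv_anti₀ hδ hx
  have h4 : 0 < 1 / δ := by positivity
  constructor <;> linarith

lemma norm_clog_le (z : ℂ) : ‖log z‖ ≤ |Real.log ‖z‖| + Real.pi := by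
  refine (norm_le_abs_re_add_abs_im _).trans ?_
  rw [log_re, log_im]
  exact add_le_add_right (abs_arg_le_pi z) _

lemma norm_kernelLog_le {q : ℂ} {δ v : ℝ} (hδ : 0 < δ) (hv : 0 ≤ v) (h : δ ≤ ‖q + v‖) :
    ‖kernelLog q v‖ ≤ (1 / δ + ‖q‖ + 1 + Real.pi) * (1 + v) := by
  have h1 : ‖(v : ℂ) / (q + v)‖ ≤ v * (1 / δ) := by
    rw [norm_div, norm_real, Real.norm_of_nonneg hv, div_eq_mul_one_div]
    exact mul_le_mul_of_nonneg_left (one_div_le_one_div_of_le hδ h) hv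
  have h2 := norm_clog_le (q + v)
  have h3 := abs_log_le hδ h
  have h4 : ‖q + v‖ ≤ ‖q‖ + v := by
    refine (norm_add_le _ _).trans ?_
    rw [norm_real, Real.norm_of_nonneg hv]
  have h5 := norm_add_le ((v : ℂ) / (q + v)) (log (q + v))
  have h6 : 0 < 1 / δ := by positivity
  have h7 := mul_nonneg (norm_nonneg q) hv
  have h8 := mul_nonneg Real.pi_pos.le hv
  rw [kernelLog]
  nlinarith

lemma integrableOn_mul_kernelLog {φ : ℝ → ℂ} (hφ : IntegrableOn φ (Ioi 0))
    (hφ' : IntegrableOn (fun v => v * φ v) (Ioi 0)) {q : ℂ} (hq : q ∈ slitPlane) :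
    IntegrableOn (fun v => φ v * kernelLog q v) (Ioi 0) := by
  obtain ⟨δ, hδ, h⟩ := exists_le_norm_add hq
  have h := (h q (Metric.mem_ball_self hδ)).2
  set C := 1 / δ + ‖q‖ + 1 + Real.pi
  refine Integrable.mono' ((hφ.norm.add hφ'.norm).const_mul C)
    (hφ.aestronglyMeasurable.mul (measurable_kernelLog q).aestronglyMeasurable) ?_
  refine (ae_restrict_iff' measurableSet_Ioi).2 (.of_forall fun v (hv : 0 < v) => ?_)
  rw [norm_mul]
  have h1 := mul_le_mul_of_nonneg_left (norm_kernelLog_le hδ hv.le (h v hv.le)) (norm_nonneg (φ v))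
  refine h1.trans (le_of_eq ?_)
  simp only [Pi.add_apply, norm_mul, norm_real, Real.norm_of_nonneg hv.le]
  ring

lemma integrableOn_div_add {φ : ℝ → ℂ} (hφ : IntegrableOn φ (Ioi 0)) {q : ℂ}
    (hq : q ∈ slitPlane) : IntegrableOn (fun v => φ v / (q + v)) (Ioi 0) := by
  obtain ⟨δ, hδ, h⟩ := exists_le_norm_add hq
  have h := (h q (Metric.mem_ball_self hδ)).2
  simp only [div_eq_mul_inv]
  refine Integrable.mono' (hφ.norm.mul_const (1 / δ))
    (hφ.aestronglyMeasurable.mul (measurable_inv_add q).aestronglyMeasurable) ?_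
  refine (ae_restrict_iff' measurableSet_Ioi).2 (.of_forall fun v (hv : 0 < v) => ?_)
  rw [norm_mul, norm_inv, ← one_div]
  exact mul_le_mul_of_nonneg_left (one_div_le_one_div_of_le hδ (h v hv.le)) (norm_nonneg _)

lemma hasDerivAt_stieltjes {φ : ℝ → ℂ} (hφ : IntegrableOn φ (Ioi 0)) {q : ℂ}
    (hq : q ∈ slitPlane) :
    HasDerivAt (stieltjes φ) (-∫ v in Ioi (0 : ℝ), φ v / (q + v) ^ 2) q := by
  obtain ⟨δ, hδ, h⟩ := exists_le_norm_add hq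
  rw [← integral_neg]
  refine (hasDerivAt_integral_of_dominated_loc_of_deriv_le (Metric.ball_mem_nhds q hδ)
    (F := fun q v => φ v / (q + v)) (F' := fun q v => -(φ v / (q + v) ^ 2))
    (bound := fun v => ‖φ v‖ * (1 / δ) ^ 2) (.of_forall fun q' => ?_)
    (integrableOn_div_add hφ hq) ?_ ?_ (hφ.norm.mul_const _) ?_).2
  · simp only [div_eq_mul_inv]
    exact hφ.aestronglyMeasurable.mul (measurable_inv_add q').aestronglyMeasurable
  · simp only [div_eq_mul_inv, ← inv_pow]
    exact (hφ.aestronglyMeasurable.mul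
      ((measurable_inv_add q).pow_const 2).aestronglyMeasurable).neg
  · refine (ae_restrict_iff' measurableSet_Ioi).2 (.of_forall fun v (hv : 0 < v) q' hq' => ?_)
    have h1 := (h q' hq').2 v hv.le
    rw [norm_neg, norm_div, norm_pow, div_eq_mul_one_div, ← one_div_pow]
    gcongr
  · refine (ae_restrict_iff' measurableSet_Ioi).2 (.of_forall fun v (hv : 0 < v) q' hq' => ?_)
    have h1 : q' + v ≠ 0 := norm_pos_iff.1 (hδ.trans_le ((h q' hq').2 v hv.le))
    have h2 := (hasDerivAt_const q' (φ v)).div ((hasDerivAt_id q').add_const (v : ℂ)) h1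
    convert! h2 using 1
    simp [neg_div]

/-- -v/(q+v)² + 1/(q+v) = q/(q+v)²: the kernel is chosen so that the factor q comes out of the
integral. -/
lemma hasDerivAt_kernelLog {q : ℂ} {v : ℝ} (h : q + v ∈ slitPlane) :
    HasDerivAt (fun q => kernelLog q v) (q / (q + v) ^ 2) q := by
  have h1 : q + v ≠ 0 := slitPlane_ne_zero h
  have h2 := ((hasDerivAt_const q (v : ℂ)).div ((hasDerivAt_id q).add_const (v : ℂ)) h1).add
    (((hasDerivAt_id q).add_const (v : ℂ)).clog h)
  convert! h2 using 1
  simp only [id]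
  field_simp
  ring

/-- Up to the factor -q this is the derivative of `stieltjes φ`; the τ-function equations rest on
this proportionality. The kernel grows linearly in v, which is why the first moment of φ must be
integrable. -/
lemma hasDerivAt_logStieltjes {φ : ℝ → ℂ} (hφ : IntegrableOn φ (Ioi 0))
    (hφ' : IntegrableOn (fun v => v * φ v) (Ioi 0)) {q : ℂ} (hq : q ∈ slitPlane) :
    HasDerivAt (logStieltjes φ) (q * ∫ v in Ioi (0 : ℝ), φ v / (q + v) ^ 2) q := by
  obtain ⟨δ, hδ, h⟩ := exists_le_norm_add hq
  rw [← integral_const_mul]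
  refine (hasDerivAt_integral_of_dominated_loc_of_deriv_le (Metric.ball_mem_nhds q hδ)
    (F := fun q v => φ v * kernelLog q v) (F' := fun q v => q * (φ v / (q + v) ^ 2))
    (bound := fun v => (‖q‖ + δ) * (‖φ v‖ * (1 / δ) ^ 2)) (.of_forall fun q' => ?_)
    (integrableOn_mul_kernelLog hφ hφ' hq) ?_ ?_ ((hφ.norm.mul_const _).const_mul _) ?_).2
  · exact hφ.aestronglyMeasurable.mul (measurable_kernelLog q').aestronglyMeasurable
  · simp only [div_eq_mul_inv, ← inv_pow]
    exact (hφ.aestronglyMeasurable.mul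
      ((measurable_inv_add q).pow_const 2).aestronglyMeasurable).const_mul _
  · refine (ae_restrict_iff' measurableSet_Ioi).2 (.of_forall fun v (hv : 0 < v) q' hq' => ?_)
    have h1 := (h q' hq').2 v hv.le
    have h2 : ‖q'‖ ≤ ‖q‖ + δ := by
      rw [Metric.mem_ball, dist_eq_norm] at hq'
      have := norm_sub_norm_le q' q
      linarith
    rw [norm_mul, norm_div, norm_pow, div_eq_mul_one_div, ← one_div_pow]
    gcongr
  · refine (ae_restrict_iff' measurableSet_Ioi).2 (.of_forall fun v (hv : 0 < v) q' hq' => ?_)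
    have h2 := (hasDerivAt_kernelLog (add_ofReal_mem_slitPlane (h q' hq').1 hv.le)).const_mul (φ v)
    convert! h2 using 1
    ring

/-! ### Transforms of tails and integration by parts -/

/-- `∫_u^∞ φ`. -/
def tail (φ : ℝ → ℂ) (u : ℝ) : ℂ := ∫ v in Ioi u, φ v

lemma integral_inv_add {q : ℂ} (hq : q ∈ slitPlane) {v : ℝ} (hv : 0 ≤ v) :
    ∫ u in Ioo 0 v, (q + (u : ℂ))⁻¹ = log (q + v) - log q := by
  rw [← integral_Ioc_eq_integral_Ioo, ← intervalIntegral.integral_of_le hv]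
  have hmem : ∀ u ∈ uIcc 0 v, q + (u : ℂ) ∈ slitPlane := fun u hu => by
    rw [uIcc_of_le hv] at hu
    exact add_ofReal_mem_slitPlane hq hu.1
  rw [intervalIntegral.integral_eq_sub_of_hasDerivAt (f := fun u : ℝ => log (q + u))]
  · simp
  · intro u hu
    have h := ((hasDerivAt_id u).ofReal_comp.const_add q).clog_real (hmem u hu)
    simpa [one_div] using h
  · refine ContinuousOn.intervalIntegrable fun u hu => ContinuousAt.continuousWithinAt ?_
    exact (continuous_const.add continuous_ofReal).continuousAt.inv₀ (slitPlane_ne_zero (hmem u hu))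

/-- Hypothesis for Fubini on {0 < u < v}: with |q+u| ≥ δ, integrating the modulus over u gives at
most v|φ(v)|/δ, which is integrable by the moment assumption. -/
lemma integrable_tail_kernel {φ : ℝ → ℂ} (hφ : IntegrableOn φ (Ioi 0))
    (hφ' : IntegrableOn (fun v => v * φ v) (Ioi 0)) {q : ℂ} (hq : q ∈ slitPlane) :
    Integrable (fun p : ℝ × ℝ => {p : ℝ × ℝ | p.1 < p.2}.indicator
      (fun p => φ p.2 * (q + p.1)⁻¹) p)
      ((volume.restrict (Ioi (0 : ℝ))).prod (volume.restrict (Ioi (0 : ℝ)))) := by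
  obtain ⟨δ, hδ, h⟩ := exists_le_norm_add hq
  have h := (h q (Metric.mem_ball_self hδ)).2
  have hmeas : AEStronglyMeasurable (fun p : ℝ × ℝ => {p : ℝ × ℝ | p.1 < p.2}.indicator
      (fun p => φ p.2 * (q + p.1)⁻¹) p)
      ((volume.restrict (Ioi (0 : ℝ))).prod (volume.restrict (Ioi (0 : ℝ)))) := by
    refine AEStronglyMeasurable.indicator ?_ (measurableSet_lt measurable_fst measurable_snd)
    exact hφ.aestronglyMeasurable.comp_snd.mul
      ((measurable_inv_add q).comp measurable_fst).aestronglyMeasurable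
  have hle : ∀ v : ℝ, 0 < v → ∀ u : ℝ, 0 < u → ‖{p : ℝ × ℝ | p.1 < p.2}.indicator
      (fun p => φ p.2 * (q + p.1)⁻¹) (u, v)‖ ≤ (Ioo 0 v).indicator (fun _ => ‖φ v‖ * (1 / δ)) u := by
    intro v hv u hu
    by_cases huv : u < v
    · rw [indicator_of_mem (by exact huv), indicator_of_mem (by exact ⟨hu, huv⟩), norm_mul, norm_inv,
        ← one_div]
      exact mul_le_mul_of_nonneg_left (one_div_le_one_div_of_le hδ (h u hu.le)) (norm_nonneg _)
    · rw [indicator_of_notMem (by exact huv), norm_zero]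
      exact indicator_nonneg (fun _ _ => by positivity) _
  have hI : ∀ v : ℝ, Integrable ((Ioo 0 v).indicator (fun _ => ‖φ v‖ * (1 / δ)))
      (volume.restrict (Ioi (0 : ℝ))) := fun v =>
    ((integrable_indicator_iff measurableSet_Ioo).2 (integrableOn_const (by simp))).restrict
  refine (integrable_prod_iff' hmeas).2 ⟨?_, ?_⟩
  · have hae := hmeas.prod_swap
    filter_upwards [hae.prodMk_left, ae_restrict_mem measurableSet_Ioi] with v h1 hv
    refine Integrable.mono' (hI v) h1 ?_
    exact (ae_restrict_iff' measurableSet_Ioi).2 (.of_forall fun u hu => hle v hv u hu)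
  · refine Integrable.mono' (hφ'.norm.mul_const (1 / δ))
      hmeas.norm.prod_swap.integral_prod_right' ?_
    refine (ae_restrict_iff' measurableSet_Ioi).2 (.of_forall fun v (hv : 0 < v) => ?_)
    rw [Real.norm_of_nonneg (integral_nonneg fun _ => norm_nonneg _)]
    have h1 : ∫ u in Ioi (0 : ℝ), (Ioo 0 v).indicator (fun _ => ‖φ v‖ * (1 / δ)) u
        = ‖(v : ℂ) * φ v‖ * (1 / δ) := by
      rw [setIntegral_indicator measurableSet_Ioo, inter_eq_right.2 Ioo_subset_Ioi_self]
      simp [hv.le, mul_assoc, abs_of_pos hv]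
    rw [← h1]
    refine integral_mono_of_nonneg (.of_forall fun _ => norm_nonneg _) (hI v) ?_
    exact (ae_restrict_iff' measurableSet_Ioi).2 (.of_forall fun u hu => hle v hv u hu)

lemma integral_tail_kernel (φ : ℝ → ℂ) (q : ℂ) {u : ℝ} (hu : 0 < u) :
    ∫ v in Ioi (0 : ℝ), {p : ℝ × ℝ | p.1 < p.2}.indicator (fun p => φ p.2 * (q + p.1)⁻¹) (u, v)
      = tail φ u / (q + u) := by
  have h : (fun v : ℝ => {p : ℝ × ℝ | p.1 < p.2}.indicator (fun p => φ p.2 * (q + p.1)⁻¹) (u, v))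
      = (Ioi u).indicator (fun v => φ v * (q + u)⁻¹) := by
    ext v; simp only [indicator, mem_Ioi, mem_ofPred_eq]
  rw [h, setIntegral_indicator measurableSet_Ioi, inter_eq_right.2 (Ioi_subset_Ioi hu.le),
    integral_mul_const, tail, div_eq_mul_inv]

lemma integrableOn_tail_div {φ : ℝ → ℂ} (hφ : IntegrableOn φ (Ioi 0))
    (hφ' : IntegrableOn (fun v => v * φ v) (Ioi 0)) {q : ℂ} (hq : q ∈ slitPlane) :
    IntegrableOn (fun u => tail φ u / (q + u)) (Ioi 0) :=
  (integrable_tail_kernel hφ hφ' hq).integral_prod_left.congr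
    ((ae_restrict_iff' measurableSet_Ioi).2
      (.of_forall fun _ hu => integral_tail_kernel φ q hu))

lemma integral_tail_div {φ : ℝ → ℂ} (hφ : IntegrableOn φ (Ioi 0))
    (hφ' : IntegrableOn (fun v => v * φ v) (Ioi 0)) {q : ℂ} (hq : q ∈ slitPlane) :
    ∫ u in Ioi (0 : ℝ), tail φ u / (q + u)
      = ∫ v in Ioi (0 : ℝ), φ v * (log (q + v) - log q) := by
  rw [← setIntegral_congr_fun measurableSet_Ioi fun u hu => integral_tail_kernel φ q hu,
    integral_integral_swap (f := fun u v => {p : ℝ × ℝ | p.1 < p.2}.indicator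
      (fun p => φ p.2 * (q + p.1)⁻¹) (u, v)) (integrable_tail_kernel hφ hφ' hq)]
  refine setIntegral_congr_fun measurableSet_Ioi fun v hv => ?_
  have hv : 0 < v := hv
  have h : (fun u : ℝ => {p : ℝ × ℝ | p.1 < p.2}.indicator (fun p => φ p.2 * (q + p.1)⁻¹) (u, v))
      = (Iio v).indicator (fun u => φ v * (q + u)⁻¹) := by
    ext u; simp only [indicator, mem_Iio, mem_ofPred_eq]
  rw [h, setIntegral_indicator measurableSet_Iio, Ioi_inter_Iio, integral_const_mul,
    integral_inv_add hq hv.le]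

/-- Integration by parts for the transform of `∫_u^∞ φ + u φ(u)`. -/
lemma integral_tail_add_mul_div {φ : ℝ → ℂ} (hφ : IntegrableOn φ (Ioi 0))
    (hφ' : IntegrableOn (fun v => v * φ v) (Ioi 0)) {q : ℂ} (hq : q ∈ slitPlane) :
    (∫ u in Ioi (0 : ℝ), (tail φ u + u * φ u) / (q + u)) + tail φ 0 * log q
      = logStieltjes φ q := by
  have h1 := integrableOn_tail_div hφ hφ' hq
  have h2 := integrableOn_div_add hφ' hq
  have h3 := integrableOn_mul_kernelLog hφ hφ' hq
  have h5 : IntegrableOn (fun v => φ v * kernelLog q v - v * φ v / (q + v)) (Ioi 0) := h3.sub h2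
  have h4 : ∫ v in Ioi (0 : ℝ), φ v * (log (q + v) - log q)
      = logStieltjes φ q - (∫ v in Ioi (0 : ℝ), v * φ v / (q + v)) - tail φ 0 * log q := by
    rw [tail, ← integral_mul_const, logStieltjes, ← integral_sub h3 h2,
      ← integral_sub h5 (hφ.mul_const _)]
    refine setIntegral_congr_fun measurableSet_Ioi fun v _ => ?_
    simp only [kernelLog]
    ring
  simp only [add_div]
  rw [integral_add h1 h2, integral_tail_div hφ hφ' hq, h4]
  ring

/-! ### The weights `-log (1 - y e^{-2πv})` -/

/-- The weight `v ↦ e^{-2πv}`. -/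
def expW (v : ℝ) : ℂ := (Real.exp (-(2 * Real.pi) * v) : ℝ)

/-- The weight `v ↦ -log (1 - y e^{-2πv})`. -/
def logW (y : ℂ) (v : ℝ) : ℂ := -log (1 - y * expW v)

lemma norm_expW (v : ℝ) : ‖expW v‖ = Real.exp (-(2 * Real.pi) * v) := by
  rw [expW, norm_real, Real.norm_of_nonneg (Real.exp_pos _).le]

lemma continuous_expW : Continuous expW := by
  unfold expW; fun_prop

lemma measurable_logW (y : ℂ) : Measurable (logW y) :=
  (measurable_log.comp (measurable_const.sub
    (measurable_const.mul continuous_expW.measurable))).neg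

lemma integrableOn_exp_neg_two_pi (a : ℝ) :
    IntegrableOn (fun v : ℝ => Real.exp (-(2 * Real.pi) * v)) (Ioi a) :=
  exp_neg_integrableOn_Ioi a Real.two_pi_pos

lemma mul_exp_neg_two_pi_le {v : ℝ} (hv : 0 ≤ v) :
    v * Real.exp (-(2 * Real.pi) * v) ≤ Real.exp (-1 * v) := by
  have h1 : v ≤ Real.exp v := by linarith [Real.add_one_le_exp v]
  calc v * Real.exp (-(2 * Real.pi) * v) ≤ Real.exp v * Real.exp (-(2 * Real.pi) * v) := by gcongr
    _ = Real.exp (v + -(2 * Real.pi) * v) := (Real.exp_add _ _).symm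
    _ ≤ Real.exp (-1 * v) := by
      apply Real.exp_le_exp.2
      nlinarith [Real.pi_gt_three]

lemma integrableOn_mul_exp_neg_two_pi :
    IntegrableOn (fun v : ℝ => v * Real.exp (-(2 * Real.pi) * v)) (Ioi 0) := by
  refine Integrable.mono' (exp_neg_integrableOn_Ioi 0 one_pos) (by fun_prop) ?_
  refine (ae_restrict_iff' measurableSet_Ioi).2 (.of_forall fun v (hv : 0 < v) => ?_)
  rw [Real.norm_of_nonneg (by positivity)]
  exact mul_exp_neg_two_pi_le hv.le

lemma integrableOn_expW : IntegrableOn expW (Ioi 0) :=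
  (integrableOn_exp_neg_two_pi 0).ofReal

lemma integrableOn_mul_expW : IntegrableOn (fun v : ℝ => (v : ℂ) * expW v) (Ioi 0) := by
  simpa [expW] using! integrableOn_mul_exp_neg_two_pi.ofReal (𝕜 := ℂ)

lemma norm_log_one_sub_le_of_le_half {x : ℂ} (hx : ‖x‖ ≤ 1 / 2) :
    ‖log (1 - x)‖ ≤ 3 / 2 * ‖x‖ := by
  have := norm_log_one_add_half_le_self (z := -x) (by simpa using hx)
  simpa [sub_eq_add_neg] using this

/-- The bound depends on x only through its modulus. It therefore serves as a dominating function
while x moves on a circle, even when that circle crosses the cut. -/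
lemma norm_log_one_sub_le {x : ℂ} (hx : ‖x‖ ≠ 1) :
    ‖log (1 - x)‖ ≤ |Real.log (1 - ‖x‖)| + 8 * ‖x‖ := by
  have h0 := norm_nonneg x
  rcases le_or_gt ‖x‖ (1 / 2) with h | h
  · have := norm_log_one_sub_le_of_le_half h
    have := abs_nonneg (Real.log (1 - ‖x‖))
    linarith
  · have h1 := norm_clog_le (1 - x)
    -- For ‖x‖ > 1/2 the argument is at most π < 7‖x‖. One further ‖x‖ bounds log(1+‖x‖), whence the
    -- constant 8.
    have hpi : Real.pi ≤ 7 * ‖x‖ := by linarith [Real.pi_lt_d2]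
    have h2 : |1 - ‖x‖| ≤ ‖1 - x‖ := by
      simpa using abs_norm_sub_norm_le (1 : ℂ) x
    have h3 : ‖1 - x‖ ≤ 1 + ‖x‖ := by simpa using norm_sub_le (1 : ℂ) x
    have h4 : 0 < |1 - ‖x‖| := abs_pos.2 (sub_ne_zero.2 (Ne.symm hx))
    have h5 : |Real.log ‖1 - x‖| ≤ |Real.log (1 - ‖x‖)| + ‖x‖ := by
      rw [abs_le]
      have h6 := Real.log_le_log h4 h2
      rw [Real.log_abs] at h6
      have h7 := Real.log_le_sub_one_of_pos (h4.trans_le h2)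
      have h8 := neg_abs_le (Real.log (1 - ‖x‖))
      have h9 := abs_nonneg (Real.log (1 - ‖x‖))
      constructor <;> linarith
    linarith

/-- For arbitrary y the weight may have a logarithmic singularity at a point with y e^{-2πv} = 1. On
a bounded interval the log-modulus of an analytic function is integrable through its zeros and the
argument is at most π; beyond T the weight decays exponentially. -/
lemma integrableOn_logW_aux (y : ℂ) :
    IntegrableOn (logW y) (Ioi 0) ∧ IntegrableOn (fun v : ℝ => (v : ℂ) * logW y v) (Ioi 0) := by
  obtain ⟨T, hT0, hT⟩ : ∃ T : ℝ, 0 < T ∧ ∀ v, T < v → ‖y * expW v‖ ≤ 1 / 2 := by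
    have h : Tendsto (fun v : ℝ => ‖y‖ * Real.exp (-(2 * Real.pi) * v)) atTop (𝓝 (‖y‖ * 0)) := by
      refine Tendsto.const_mul _ (Real.tendsto_exp_atBot.comp ?_)
      exact tendsto_id.const_mul_atTop_of_neg (by linarith [Real.pi_pos])
    rw [mul_zero] at h
    obtain ⟨T, hT⟩ := eventually_atTop.1 (h.eventually_le_const (show (0 : ℝ) < 1 / 2 by norm_num))
    refine ⟨max T 1, by positivity, fun v hv => ?_⟩
    rw [norm_mul, norm_expW]
    exact hT v ((le_max_left _ _).trans hv.le)
  have hsplit : Ioi (0 : ℝ) = Ioc 0 T ∪ Ioi T := (Ioc_union_Ioi_eq_Ioi hT0.le).symm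
  have hA : IntegrableOn (logW y) (Ioc 0 T) := by
    have h : IntervalIntegrable (fun v : ℝ => Real.log ‖1 - y * expW v‖) volume 0 T := by
      apply MeromorphicOn.intervalIntegrable_log_norm (f := fun v : ℝ => 1 - y * expW v)
      intro v _
      refine AnalyticAt.meromorphicAt ?_
      have h1 : AnalyticAt ℝ (fun v : ℝ => Real.exp (-(2 * Real.pi) * v)) v := by fun_prop
      have h2 : AnalyticAt ℝ (fun v : ℝ => expW v) v :=
        (ofRealCLM.analyticAt _).comp h1
      exact analyticAt_const.sub (analyticAt_const.mul h2)
    rw [intervalIntegrable_iff_integrableOn_Ioc_of_le hT0.le] at h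
    refine Integrable.mono' (h.norm.add (integrableOn_const (C := Real.pi) (by simp)))
      (measurable_logW y).aestronglyMeasurable (.of_forall fun v => ?_)
    rw [logW, norm_neg]
    exact norm_clog_le _
  have hB : ∀ v, T < v → ‖logW y v‖ ≤ 3 / 2 * ‖y‖ * Real.exp (-(2 * Real.pi) * v) := by
    intro v hv
    have := norm_log_one_sub_le_of_le_half (hT v hv)
    rw [logW, norm_neg]
    rwa [norm_mul, norm_expW, ← mul_assoc] at this
  constructor
  · rw [hsplit]
    refine hA.union ?_
    refine Integrable.mono' ((integrableOn_exp_neg_two_pi T).const_mul (3 / 2 * ‖y‖))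
      (measurable_logW y).aestronglyMeasurable ?_
    exact (ae_restrict_iff' measurableSet_Ioi).2 (.of_forall fun v hv => hB v hv)
  · rw [hsplit]
    refine IntegrableOn.union ?_ ?_
    · refine Integrable.mono' (hA.norm.const_mul T)
        (measurable_ofReal.mul (measurable_logW y)).aestronglyMeasurable ?_
      refine (ae_restrict_iff' measurableSet_Ioc).2 (.of_forall fun v hv => ?_)
      rw [norm_mul, norm_real, Real.norm_of_nonneg hv.1.le]
      exact mul_le_mul_of_nonneg_right hv.2 (norm_nonneg _)
    · refine Integrable.mono' ((integrableOn_mul_exp_neg_two_pi.mono_set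
        (Ioi_subset_Ioi hT0.le)).const_mul (3 / 2 * ‖y‖))
        (measurable_ofReal.mul (measurable_logW y)).aestronglyMeasurable ?_
      refine (ae_restrict_iff' measurableSet_Ioi).2 (.of_forall fun v (hv : T < v) => ?_)
      rw [norm_mul, norm_real, Real.norm_of_nonneg (hT0.trans hv).le]
      have := mul_le_mul_of_nonneg_left (hB v hv) (hT0.trans hv).le
      linarith

lemma integrableOn_logW (y : ℂ) : IntegrableOn (logW y) (Ioi 0) := (integrableOn_logW_aux y).1

lemma integrableOn_mul_logW (y : ℂ) : IntegrableOn (fun v : ℝ => (v : ℂ) * logW y v) (Ioi 0) :=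
  (integrableOn_logW_aux y).2

/-! ### A generalized Binet formula -/

/-- The integrand of the generalized Binet formula, for `c = ± i`. -/
def binetFn (c s u : ℂ) : ℂ := log (1 - exp (2 * Real.pi * c * u)) / (s - u) ^ 2

/-- The integral of `binetFn c s` along `η + c ℝ_{>0}`. -/
def binetInt (c s η : ℂ) : ℂ := ∫ v in Ioi (0 : ℝ), binetFn c s (η + c * v)

lemma exp_shift {c : ℂ} (hc : c * c = -1) (η : ℂ) (v : ℝ) :
    exp (2 * Real.pi * c * (η + c * v)) = exp (2 * Real.pi * c * η) * expW v := by
  rw [expW, ofReal_exp, ← exp_add]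
  congr 1
  push_cast
  linear_combination 2 * Real.pi * v * hc

lemma binetFn_shift {c : ℂ} (hc : c * c = -1) (s η : ℂ) (v : ℝ) :
    binetFn c s (η + c * v) = -logW (exp (2 * Real.pi * c * η)) v / (s - η - c * v) ^ 2 := by
  rw [binetFn, exp_shift hc, logW, neg_neg, sub_add_eq_sub_sub]

/-- The vertical strip `0 < Re u < 1`, cut off at `Re s`. -/
def strip (s : ℂ) : Set ℂ := {u | 0 < u.re ∧ u.re < 1 ∧ u.re < s.re}

lemma isOpen_strip (s : ℂ) : IsOpen (strip s) :=
  (isOpen_lt continuous_const continuous_re).inter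
    ((isOpen_lt continuous_re continuous_const).inter (isOpen_lt continuous_re continuous_const))

lemma isPreconnected_strip (s : ℂ) : IsPreconnected (strip s) := by
  have h : strip s = {u : ℂ | 0 < u.re} ∩ ({u : ℂ | u.re < 1} ∩ {u : ℂ | u.re < s.re}) := rfl
  rw [h]
  exact ((convex_halfSpace_re_gt _).inter ((convex_halfSpace_re_lt _).inter
    (convex_halfSpace_re_lt _))).isPreconnected

lemma one_sub_mem_slitPlane_of_not {x : ℂ} (h : 1 - x ∉ slitPlane) : x.im = 0 ∧ 1 ≤ x.re := by
  rw [mem_slitPlane_iff] at h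
  push Not at h
  simp at h
  exact ⟨h.2, h.1⟩

/-- On the cut the exponential would be a positive real number. Then 2πcu differs from a real number
by an element of 2πiℤ, so Re u would be an integer. -/
lemma one_sub_exp_mem_slitPlane {c u : ℂ} (hc : c = I ∨ c = -I) (h0 : 0 < u.re) (h1 : u.re < 1) :
    1 - exp (2 * Real.pi * c * u) ∈ slitPlane := by
  by_contra hcon
  obtain ⟨him, hre⟩ := one_sub_mem_slitPlane_of_not hcon
  set z := exp (2 * Real.pi * c * u) with hz
  have h2 : exp (2 * Real.pi * c * u) = exp (Real.log z.re : ℝ) := by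
    rw [← ofReal_exp, Real.exp_log (by linarith), ← hz]
    apply Complex.ext <;> simp [him]
  obtain ⟨n, hn⟩ := exp_eq_exp_iff_exists_int.1 h2
  have h3 := congrArg Complex.im hn
  have hpi := Real.pi_pos
  rcases hc with rfl | rfl
  · simp at h3
    have h4 : u.re = n := by
      have : 2 * Real.pi * (u.re - n) = 0 := by linarith
      rcases mul_eq_zero.1 this with h | h
      · linarith
      · linarith
    rw [h4] at h0 h1
    have h5 : (0 : ℤ) < n := by exact_mod_cast h0
    have h6 : n < (1 : ℤ) := by exact_mod_cast h1
    omega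
  · simp at h3
    have h4 : u.re = -n := by
      have : 2 * Real.pi * (u.re + n) = 0 := by linarith
      rcases mul_eq_zero.1 this with h | h
      · linarith
      · linarith
    rw [h4] at h0 h1
    have h5 : (0 : ℤ) < -n := by exact_mod_cast h0
    have h6 : -n < (1 : ℤ) := by exact_mod_cast h1
    omega

lemma differentiableOn_binetFn {c : ℂ} (hc : c = I ∨ c = -I) (s : ℂ) :
    DifferentiableOn ℂ (binetFn c s) (strip s) := by
  intro u hu
  refine DifferentiableAt.differentiableWithinAt ?_
  have h1 := one_sub_exp_mem_slitPlane hc hu.1 hu.2.1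
  have h2 : s - u ≠ 0 := by
    intro h
    have := congrArg Complex.re h
    simp at this
    linarith [hu.2.2]
  unfold binetFn
  refine DifferentiableAt.div (DifferentiableAt.clog (by fun_prop) h1) (by fun_prop)
    (pow_ne_zero 2 h2)

lemma mul_self_of_eq {c : ℂ} (hc : c = I ∨ c = -I) : c * c = -1 := by
  rcases hc with rfl | rfl <;> simp

lemma norm_of_eq {c : ℂ} (hc : c = I ∨ c = -I) : ‖c‖ = 1 := by
  rcases hc with rfl | rfl <;> simp

lemma re_add_mul_ofReal {c : ℂ} (hc : c = I ∨ c = -I) (η : ℂ) (v : ℝ) :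
    (η + c * v).re = η.re := by
  rcases hc with rfl | rfl <;> simp

lemma add_mem_strip {c s η : ℂ} (hc : c = I ∨ c = -I) (hη : η ∈ strip s) (v : ℝ) :
    η + c * v ∈ strip s := by
  simpa only [strip, mem_ofPred_eq, re_add_mul_ofReal hc] using hη

/-- Locally uniform exponential decay of the integrand on the strip. -/
lemma exists_norm_binetFn_le {c s η₀ : ℂ} (hc : c = I ∨ c = -I) (hη : η₀ ∈ strip s) :
    ∃ ρ C : ℝ, 0 < ρ ∧ 0 ≤ C ∧ ∀ η ∈ Metric.closedBall η₀ (2 * ρ), η ∈ strip s ∧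
      ∀ v : ℝ, 0 ≤ v → ‖binetFn c s (η + c * v)‖ ≤ C * Real.exp (-1 * v) := by
  obtain ⟨ε, hε, hball⟩ := Metric.isOpen_iff.1 (isOpen_strip s) η₀ hη
  set d := (s.re - η₀.re) / 2 with hd
  have hd0 : 0 < d := by have := hη.2.2; linarith
  -- The ball of radius 2ρ stays in the strip and at horizontal distance at least d from s. The
  -- factor 2 leaves room for Cauchy estimates on discs of radius ρ.
  set ρ := min (ε / 3) (d / 2) with hρ
  have hρ0 : 0 < ρ := lt_min (by linarith) (by linarith)
  have hρε : 2 * ρ < ε := by have := min_le_left (ε / 3) (d / 2); linarith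
  have hρd : 2 * ρ ≤ d := by have := min_le_right (ε / 3) (d / 2); linarith
  have hsub : ∀ η ∈ Metric.closedBall η₀ (2 * ρ), η ∈ strip s := fun η h =>
    hball (Metric.closedBall_subset_ball hρε h)
  -- M bounds |2πcη| on the ball. For v ≤ M+1 compactness suffices; for v > M+1 the exponential is
  -- at most e^{M-2πv} ≤ e^{-1} < 1/2, where log(1-x) is linearly bounded.
  set M := 2 * Real.pi * (‖η₀‖ + 2 * ρ) with hM
  have hpi := Real.pi_gt_three
  have hM0 : 0 ≤ M := by positivity
  have hcont : ContinuousOn (fun p : ℂ × ℝ => binetFn c s (p.1 + c * p.2))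
      (Metric.closedBall η₀ (2 * ρ) ×ˢ Icc 0 (M + 1)) := by
    refine (differentiableOn_binetFn hc s).continuousOn.comp (by fun_prop) ?_
    rintro ⟨η, v⟩ ⟨h1, _⟩
    exact add_mem_strip hc (hsub η h1) v
  obtain ⟨C₁, hC₁⟩ := ((isCompact_closedBall η₀ (2 * ρ)).prod
    (isCompact_Icc (a := (0 : ℝ)) (b := M + 1))).exists_bound_of_continuousOn hcont
  have hE := Real.exp_pos M
  have hE1 := Real.exp_pos (M + 1)
  refine ⟨ρ, |C₁| * Real.exp (M + 1) + 3 / 2 * Real.exp M / d ^ 2, hρ0, by positivity,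
    fun η hη' => ⟨hsub η hη', fun v hv => ?_⟩⟩
  have hev := Real.exp_pos (-1 * v)
  rcases le_or_gt v (M + 1) with h | h
  · have h1 := hC₁ (η, v) ⟨hη', hv, h⟩
    have h2 : 1 ≤ Real.exp (M + 1) * Real.exp (-1 * v) := by
      rw [← Real.exp_add]
      exact Real.one_le_exp (by linarith)
    have h3 : |C₁| * 1 ≤ |C₁| * (Real.exp (M + 1) * Real.exp (-1 * v)) :=
      mul_le_mul_of_nonneg_left h2 (abs_nonneg _)
    have h4 : 0 ≤ 3 / 2 * Real.exp M / d ^ 2 * Real.exp (-1 * v) := by positivity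
    have h5 := le_abs_self C₁
    simp only at h1
    linarith
  · have hx : ‖exp (2 * Real.pi * c * (η + c * v))‖ ≤ Real.exp M * Real.exp (-1 * v) ∧
        ‖exp (2 * Real.pi * c * (η + c * v))‖ ≤ 1 / 2 := by
      have h1 : ‖exp (2 * Real.pi * c * η)‖ ≤ Real.exp M := by
        refine (norm_exp_le_exp_norm _).trans (Real.exp_le_exp.2 ?_)
        have h2 : ‖η‖ ≤ ‖η₀‖ + 2 * ρ := by
          rw [Metric.mem_closedBall, dist_eq_norm] at hη'
          have := norm_sub_norm_le η η₀
          linarith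
        simp only [norm_mul, norm_of_eq hc, norm_real, Real.norm_of_nonneg Real.pi_pos.le,
          Complex.norm_ofNat, mul_one]
        rw [hM]
        gcongr
      rw [exp_shift (mul_self_of_eq hc), norm_mul, norm_expW]
      constructor
      · gcongr
        nlinarith
      · calc ‖exp (2 * Real.pi * c * η)‖ * Real.exp (-(2 * Real.pi) * v)
            ≤ Real.exp M * Real.exp (-(2 * Real.pi) * v) := by gcongr
          _ = Real.exp (M + -(2 * Real.pi) * v) := (Real.exp_add _ _).symm
          _ ≤ Real.exp (-1) := Real.exp_le_exp.2 (by nlinarith)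
          _ ≤ 1 / 2 := by
            have := Real.exp_one_gt_d9
            rw [Real.exp_neg, one_div]
            exact inv_anti₀ (by norm_num) (by linarith)
    have h1 := norm_log_one_sub_le_of_le_half hx.2
    have h2 : d ≤ ‖s - (η + c * v)‖ := by
      refine le_trans ?_ (re_le_norm _)
      rw [sub_re, re_add_mul_ofReal hc]
      rw [Metric.mem_closedBall, dist_eq_norm] at hη'
      have := (abs_re_le_norm (η - η₀)).trans hη'
      rw [sub_re, abs_le] at this
      linarith
    rw [binetFn, norm_div, norm_pow]
    have h3 : ‖log (1 - exp (2 * Real.pi * c * (η + c * v)))‖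
        ≤ 3 / 2 * Real.exp M * Real.exp (-1 * v) := by linarith [hx.1]
    have h4 : ‖log (1 - exp (2 * Real.pi * c * (η + c * v)))‖ / ‖s - (η + c * v)‖ ^ 2
        ≤ (3 / 2 * Real.exp M * Real.exp (-1 * v)) / d ^ 2 := by gcongr
    refine h4.trans ?_
    have h5 : 0 ≤ |C₁| * Real.exp (M + 1) * Real.exp (-1 * v) := by positivity
    have h6 : 3 / 2 * Real.exp M * Real.exp (-1 * v) / d ^ 2
      = 3 / 2 * Real.exp M / d ^ 2 * Real.exp (-1 * v) := by ring
    rw [h6, add_mul]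
    linarith

/-- Moving the starting point agrees with moving along the half-line: the η-derivative of the
integrand is c⁻¹ times its v-derivative. The integral thus telescopes to a boundary term at v = 0,
and -c⁻¹ = c. -/
lemma hasDerivAt_binetInt {c s η₀ : ℂ} (hc : c = I ∨ c = -I) (hη : η₀ ∈ strip s) :
    HasDerivAt (binetInt c s) (c * binetFn c s η₀) η₀ := by
  obtain ⟨ρ, C, hρ, hC, h⟩ := exists_norm_binetFn_le hc hη
  have hd := differentiableOn_binetFn hc s
  have hd' : DifferentiableOn ℂ (deriv (binetFn c s)) (strip s) := hd.deriv (isOpen_strip s)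
  have hc0 : c ≠ 0 := by rcases hc with rfl | rfl <;> simp
  have hball : ∀ η ∈ Metric.ball η₀ (2 * ρ), η ∈ strip s := fun η hη =>
    (h η (Metric.ball_subset_closedBall hη)).1
  have hline : ∀ η ∈ strip s, Continuous fun v : ℝ => binetFn c s (η + c * v) := fun η hη =>
    hd.continuousOn.comp_continuous (by fun_prop) fun v => add_mem_strip hc hη v
  have hline' : Continuous fun v : ℝ => deriv (binetFn c s) (η₀ + c * v) :=
    hd'.continuousOn.comp_continuous (by fun_prop) fun v => add_mem_strip hc hη v
  have hexp := (exp_neg_integrableOn_Ioi 0 one_pos).const_mul C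
  have hat : ∀ η ∈ strip s, ∀ v : ℝ, HasDerivAt (binetFn c s)
      (deriv (binetFn c s) (η + c * v)) (η + c * v) := fun η hη v =>
    (hd.differentiableAt ((isOpen_strip s).mem_nhds (add_mem_strip hc hη v))).hasDerivAt
  have hint : IntegrableOn (fun v : ℝ => binetFn c s (η₀ + c * v)) (Ioi 0) := by
    refine Integrable.mono' hexp (hline η₀ hη).aestronglyMeasurable ?_
    refine (ae_restrict_iff' measurableSet_Ioi).2 (.of_forall fun v (hv : 0 < v) => ?_)
    exact (h η₀ (Metric.mem_closedBall_self (by linarith))).2 v hv.le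
  have key := hasDerivAt_integral_of_dominated_loc_of_deriv_le
    (μ := volume.restrict (Ioi (0 : ℝ))) (Metric.ball_mem_nhds η₀ hρ)
    (F := fun η v => binetFn c s (η + c * v))
    (F' := fun η v => deriv (binetFn c s) (η + c * v))
    (bound := fun v => C * Real.exp (-1 * v) / ρ) ?_ hint hline'.aestronglyMeasurable ?_
    (hexp.div_const ρ) ?_
  · have hval : ∫ v in Ioi (0 : ℝ), deriv (binetFn c s) (η₀ + c * v) = c * binetFn c s η₀ := by
      have hder : ∀ v ∈ Ici (0 : ℝ), HasDerivAt (fun v : ℝ => c⁻¹ * binetFn c s (η₀ + c * v))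
          (deriv (binetFn c s) (η₀ + c * v)) v := fun v _ => by
        have h1 : HasDerivAt (fun v : ℝ => η₀ + c * v) c v := by
          simpa using! ((hasDerivAt_id v).ofReal_comp.const_mul c).const_add η₀
        have h2 := ((hat η₀ hη v).comp v h1).const_mul c⁻¹
        convert! h2 using 1
        field_simp
      have hlim : Tendsto (fun v : ℝ => c⁻¹ * binetFn c s (η₀ + c * v)) atTop (𝓝 0) := by
        have h1 : Tendsto (fun v : ℝ => C * Real.exp (-1 * v)) atTop (𝓝 0) := by
          have : Tendsto (fun v : ℝ => Real.exp (-1 * v)) atTop (𝓝 0) := by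
            simpa using! Real.tendsto_exp_neg_atTop_nhds_zero
          simpa using this.const_mul C
        have h2 : Tendsto (fun v : ℝ => binetFn c s (η₀ + c * v)) atTop (𝓝 0) := by
          refine squeeze_zero_norm' ?_ h1
          filter_upwards [eventually_ge_atTop 0] with v hv
          exact (h η₀ (Metric.mem_closedBall_self (by linarith))).2 v hv
        simpa using h2.const_mul c⁻¹
      rw [integral_Ioi_of_hasDerivAt_of_tendsto' hder key.1 hlim]
      have h1 : c⁻¹ = -c := by
        rw [inv_eq_iff_eq_inv, eq_comm, inv_eq_of_mul_eq_one_right]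
        linear_combination -(mul_self_of_eq hc)
      simp [h1]
    rw [← hval]
    exact key.2
  · filter_upwards [Metric.ball_mem_nhds η₀ (show 0 < 2 * ρ by linarith)] with η hη'
    exact (hline η (hball η hη')).aestronglyMeasurable
  · refine (ae_restrict_iff' measurableSet_Ioi).2 (.of_forall fun v (hv : 0 < v) η hη' => ?_)
    -- Cauchy estimate: discs around η + cv are translated back by cv, so the exponential bound
    -- applies with the same v on the whole circle.
    have hsub : ∀ z ∈ Metric.closedBall (η + c * v) ρ,
        z - c * v ∈ Metric.closedBall η₀ (2 * ρ) := fun z hz => by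
      rw [Metric.mem_closedBall, dist_eq_norm] at *
      rw [Metric.mem_ball, dist_eq_norm] at hη'
      have h1 : z - c * v - η₀ = (z - (η + c * v)) + (η - η₀) := by ring
      rw [h1]
      refine (norm_add_le _ _).trans ?_
      linarith
    have hz : ∀ z ∈ Metric.closedBall (η + c * v) ρ, z ∈ strip s := fun z hz => by
      have := add_mem_strip hc (h _ (hsub z hz)).1 v
      simpa using this
    refine norm_deriv_le_of_forall_mem_sphere_norm_le hρ ?_ fun z hz' => ?_
    · refine DifferentiableOn.diffContOnCl (hd.mono fun z hz' => ?_)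
      rw [closure_ball _ hρ.ne'] at hz'
      exact hz z hz'
    · have := (h _ (hsub z (Metric.sphere_subset_closedBall hz'))).2 v hv.le
      simpa using this
  · refine (ae_restrict_iff' measurableSet_Ioi).2 (.of_forall fun v (hv : 0 < v) η hη' => ?_)
    have h1 : HasDerivAt (fun η : ℂ => η + c * v) 1 η := (hasDerivAt_id η).add_const _
    have h2 := (hat η (hball η (Metric.ball_subset_ball (by linarith) hη')) v).comp η h1
    simpa using! h2

lemma hasDerivAt_log_one_sub_exp {c u : ℂ} (hc : c = I ∨ c = -I) (h0 : 0 < u.re)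
    (h1 : u.re < 1) : HasDerivAt (fun u => log (1 - exp (2 * Real.pi * c * u)))
      (-(2 * Real.pi * c * exp (2 * Real.pi * c * u)) / (1 - exp (2 * Real.pi * c * u))) u := by
  have h2 := ((((hasDerivAt_id u).const_mul (2 * Real.pi * c)).cexp).const_sub 1).clog
    (one_sub_exp_mem_slitPlane hc h0 h1)
  convert! h2 using 1
  simp only [id]
  ring

/-- The difference of the two logarithms is linear on the strip. -/
lemma log_one_sub_exp_sub {u : ℂ} (h0 : 0 < u.re) (h1 : u.re < 1) :
    log (1 - exp (2 * Real.pi * I * u)) - log (1 - exp (2 * Real.pi * -I * u))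
      = 2 * Real.pi * I * (u - 1 / 2) := by
  have hder : ∀ u ∈ strip 2, HasDerivAt (fun u : ℂ => log (1 - exp (2 * Real.pi * I * u))
      - log (1 - exp (2 * Real.pi * -I * u)) - 2 * Real.pi * I * (u - 1 / 2)) 0 u := by
    intro u hu
    have h2 := ((hasDerivAt_log_one_sub_exp (Or.inl rfl) hu.1 hu.2.1).sub
      (hasDerivAt_log_one_sub_exp (Or.inr rfl) hu.1 hu.2.1)).sub
      (((hasDerivAt_id u).sub_const (1 / 2)).const_mul (2 * Real.pi * I))
    convert! h2 using 1
    have e1 := slitPlane_ne_zero (one_sub_exp_mem_slitPlane (Or.inl rfl) hu.1 hu.2.1)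
    have e2 : exp (2 * Real.pi * -I * u) = (exp (2 * Real.pi * I * u))⁻¹ := by
      rw [← exp_neg]; congr 1; ring
    have e3 := exp_ne_zero (2 * Real.pi * I * u)
    have e4 := slitPlane_ne_zero (one_sub_exp_mem_slitPlane (Or.inr rfl) hu.1 hu.2.1)
    rw [e2] at e4 ⊢
    generalize exp (2 * Real.pi * I * u) = E at *
    have e5 : 1 - E⁻¹ = -(1 - E) / E := by field_simp; ring
    rw [e5]
    field_simp
    ring
  have hmem : u ∈ strip 2 := ⟨h0, h1, by simp; linarith⟩
  -- At u = 1/2 both exponentials equal -1, which fixes the constant of integration.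
  have hmem' : (1 / 2 : ℂ) ∈ strip 2 := by
    refine ⟨?_, ?_, ?_⟩ <;> norm_num
  have h := (isOpen_strip 2).is_const_of_deriv_eq_zero (isPreconnected_strip 2)
    (fun u hu => (hder u hu).differentiableAt.differentiableWithinAt)
    (fun u hu => (hder u hu).deriv) hmem hmem'
  have e1 : exp (2 * Real.pi * I * (1 / 2)) = -1 := by
    rw [← exp_pi_mul_I]; congr 1; ring
  have e2 : exp (2 * Real.pi * -I * (1 / 2)) = -1 := by
    rw [← exp_neg_pi_mul_I]; congr 1; ring
  simp only [e1, e2, sub_self, mul_zero] at h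
  linear_combination h

/-- The left-hand side of the generalized Binet formula; it depends on `s` only. -/
def binet (s η : ℂ) : ℂ :=
  1 / (2 * Real.pi) * (binetInt (-I) s η + binetInt I s η) + log (s - η) + (η - 1 / 2) / (s - η)

/-- The endpoint terms combine to i/(2π) times the difference of the two logarithms over (s-η)²,
which is -(η-1/2)/(s-η)² by `log_one_sub_exp_sub`. The two elementary summands are chosen to cancel
exactly this. -/
lemma hasDerivAt_binet {s η : ℂ} (hη : η ∈ strip s) : HasDerivAt (binet s) 0 η := by
  have h0 : 0 < (s - η).re := by simpa using hη.2.2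
  have h0' : s - η ≠ 0 := fun h => by simp [h] at h0
  have hs : HasDerivAt (fun η => s - η) (-1) η := by
    simpa using (hasDerivAt_id η).const_sub s
  have h1 := ((hasDerivAt_binetInt (Or.inr rfl) hη).add
    (hasDerivAt_binetInt (Or.inl rfl) hη)).const_mul (1 / (2 * Real.pi) : ℂ)
  have h2 := hs.clog (Or.inl h0)
  have h3 := ((hasDerivAt_id η).sub_const (1 / 2)).div hs h0'
  convert! (h1.add h2).add h3 using 1
  have e := log_one_sub_exp_sub hη.1 hη.2.1
  have hpi : (Real.pi : ℂ) ≠ 0 := by exact_mod_cast Real.pi_ne_zero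
  simp only [binetFn, id]
  have e' : log (1 - exp (2 * Real.pi * I * η))
    = log (1 - exp (2 * Real.pi * -I * η)) + 2 * Real.pi * I * (η - 1 / 2) := by
    linear_combination e
  rw [e']
  field_simp
  ring_nf
  simp only [I_sq]
  ring

lemma binet_eq {s η η' : ℂ} (hη : η ∈ strip s) (hη' : η' ∈ strip s) : binet s η = binet s η' :=
  (isOpen_strip s).is_const_of_deriv_eq_zero (isPreconnected_strip s)
    (fun _ hu => (hasDerivAt_binet hu).differentiableAt.differentiableWithinAt)
    (fun _ hu => (hasDerivAt_binet hu).deriv) hη hη'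

/-! ### Boundary values of the Binet integrals on the sides of the strip -/

lemma norm_exp_of_eq {c : ℂ} (hc : c = I ∨ c = -I) (p τ : ℝ) :
    ‖exp (2 * Real.pi * c * (p + τ * I))‖ = ‖exp (2 * Real.pi * c * (τ * I))‖ := by
  rw [mul_add, exp_add, norm_mul]
  have : ‖exp (2 * Real.pi * c * p)‖ = 1 := by
    rw [norm_exp]
    rcases hc with rfl | rfl <;> simp
  rw [this, one_mul]

/-- The cut is harmless in two situations. If the exponential has modulus at most 1, the factor
e^{-2πv} < 1 keeps 1 - x off the cut. If its imaginary part is nonpositive on approach, 1 - x tends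
to the cut from the closed upper half-plane, the side on which the principal logarithm is
continuous. -/
lemma tendsto_log_one_sub {c : ℂ} (hc : c = I ∨ c = -I) {p₀ τ : ℝ}
    (hside : ‖exp (2 * Real.pi * c * (τ * I))‖ ≤ 1 ∨
      ∀ᶠ p : ℝ in 𝓝[Ioo 0 1] p₀, (exp (2 * Real.pi * c * (p + τ * I))).im ≤ 0)
    {v : ℝ} (hv : 0 < v)
    (hne : exp (2 * Real.pi * c * (p₀ + τ * I)) * expW v ≠ 1) :
    Tendsto (fun p : ℝ => logW (exp (2 * Real.pi * c * (p + τ * I))) v) (𝓝[Ioo 0 1] p₀)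
      (𝓝 (logW (exp (2 * Real.pi * c * (p₀ + τ * I))) v)) := by
  have hcont : Continuous fun p : ℝ => 1 - exp (2 * Real.pi * c * (p + τ * I)) * expW v := by
    fun_prop
  have ht := (hcont.tendsto p₀).mono_left (nhdsWithin_le_nhds (s := Ioo 0 1))
  refine Tendsto.neg ?_
  by_cases hs : 1 - exp (2 * Real.pi * c * (p₀ + τ * I)) * expW v ∈ slitPlane
  · exact (continuousAt_clog hs).tendsto.comp ht
  · obtain ⟨him, hre⟩ := one_sub_mem_slitPlane_of_not hs
    have hside' : ∀ᶠ p : ℝ in 𝓝[Ioo 0 1] p₀, (exp (2 * Real.pi * c * (p + τ * I))).im ≤ 0 := by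
      rcases hside with h | h
      · exfalso
        have h1 := hre.trans (re_le_norm _)
        rw [norm_mul, norm_exp_of_eq hc, norm_expW] at h1
        have h2 : Real.exp (-(2 * Real.pi) * v) < 1 := by
          rw [Real.exp_lt_one_iff]
          nlinarith [Real.pi_pos]
        nlinarith [Real.exp_pos (-(2 * Real.pi) * v)]
      · exact h
    have hre' : 1 < (exp (2 * Real.pi * c * (p₀ + τ * I)) * expW v).re := by
      refine lt_of_le_of_ne hre fun h => hne ?_
      apply Complex.ext <;> simp [him, ← h]
    have hw := continuousWithinAt_log_of_re_neg_of_im_zero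
      (z := 1 - exp (2 * Real.pi * c * (p₀ + τ * I)) * expW v)
      (by rw [sub_re, one_re]; linarith) (by simp [him])
    refine hw.tendsto.comp (tendsto_nhdsWithin_iff.2 ⟨ht, ?_⟩)
    filter_upwards [hside'] with p hp
    have h3 := mul_nonpos_of_nonpos_of_nonneg hp (Real.exp_pos (-(2 * Real.pi) * v)).le
    have h4 : (exp (2 * Real.pi * c * (p + τ * I)) * expW v).im
        = (exp (2 * Real.pi * c * (p + τ * I))).im * Real.exp (-(2 * Real.pi) * v) := by
      rw [expW, im_mul_ofReal]
    simp only [sub_im, one_im, h4]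
    linarith

/-- The Binet integrals are continuous up to the sides of the strip. -/
lemma tendsto_binetInt {c : ℂ} (hc : c = I ∨ c = -I) {s : ℂ} {p₀ τ : ℝ} (hp₀ : p₀ < s.re)
    (hside : ‖exp (2 * Real.pi * c * (τ * I))‖ ≤ 1 ∨
      ∀ᶠ p : ℝ in 𝓝[Ioo 0 1] p₀, (exp (2 * Real.pi * c * (p + τ * I))).im ≤ 0) :
    Tendsto (fun p : ℝ => binetInt c s (p + τ * I)) (𝓝[Ioo 0 1] p₀)
      (𝓝 (binetInt c s (p₀ + τ * I))) := by
  set A := ‖exp (2 * Real.pi * c * (τ * I))‖ with hA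
  have hA0 : 0 < A := norm_pos_iff.2 (exp_ne_zero _)
  set d := (s.re - p₀) / 2 with hd
  have hd0 : 0 < d := by linarith
  have hcc := mul_self_of_eq hc
  unfold binetInt
  simp only [binetFn_shift hcc]
  -- At most one v puts the argument on the unit circle, where the dominating bound is unavailable.
  have hae : ∀ᵐ v : ℝ ∂(volume.restrict (Ioi 0)), A * Real.exp (-(2 * Real.pi) * v) ≠ 1 := by
    refine ae_restrict_of_ae ?_
    have hsub : {v : ℝ | ¬ A * Real.exp (-(2 * Real.pi) * v) ≠ 1}.Subsingleton := by
      intro v hv v' hv'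
      simp only [not_not, mem_ofPred_eq, ne_eq] at hv hv'
      have h1 : Real.exp (-(2 * Real.pi) * v) = Real.exp (-(2 * Real.pi) * v') :=
        mul_left_cancel₀ hA0.ne' (hv.trans hv'.symm)
      have h2 := Real.exp_injective h1
      exact mul_left_cancel₀ (neg_ne_zero.2 Real.two_pi_pos.ne') h2
    exact hsub.measure_zero _
  have hnear : ∀ᶠ p : ℝ in 𝓝[Ioo 0 1] p₀, p < p₀ + d :=
    nhdsWithin_le_nhds (Iio_mem_nhds (by linarith))
  have hnorm : ∀ (p v : ℝ), ‖exp (2 * Real.pi * c * (p + τ * I)) * expW v‖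
      = A * Real.exp (-(2 * Real.pi) * v) := fun p v => by
    rw [norm_mul, norm_exp_of_eq hc, norm_expW]
  have hre : ∀ (p v : ℝ), (s - (p + τ * I) - c * v).re = s.re - p := fun p v => by
    rcases hc with rfl | rfl <;> simp
  refine tendsto_integral_filter_of_dominated_convergence
    -- The modulus A is constant along the horizontal approach, so one integrable function dominates
    -- all p.
    (fun v => (‖logW A v‖ + 8 * (A * Real.exp (-(2 * Real.pi) * v))) / d ^ 2)
    (.of_forall fun p => ?_) ?_ ?_ ?_
  · refine (Measurable.aestronglyMeasurable ?_)
    exact (measurable_logW _).neg.div (by fun_prop)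
  · filter_upwards [hnear] with p hp
    filter_upwards [hae] with v hv
    have h1 : ‖logW (exp (2 * Real.pi * c * (p + τ * I))) v‖
        ≤ ‖logW A v‖ + 8 * (A * Real.exp (-(2 * Real.pi) * v)) := by
      have h2 := norm_log_one_sub_le (x := exp (2 * Real.pi * c * (p + τ * I)) * expW v)
        (by rw [hnorm]; exact hv)
      rw [hnorm] at h2
      rw [logW, norm_neg]
      refine h2.trans (add_le_add_left ?_ _)
      have h3 := abs_re_le_norm (logW A v)
      rw [logW, neg_re, log_re, abs_neg] at h3
      have h4 : (1 : ℂ) - A * expW v = ((1 - A * Real.exp (-(2 * Real.pi) * v) : ℝ) : ℂ) := by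
        rw [expW]; push_cast; ring
      rw [h4, norm_real, Real.norm_eq_abs, Real.log_abs] at h3
      rwa [logW, h4]
    have h5 : d ≤ ‖s - (p + τ * I) - c * v‖ := by
      refine le_trans ?_ (re_le_norm _)
      rw [hre]; linarith
    rw [norm_div, norm_neg, norm_pow]
    gcongr
  · exact ((integrableOn_logW A).norm.add
      (((integrableOn_exp_neg_two_pi 0).const_mul A).const_mul 8)).div_const _
  · filter_upwards [hae, ae_restrict_mem measurableSet_Ioi] with v hv hv0
    refine Tendsto.div (tendsto_log_one_sub hc hside hv0 fun h => hv ?_).neg ?_ ?_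
    · rw [← hnorm p₀ v, h, norm_one]
    · have hcont : Continuous fun p : ℝ => (s - (p + τ * I) - c * v) ^ 2 := by fun_prop
      exact hcont.continuousAt.tendsto.mono_left nhdsWithin_le_nhds
    · refine pow_ne_zero 2 fun h => ?_
      have := hre p₀ v
      rw [h, zero_re] at this
      linarith

/-- The parameters for which the Binet formula holds with principal logarithms. -/
def Admissible (η : ℂ) : Prop :=
  (0 < η.re ∧ η.re < 1) ∨ (η.re = 1 ∧ η.im ≤ 0) ∨ (η.re = 0 ∧ 0 ≤ η.im)

lemma Admissible.re_nonneg {η : ℂ} (h : Admissible η) : 0 ≤ η.re := by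
  rcases h with h | h | h <;> linarith [h.1]

lemma Admissible.re_le_one {η : ℂ} (h : Admissible η) : η.re ≤ 1 := by
  rcases h with h | h | h
  · exact h.2.le
  · exact h.1.le
  · rw [h.1]; exact zero_le_one

lemma norm_exp_le_one_of {ε τ : ℝ} (h : 0 ≤ ε * τ) :
    ‖exp (2 * Real.pi * (ε * I) * (τ * I))‖ ≤ 1 := by
  rw [norm_exp]
  have : (2 * Real.pi * (ε * I) * (τ * I) : ℂ) = ((-(2 * Real.pi * (ε * τ)) : ℝ) : ℂ) := by
    push_cast
    linear_combination 2 * Real.pi * ε * τ * I_mul_I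
  rw [this, ofReal_re, Real.exp_le_one_iff]
  have := Real.two_pi_pos
  nlinarith

/-- The free integer k moves the angle into [-π, 0]: k = 1 is used near p = 1 and k = 0 near p = 0.
-/
lemma im_exp_eq {ε p τ : ℝ} (k : ℤ) :
    (exp (2 * Real.pi * (ε * I) * (p + τ * I))).im
      = Real.exp (-(2 * Real.pi * (ε * τ))) * Real.sin (2 * Real.pi * (ε * p) - k * (2 * Real.pi)) := by
  rw [Real.sin_sub_int_mul_two_pi]
  have : (2 * Real.pi * (ε * I) * (p + τ * I) : ℂ)
      = ((-(2 * Real.pi * (ε * τ)) : ℝ) : ℂ) + ((2 * Real.pi * (ε * p) : ℝ) : ℂ) * I := by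
    push_cast
    linear_combination 2 * Real.pi * ε * τ * I_mul_I
  rw [this, exp_im]
  simp

/-- On each side of the strip the sign of Im η makes one of the two exponentials have modulus at
most 1; the other has nonpositive imaginary part when approached from inside. This is the reason for
the sign conditions in `Admissible`. -/
lemma Admissible.side {η : ℂ} (h : Admissible η) {c : ℂ} (hc : c = I ∨ c = -I)
    {s : ℂ} (hs : η.re < s.re) :
    Tendsto (fun p : ℝ => binetInt c s (p + η.im * I)) (𝓝[Ioo 0 1] η.re)
      (𝓝 (binetInt c s (η.re + η.im * I))) := by
  rcases h with h | h | h
  · have hmem : (η.re + η.im * I) ∈ strip s := by simpa [strip] using ⟨h.1, h.2, hs⟩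
    have h1 := (hasDerivAt_binetInt hc hmem).continuousAt
    have h2 : ContinuousAt (fun p : ℝ => (p : ℂ) + η.im * I) η.re := by fun_prop
    exact (ContinuousAt.comp (f := fun p : ℝ => (p : ℂ) + η.im * I) h1 h2).tendsto.mono_left
      nhdsWithin_le_nhds
  · refine tendsto_binetInt hc hs ?_
    rcases hc with rfl | rfl
    · right
      rw [h.1]
      have : ∀ᶠ p : ℝ in 𝓝[Ioo 0 1] 1, 1 / 2 < p :=
        nhdsWithin_le_nhds (Ioi_mem_nhds (by norm_num))
      filter_upwards [this, self_mem_nhdsWithin] with p hp hp'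
      have e := im_exp_eq (ε := 1) (p := p) (τ := η.im) 1
      simp only [ofReal_one, one_mul] at e
      rw [e]
      refine mul_nonpos_of_nonneg_of_nonpos (Real.exp_pos _).le ?_
      have := Real.pi_pos
      apply Real.sin_nonpos_of_nonpos_of_neg_pi_le
      · push_cast; nlinarith [hp'.2]
      · push_cast; nlinarith
    · left
      have e := norm_exp_le_one_of (ε := -1) (τ := η.im) (by linarith)
      simpa using e
  · refine tendsto_binetInt hc hs ?_
    rcases hc with rfl | rfl
    · left
      have e := norm_exp_le_one_of (ε := 1) (τ := η.im) (by linarith)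
      simpa using e
    · right
      rw [h.1]
      have : ∀ᶠ p : ℝ in 𝓝[Ioo 0 1] 0, p < 1 / 2 :=
        nhdsWithin_le_nhds (Iio_mem_nhds (by norm_num))
      filter_upwards [this, self_mem_nhdsWithin] with p hp hp'
      have e := im_exp_eq (ε := -1) (p := p) (τ := η.im) 0
      simp only [ofReal_neg, ofReal_one, neg_mul, one_mul] at e
      rw [e]
      refine mul_nonpos_of_nonneg_of_nonpos (Real.exp_pos _).le ?_
      have := Real.pi_pos
      apply Real.sin_nonpos_of_nonpos_of_neg_pi_le
      · push_cast; nlinarith [hp'.1]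
      · push_cast; nlinarith

/-- The common value of `binet s` on the strip. -/
def binetPsi (s : ℂ) : ℂ := binet s ((min (1 / 2) (s.re / 2) : ℝ) : ℂ)

/-- Inside the strip the value is constant, and a boundary parameter is the limit along the
horizontal segment through it. -/
lemma binet_eq_binetPsi {s η : ℂ} (h : Admissible η) (hs : η.re < s.re) :
    binet s η = binetPsi s := by
  have hs0 : 0 < s.re := h.re_nonneg.trans_lt hs
  have hmem : ((min (1 / 2) (s.re / 2) : ℝ) : ℂ) ∈ strip s := by
    simp only [strip, mem_ofPred_eq, ofReal_re]
    refine ⟨lt_min (by norm_num) (by linarith), (min_le_left _ _).trans_lt (by norm_num),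
      (min_le_right _ _).trans_lt (by linarith)⟩
  have hη : (η.re : ℂ) + η.im * I = η := re_add_im η
  have hne : s - η ≠ 0 := fun h' => by
    have := congrArg Complex.re h'
    simp at this
    linarith
  have hslit : s - η ∈ slitPlane := Or.inl (by simpa using hs)
  have hlim : Tendsto (fun p : ℝ => binet s (p + η.im * I)) (𝓝[Ioo 0 1] η.re) (𝓝 (binet s η)) := by
    have h1 := h.side (Or.inl rfl) hs
    have h2 := h.side (Or.inr rfl) hs
    have h3 : ContinuousAt (fun u : ℂ => log (s - u) + (u - 1 / 2) / (s - u)) η :=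
      ((continuousAt_const.sub continuousAt_id).clog hslit).add
        ((continuousAt_id.sub continuousAt_const).div (continuousAt_const.sub continuousAt_id) hne)
    have h4 : Tendsto (fun p : ℝ => (p : ℂ) + η.im * I) (𝓝[Ioo 0 1] η.re) (𝓝 η) := by
      have : ContinuousAt (fun p : ℝ => (p : ℂ) + η.im * I) η.re := by fun_prop
      have := this.tendsto.mono_left (nhdsWithin_le_nhds (s := Ioo 0 1))
      rwa [hη] at this
    rw [hη] at h1 h2
    have h5 := ((h2.add h1).const_mul (1 / (2 * Real.pi) : ℂ)).add (h3.tendsto.comp h4)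
    have e : ∀ u, binet s u = 1 / (2 * Real.pi) * (binetInt (-I) s u + binetInt I s u)
        + (log (s - u) + (u - 1 / 2) / (s - u)) := fun u => by rw [binet, add_assoc]
    simp only [e]
    exact h5
  have hev : ∀ᶠ p : ℝ in 𝓝[Ioo 0 1] η.re, binet s (p + η.im * I) = binetPsi s := by
    have hlt : ∀ᶠ p : ℝ in 𝓝[Ioo 0 1] η.re, p < s.re := nhdsWithin_le_nhds (Iio_mem_nhds hs)
    filter_upwards [hlt, self_mem_nhdsWithin] with p hp hp'
    refine binet_eq ?_ hmem
    simpa [strip] using ⟨hp'.1, hp'.2, hp⟩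
  have hNe : (𝓝[Ioo (0 : ℝ) 1] η.re).NeBot := by
    rw [← mem_closure_iff_nhdsWithin_neBot, closure_Ioo zero_ne_one]
    exact ⟨h.re_nonneg, h.re_le_one⟩
  exact tendsto_nhds_unique hlim (tendsto_const_nhds.congr' (hev.mono fun _ h => h.symm))

/-! ### Identification of the common value with the digamma function -/

lemma admissible_zero : Admissible 0 := Or.inr (Or.inr (by simp))

lemma admissible_one : Admissible 1 := Or.inr (Or.inl (by simp))

lemma binetInt_add_one {c : ℂ} (hc : c = I ∨ c = -I) (s : ℂ) :
    binetInt c (s + 1) 1 = binetInt c s 0 := by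
  unfold binetInt
  congr 1
  ext v
  have h : exp (2 * Real.pi * c * 1) = 1 := by
    rcases hc with rfl | rfl
    · rw [mul_one, exp_two_pi_mul_I]
    · rw [mul_one, mul_neg, exp_neg, exp_two_pi_mul_I, inv_one]
  rw [binetFn_shift (mul_self_of_eq hc), binetFn_shift (mul_self_of_eq hc), h, mul_zero, exp_zero]
  congr 2
  ring

/-- Evaluate at η = 1 for s+1 and at η = 0 for s. Integrals and logarithms agree, since s - η is the
same; only the rational terms ±1/(2s) differ. -/
lemma binetPsi_add_one {s : ℂ} (hs : 0 < s.re) : binetPsi (s + 1) = binetPsi s + 1 / s := by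
  have h0 : s ≠ 0 := by rintro rfl; simp at hs
  rw [← binet_eq_binetPsi admissible_one (by simpa using hs),
    ← binet_eq_binetPsi admissible_zero (by simpa using hs), binet, binet,
    binetInt_add_one (Or.inl rfl), binetInt_add_one (Or.inr rfl), add_sub_cancel_right, sub_zero]
  field_simp
  ring

lemma norm_binetInt_zero_le {c : ℂ} (hc : c = I ∨ c = -I) {s : ℂ} (hs : 0 < s.re) :
    ‖binetInt c s 0‖ ≤ (∫ v in Ioi (0 : ℝ), ‖logW 1 v‖) / s.re ^ 2 := by
  rw [← integral_div]
  refine norm_integral_le_of_norm_le ((integrableOn_logW 1).norm.div_const _) ?_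
  refine .of_forall fun v => ?_
  rw [binetFn_shift (mul_self_of_eq hc), mul_zero, exp_zero, norm_div, norm_neg, norm_pow]
  have h : s.re ≤ ‖s - 0 - c * v‖ := by
    refine le_trans (le_of_eq ?_) (re_le_norm _)
    rcases hc with rfl | rfl <;> simp
  gcongr

/-- At η = 0 the integrals are O(1/(Re s)²) and the rational term is O(1/Re s), so only the
logarithm survives. -/
lemma tendsto_binetPsi_sub_log {s : ℂ} (hs : 0 < s.re) :
    Tendsto (fun n : ℕ => binetPsi (s + n) - Real.log n) atTop (𝓝 0) := by
  have hcast : Tendsto (fun n : ℕ => s.re + (n : ℝ)) atTop atTop :=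
    tendsto_atTop_add_const_left _ _ tendsto_natCast_atTop_atTop
  have hre : ∀ n : ℕ, (s + n).re = s.re + n := fun n => by simp
  have hpos : ∀ n : ℕ, 0 < (s + n).re := fun n => by
    rw [hre]; have : (0 : ℝ) ≤ n := n.cast_nonneg; linarith
  have hJ : ∀ c : ℂ, c = I ∨ c = -I →
      Tendsto (fun n : ℕ => binetInt c (s + n) 0) atTop (𝓝 0) := fun c hc => by
    refine squeeze_zero_norm (fun n => norm_binetInt_zero_le hc (hpos n)) ?_
    simp only [hre]
    exact Tendsto.div_atTop tendsto_const_nhds ((tendsto_pow_atTop two_ne_zero).comp hcast)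
  have hinv : Tendsto (fun n : ℕ => (0 - 1 / 2 : ℂ) / (s + n)) atTop (𝓝 0) := by
    rw [tendsto_zero_iff_norm_tendsto_zero]
    refine squeeze_zero (fun n => norm_nonneg _) (fun n => ?_)
      (Tendsto.div_atTop (tendsto_const_nhds (x := (1 : ℝ))) hcast)
    rw [norm_div, ← hre]
    gcongr
    · exact hpos n
    · norm_num
    · exact re_le_norm _
  have hlog : Tendsto (fun n : ℕ => log (s + n) - Real.log n) atTop (𝓝 0) := by
    have h1 : Tendsto (fun n : ℕ => log (1 + s / n)) atTop (𝓝 (log 1)) := by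
      refine (continuousAt_clog (by simp)).tendsto.comp ?_
      have : Tendsto (fun n : ℕ => s / (n : ℂ)) atTop (𝓝 0) := tendsto_const_div_atTop_nhds_zero_nat s
      simpa using this.const_add 1
    rw [log_one] at h1
    refine h1.congr' ?_
    filter_upwards [eventually_gt_atTop 0] with n hn
    have hn' : (n : ℂ) ≠ 0 := by exact_mod_cast hn.ne'
    have hn0 : (0 : ℝ) < n := by exact_mod_cast hn
    have h2 : s + n = ((n : ℝ) : ℂ) * (1 + s / n) := by push_cast; field_simp; ring
    have h3 : 1 + s / n ≠ 0 := by
      intro h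
      rw [h, mul_zero] at h2
      have := hpos n
      simp [h2] at this
    rw [h2, log_ofReal_mul hn0 h3]
    ring
  have h := ((((hJ _ (Or.inr rfl)).add (hJ _ (Or.inl rfl))).const_mul
    (1 / (2 * Real.pi) : ℂ)).add hlog).add hinv
  simp only [add_zero, mul_zero] at h
  refine h.congr fun n => ?_
  rw [← binet_eq_binetPsi admissible_zero (by simpa using hpos n), binet, sub_zero]
  ring

/-- The recursion reduces the value at s to that at s+n+1. The asymptotics and the definition of
Euler's constant through harmonic numbers then give the partial fraction series. -/
lemma binetPsi_eq_psi {s : ℂ} (hs : 0 < s.re) : binetPsi s = psi s := by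
  have hpos : ∀ n : ℕ, 0 < (s + n).re := fun n => by
    have : (0 : ℝ) ≤ n := n.cast_nonneg
    simp; linarith
  have hshift : ∀ n : ℕ, binetPsi (s + n) = binetPsi s + ∑ k ∈ Finset.range n, 1 / (s + k) := by
    intro n
    induction n with
    | zero => simp
    | succ n ih =>
      rw [Finset.sum_range_succ, ← add_assoc, ← ih, ← binetPsi_add_one (hpos n)]
      push_cast; ring_nf
  have hsum : Tendsto (fun n : ℕ => ∑ k ∈ Finset.range n,
      (1 / ((k : ℂ) + 1) - 1 / ((k : ℂ) + 1 + s))) atTop (𝓝 (psiSeries s)) :=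
    (summable_inv_sub_inv (by linarith)).hasSum.tendsto_sum_nat
  have hharm : Tendsto (fun n : ℕ => (((harmonic n : ℝ) - Real.log (n + 1) : ℝ) : ℂ)) atTop
      (𝓝 eulerC) :=
    (continuous_ofReal.tendsto _).comp Real.tendsto_harmonic_sub_log_add_one
  -- The shift by one matches log(n+1) in the harmonic limit and leaves the k = 0 term 1/s apart.
  have hpsi := (tendsto_add_atTop_iff_nat 1).2 (tendsto_binetPsi_sub_log hs)
  have h := ((hpsi.sub hharm).add hsum).sub_const (1 / s)
  refine tendsto_nhds_unique (tendsto_const_nhds.congr fun n => ?_)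
    (h.trans (le_of_eq (by rw [psi]; ring_nf)))
  have hH : ∑ k ∈ Finset.range n, 1 / ((k : ℂ) + 1) = ((harmonic n : ℝ) : ℂ) := by
    rw [harmonic]
    push_cast
    simp
  have hS : ∑ k ∈ Finset.range n, 1 / ((k : ℂ) + 1 + s)
      = ∑ k ∈ Finset.range n, 1 / (s + ((k + 1 : ℕ) : ℂ)) :=
    Finset.sum_congr rfl fun k _ => by push_cast; ring_nf
  rw [hshift, Finset.sum_range_succ', Finset.sum_sub_distrib, hH, hS]
  push_cast
  ring

/-- **Generalized Binet formula** for the logarithmic derivative of the Gamma function. -/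
theorem integral_logW_add_integral_logW {w η : ℂ} (hw : 0 < w.re) (h : Admissible η) :
    (∫ v in Ioi (0 : ℝ), -logW (exp (2 * Real.pi * -I * η)) v / (w + I * v) ^ 2)
      + (∫ v in Ioi (0 : ℝ), -logW (exp (2 * Real.pi * I * η)) v / (w - I * v) ^ 2)
      = 2 * Real.pi * (psi (w + η) - log w - (η - 1 / 2) / w) := by
  have hpi : (Real.pi : ℂ) ≠ 0 := by exact_mod_cast Real.pi_ne_zero
  have h1 := binet_eq_binetPsi h (s := w + η) (by simpa using hw)
  rw [binetPsi_eq_psi (by simpa using add_pos_of_pos_of_nonneg hw h.re_nonneg), binet,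
    add_sub_cancel_right] at h1
  have e1 : ∀ v : ℝ, binetFn (-I) (w + η) (η + -I * v)
      = -logW (exp (2 * Real.pi * -I * η)) v / (w + I * v) ^ 2 := fun v => by
    rw [binetFn_shift (mul_self_of_eq (Or.inr rfl)), add_sub_cancel_right, neg_mul, sub_neg_eq_add]
  have e2 : ∀ v : ℝ, binetFn I (w + η) (η + I * v)
      = -logW (exp (2 * Real.pi * I * η)) v / (w - I * v) ^ 2 := fun v => by
    rw [binetFn_shift (mul_self_of_eq (Or.inl rfl)), add_sub_cancel_right]
  simp only [← e1, ← e2]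
  rw [← binetInt, ← binetInt, ← h1]
  field_simp
  ring

/-! ### Integrals over BPS rays as transforms -/

/-- The dilogarithm as an iterated integral of the weight `-log (1 - y e^{-2πv})`. -/
lemma dilog_mul_expW (y : ℂ) (u : ℝ) : dilog (y * expW u) = 2 * Real.pi * tail (logW y) u := by
  -- Substitution s = e^{-2π(v-u)}, under which ds/s becomes 2π dv up to orientation.
  have himage : (fun v : ℝ => Real.exp (-(2 * Real.pi) * (v - u))) '' Ioi u = Ioo 0 1 := by
    have hpi := Real.two_pi_pos
    ext s
    constructor
    · rintro ⟨v, hv, rfl⟩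
      have hv : u < v := hv
      refine ⟨Real.exp_pos _, Real.exp_lt_one_iff.2 ?_⟩
      nlinarith
    · rintro ⟨h0, h1⟩
      refine ⟨u - Real.log s / (2 * Real.pi), ?_, ?_⟩
      · have := div_neg_of_neg_of_pos (Real.log_neg h0 h1) hpi
        simp only [mem_Ioi]; linarith
      · have : -(2 * Real.pi) * (u - Real.log s / (2 * Real.pi) - u) = Real.log s := by
          field_simp; ring
        simp only [this, Real.exp_log h0]
  have hder : ∀ v ∈ Ioi u, HasDerivWithinAt (fun v : ℝ => Real.exp (-(2 * Real.pi) * (v - u)))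
      (-(2 * Real.pi) * Real.exp (-(2 * Real.pi) * (v - u))) (Ioi u) v := fun v _ => by
    have h := ((((hasDerivAt_id v).sub_const u).const_mul (-(2 * Real.pi))).exp).hasDerivWithinAt
      (s := Ioi u)
    convert! h using 1
    simp only [id]; ring
  have hinj : InjOn (fun v : ℝ => Real.exp (-(2 * Real.pi) * (v - u))) (Ioi u) := fun v _ v' _ h => by
    have h2 := Real.exp_injective h
    have h3 := mul_left_cancel₀ (neg_ne_zero.2 Real.two_pi_pos.ne') h2
    linarith
  rw [dilog, intervalIntegral.integral_of_le zero_le_one, integral_Ioc_eq_integral_Ioo, ← himage,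
    integral_image_eq_integral_abs_deriv_smul measurableSet_Ioi hder hinj, tail,
    ← integral_const_mul, ← integral_neg]
  refine setIntegral_congr_fun measurableSet_Ioi fun v _ => ?_
  have e1 : y * expW u * ((Real.exp (-(2 * Real.pi) * (v - u)) : ℝ) : ℂ) = y * expW v := by
    rw [mul_assoc, expW, ← ofReal_mul, ← Real.exp_add, expW]
    congr 3; ring
  have e2 : |-(2 * Real.pi) * Real.exp (-(2 * Real.pi) * (v - u))|
      = 2 * Real.pi * Real.exp (-(2 * Real.pi) * (v - u)) := by
    rw [abs_mul, abs_neg, abs_of_pos Real.two_pi_pos, abs_of_pos (Real.exp_pos _)]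
  have e3 : ((Real.exp (-(2 * Real.pi) * (v - u)) : ℝ) : ℂ) ≠ 0 :=
    ofReal_ne_zero.2 (Real.exp_pos _).ne'
  simp only [e1, e2, logW, real_smul]
  rw [ofReal_mul]
  field_simp
  push_cast
  ring

lemma tail_expW (u : ℝ) : 2 * Real.pi * tail expW u = expW u := by
  have hpi : (Real.pi : ℂ) ≠ 0 := by exact_mod_cast Real.pi_ne_zero
  have h := integral_exp_mul_Ioi (a := -(2 * Real.pi)) (by linarith [Real.pi_pos]) u
  have h2 : tail expW u = ((∫ v in Ioi u, Real.exp (-(2 * Real.pi) * v) : ℝ) : ℂ) := by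
    exact integral_ofReal (f := fun v : ℝ => Real.exp (-(2 * Real.pi) * v)) (𝕜 := ℂ)
  rw [h2, h, expW]
  push_cast
  field_simp

/-- Inversion r = 1/u preserves dr/r. In the new variable Z/t' = -iu, so the exponentials on the ray
become e^{-2πu} for every charge. -/
lemma rayIntegral_eq (Z : ℂ) (F : ℂ → ℂ) :
    rayIntegral Z F = ∫ u in Ioi (0 : ℝ), F (I * Z / u) / u := by
  rw [rayIntegral, ← integral_comp_rpow_Ioi _ (show (-1 : ℝ) ≠ 0 by norm_num)]
  refine setIntegral_congr_fun measurableSet_Ioi fun u (hu : 0 < u) => ?_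
  have hu' : (u : ℂ) ≠ 0 := by exact_mod_cast hu.ne'
  have e : u ^ ((-1 : ℝ) - 1) = (u ^ 2)⁻¹ := by
    rw [show (-1 : ℝ) - 1 = -((2 : ℕ) : ℝ) by norm_num, Real.rpow_neg hu.le, Real.rpow_natCast]
  simp only [Real.rpow_neg_one, e, abs_neg, abs_one, one_mul, real_smul]
  push_cast
  rw [div_eq_mul_inv (I * Z)]
  field_simp

/-- The spectral variable `-i Z/t` of a charge; it lies in the slit plane iff `t` is off the ray. -/
def slitVar (Z t : ℂ) : ℂ := -I * (Z / t)

lemma slitVar_mem_slitPlane {Z t : ℂ} (hZ : Z ≠ 0) (ht : t ≠ 0) (h : t ∉ ray Z) :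
    slitVar Z t ∈ slitPlane := by
  by_contra hcon
  rw [mem_slitPlane_iff] at hcon
  push Not at hcon
  apply h
  have e : Z / t = I * slitVar Z t := by
    rw [slitVar]; linear_combination (Z / t) * I_mul_I
  have e1 : slitVar Z t = ((slitVar Z t).re : ℂ) := by
    apply Complex.ext <;> simp [hcon.2]
  have hne : (slitVar Z t).re ≠ 0 := fun h0 => by
    rw [e1, h0, ofReal_zero, mul_zero] at e
    exact div_ne_zero hZ ht e
  exact ⟨(slitVar Z t).re, lt_of_le_of_ne hcon.1 hne, by rw [e, mul_comm, ← e1]⟩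

lemma notMem_ray_of_slitVar_mem {Z t : ℂ} (h : slitVar Z t ∈ slitPlane) : t ∉ ray Z := by
  rintro ⟨r, hr, e⟩
  have : slitVar Z t = (r : ℂ) := by
    rw [slitVar, e]; linear_combination -(r : ℂ) * I_mul_I
  rw [this, ofReal_mem_slitPlane] at h
  linarith

lemma ne_zero_of_slitVar_mem {Z t : ℂ} (h : slitVar Z t ∈ slitPlane) : Z ≠ 0 := by
  rintro rfl
  simp [slitVar] at h

lemma cauchyKernel_eq {Z t : ℂ} (ht : t ≠ 0) {u : ℝ} (hu : 0 < u) :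
    t / (I * Z / u - t) / u = -(1 / (slitVar Z t + u)) := by
  have hu' : (u : ℂ) ≠ 0 := by exact_mod_cast hu.ne'
  have e : I * Z / u - t = -(t * (slitVar Z t + u)) / u := by
    rw [slitVar]
    field_simp
    ring
  rw [e]
  -- On the ray both sides are 0 by the convention for division by zero.
  by_cases h : slitVar Z t + u = 0
  · simp [h]
  · field_simp

/-- `σ_γ e^{2πiθ_γ}`. -/
def fugacity {m : ℕ} (σ : (Fin m → ℤ) → ℂ) (θ : Fin m → ℂ) (γ : Fin m → ℤ) : ℂ :=
  σ γ * exp (2 * Real.pi * I * angle θ γ)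

lemma Xsf_ray {m : ℕ} (σ : (Fin m → ℤ) → ℂ) (θ : Fin m → ℂ) (γ : Fin m → ℤ) {z : Fin m → ℂ}
    (hZ : centralCharge z γ ≠ 0) {u : ℝ} (hu : 0 < u) :
    Xsf σ θ γ z (I * centralCharge z γ / u) = fugacity σ θ γ * expW u := by
  have hu' : (u : ℂ) ≠ 0 := by exact_mod_cast hu.ne'
  have e : centralCharge z γ / (I * centralCharge z γ / u) = -I * u := by
    field_simp
    simp
  rw [Xsf, fugacity, e, expW, ofReal_exp, mul_assoc (σ γ), ← exp_add]
  congr 2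
  push_cast
  linear_combination 2 * Real.pi * u * I_mul_I

lemma rayIntegral_log {m : ℕ} (σ : (Fin m → ℤ) → ℂ) (θ : Fin m → ℂ) (γ : Fin m → ℤ)
    {z : Fin m → ℂ} (hZ : centralCharge z γ ≠ 0) {t : ℂ} (ht : t ≠ 0) :
    rayIntegral (centralCharge z γ) (fun t' => t / (t - t') * log (1 - Xsf σ θ γ z t'))
      = -stieltjes (logW (fugacity σ θ γ)) (slitVar (centralCharge z γ) t) := by
  rw [rayIntegral_eq, stieltjes, ← integral_neg]
  refine setIntegral_congr_fun measurableSet_Ioi fun u (hu : 0 < u) => ?_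
  have h := cauchyKernel_eq (Z := centralCharge z γ) ht hu
  have e : t / (t - I * centralCharge z γ / u) = -(t / (I * centralCharge z γ / u - t)) := by
    rw [← div_neg, neg_sub]
  simp only [Xsf_ray σ θ γ hZ hu, e, logW]
  rw [mul_comm, mul_div_assoc, neg_div, h]
  ring

lemma rayIntegral_Xsf {m : ℕ} (σ : (Fin m → ℤ) → ℂ) (θ : Fin m → ℂ) (γ : Fin m → ℤ)
    {z : Fin m → ℂ} (hZ : centralCharge z γ ≠ 0) {t : ℂ} (ht : t ≠ 0) :
    rayIntegral (centralCharge z γ) (fun t' => t / (t' - t) * Xsf σ θ γ z t')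
      = -(fugacity σ θ γ * stieltjes expW (slitVar (centralCharge z γ) t)) := by
  rw [rayIntegral_eq, stieltjes, ← integral_const_mul, ← integral_neg]
  refine setIntegral_congr_fun measurableSet_Ioi fun u (hu : 0 < u) => ?_
  have h := cauchyKernel_eq (Z := centralCharge z γ) ht hu
  simp only [Xsf_ray σ θ γ hZ hu]
  rw [mul_comm, mul_div_assoc, h]
  ring

/-- The transform that appears in the integral formula for `log τ`. -/
def tauFn (φ : ℝ → ℂ) (q : ℂ) : ℂ :=
  -(2 * Real.pi * logStieltjes φ q) - Real.pi ^ 2 * I * tail φ 0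

lemma hasDerivAt_tauFn {φ : ℝ → ℂ} (hφ : IntegrableOn φ (Ioi 0))
    (hφ' : IntegrableOn (fun v : ℝ => (v : ℂ) * φ v) (Ioi 0)) {q : ℂ} (hq : q ∈ slitPlane) :
    HasDerivAt (tauFn φ) (-(2 * Real.pi * (q * ∫ v in Ioi (0 : ℝ), φ v / (q + v) ^ 2))) q :=
  (((hasDerivAt_logStieltjes hφ hφ' hq).const_mul _).neg).sub_const _

lemma logDown_eq (Z t : ℂ) : logDown (Z / t) = log (slitVar Z t) + I * (Real.pi / 2) := rfl

/-- Integration by parts produces the logarithm of q, whereas the formula uses `logDown`. The shift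
iπ/2 between them accounts for the constant π² i in `tauFn`. -/
lemma integral_eq_tauFn {φ : ℝ → ℂ} (hφ : IntegrableOn φ (Ioi 0))
    (hφ' : IntegrableOn (fun v : ℝ => (v : ℂ) * φ v) (Ioi 0)) {Z t : ℂ}
    (hq : slitVar Z t ∈ slitPlane) {F : ℝ → ℂ}
    (hF : ∀ u : ℝ, 0 < u → F u
      = -(1 / (slitVar Z t + u)) * (2 * Real.pi * tail φ u + 2 * Real.pi * u * φ u)) :
    (∫ u in Ioi (0 : ℝ), F u) - 2 * Real.pi * tail φ 0 * logDown (Z / t)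
      = tauFn φ (slitVar Z t) := by
  rw [tauFn, ← integral_tail_add_mul_div hφ hφ' hq, logDown_eq,
    setIntegral_congr_fun measurableSet_Ioi (g := fun u : ℝ =>
      -(2 * Real.pi) * ((tail φ u + u * φ u) / (slitVar Z t + u))) fun u hu => by
        beta_reduce; rw [hF u hu]; ring, integral_const_mul]
  ring

lemma logTauTermResummed_eq {m : ℕ} (B : Data m) (σ : (Fin m → ℤ) → ℂ) (θ : Fin m → ℂ)
    (γ : Fin m → ℤ) {p : (Fin m → ℂ) × ℂ} (ht : p.2 ≠ 0)
    (hq : B.Ω γ ≠ 0 → slitVar (centralCharge p.1 γ) p.2 ∈ slitPlane) :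
    logTauTermResummed B σ θ γ p = 1 / (4 * (Real.pi : ℂ) ^ 2) * (B.Ω γ : ℂ)
      * tauFn (logW (fugacity σ θ γ)) (slitVar (centralCharge p.1 γ) p.2) := by
  by_cases hΩ : B.Ω γ = 0
  · simp [logTauTermResummed, hΩ]
  have hq := hq hΩ
  have hZ := ne_zero_of_slitVar_mem hq
  rw [logTauTermResummed, ← integral_eq_tauFn (integrableOn_logW _) (integrableOn_mul_logW _) hq
    (F := fun u => p.2 / (I * centralCharge p.1 γ / u - p.2)
          * (dilog (Xsf σ θ γ p.1 (I * centralCharge p.1 γ / u))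
              - 2 * Real.pi * I * (centralCharge p.1 γ / (I * centralCharge p.1 γ / u))
                * log (1 - Xsf σ θ γ p.1 (I * centralCharge p.1 γ / u))) / u), rayIntegral_eq,
    ← dilog_mul_expW]
  · have : expW 0 = 1 := by simp [expW]
    rw [this, mul_one]
    rfl
  · intro u hu
    have hu' : (u : ℂ) ≠ 0 := by exact_mod_cast hu.ne'
    have e : centralCharge p.1 γ / (I * centralCharge p.1 γ / u) = -I * u := by
      field_simp
      simp
    -- The dilogarithm supplies the tail of the weight and the logarithm supplies the weight itself.
    rw [Xsf_ray σ θ γ hZ hu, e, dilog_mul_expW, ← cauchyKernel_eq ht hu, logW]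
    have e2 : 2 * Real.pi * I * (-I * u) = 2 * Real.pi * u := by
      linear_combination -(2 * Real.pi * u) * I_mul_I
    rw [e2]
    ring

lemma logTauTerm_eq {m : ℕ} (B : Data m) (σ : (Fin m → ℤ) → ℂ) (θ : Fin m → ℂ)
    (γ : Fin m → ℤ) {p : (Fin m → ℂ) × ℂ} (ht : p.2 ≠ 0)
    (hq : B.ratΩ γ ≠ 0 → slitVar (centralCharge p.1 γ) p.2 ∈ slitPlane) :
    logTauTerm B σ θ γ p = 1 / (4 * (Real.pi : ℂ) ^ 2) * ((B.ratΩ γ : ℂ) * fugacity σ θ γ)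
      * tauFn expW (slitVar (centralCharge p.1 γ) p.2) := by
  by_cases hΩ : B.ratΩ γ = 0
  · simp [logTauTerm, hΩ]
  have hq := hq hΩ
  have hZ := ne_zero_of_slitVar_mem hq
  rw [logTauTerm, ← integral_eq_tauFn integrableOn_expW integrableOn_mul_expW hq
    (F := fun u => p.2 / (I * centralCharge p.1 γ / u - p.2)
          * (1 + 2 * Real.pi * I * (centralCharge p.1 γ / (I * centralCharge p.1 γ / u)))
          * exp (-2 * Real.pi * I * (centralCharge p.1 γ / (I * centralCharge p.1 γ / u))) / u),
    rayIntegral_eq, tail_expW, fugacity]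
  · have : expW 0 = 1 := by simp [expW]
    rw [this, one_mul]
    ring
  · intro u hu
    have hu' : (u : ℂ) ≠ 0 := by exact_mod_cast hu.ne'
    have e : centralCharge p.1 γ / (I * centralCharge p.1 γ / u) = -I * u := by
      field_simp
      simp
    have e2 : 2 * Real.pi * I * (-I * u) = 2 * Real.pi * u := by
      linear_combination -(2 * Real.pi * u) * I_mul_I
    have e3 : exp (-2 * Real.pi * I * (-I * u)) = expW u := by
      rw [expW, ofReal_exp]
      congr 1
      push_cast
      linear_combination 2 * Real.pi * u * I_mul_I
    rw [e, e2, e3, tail_expW, ← cauchyKernel_eq ht hu]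
    ring

/-! ### Locally uniform limits of holomorphic functions of several variables -/

/-- The Weierstrass convergence theorem on an open subset of a finite-dimensional space. -/
lemma tendstoLocallyUniformlyOn_fderiv {E ι : Type*} [NormedAddCommGroup E] [NormedSpace ℂ E]
    [ProperSpace E] {l : Filter ι} [l.NeBot] {F : ι → E → ℂ} {f : E → ℂ} {V : Set E}
    (hV : IsOpen V) (hF : ∀ n, DifferentiableOn ℂ (F n) V)
    (h : TendstoLocallyUniformlyOn F f l V) :
    DifferentiableOn ℂ f V ∧
      TendstoLocallyUniformlyOn (fun n => fderiv ℂ (F n)) (fderiv ℂ f) l V := by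
  have key : ∀ x ∈ V, ∃ r : ℝ, 0 < r ∧ (∀ y ∈ Metric.ball x r, DifferentiableAt ℂ f y) ∧
      TendstoUniformlyOn (fun n => fderiv ℂ (F n)) (fderiv ℂ f) l (Metric.ball x r) := by
    intro x hx
    obtain ⟨ρ, hρ, hρV⟩ := Metric.isOpen_iff.1 hV x hx
    set r := ρ / 3 with hr
    have hr0 : 0 < r := by positivity
    have hsub : Metric.closedBall x (2 * r) ⊆ V :=
      (Metric.closedBall_subset_ball (by linarith)).trans hρV
    have hball : Metric.ball x r ⊆ Metric.closedBall x (2 * r) :=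
      (Metric.ball_subset_ball (by linarith)).trans Metric.ball_subset_closedBall
    have hdiff : ∀ n, ∀ y ∈ Metric.ball x r, DifferentiableAt ℂ (F n) y := fun n y hy =>
      (hF n).differentiableAt (hV.mem_nhds (hsub (hball hy)))
    have hunif : TendstoUniformlyOn F f l (Metric.closedBall x (2 * r)) :=
      (tendstoLocallyUniformlyOn_iff_forall_isCompact hV).1 h _ hsub (isCompact_closedBall _ _)
    -- Cauchy estimate for differences: values within rε/4 vary by at most rε/2 over a ball of
    -- radius r, so the derivatives differ by at most ε/2.
    have hcauchy : UniformCauchySeqOn (fun n => fderiv ℂ (F n)) l (Metric.ball x r) := by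
      intro u hu
      obtain ⟨ε, hε, hεu⟩ := Metric.mem_uniformity_dist.1 hu
      have h1 := hunif.uniformCauchySeqOn _
        (Metric.dist_mem_uniformity (show 0 < r * ε / 4 by positivity))
      filter_upwards [h1] with n hn y hy
      apply hεu
      have hsub' : Metric.ball y r ⊆ Metric.closedBall x (2 * r) := fun z hz => by
        rw [Metric.mem_ball] at hy hz
        rw [Metric.mem_closedBall]
        linarith [dist_triangle z y x]
      have hbound : ∀ z ∈ Metric.ball y r, ‖F n.1 z - F n.2 z‖ < r * ε / 4 := fun z hz => by
        have := hn z (hsub' hz)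
        rwa [dist_eq_norm] at this
      have h2 := norm_fderiv_le_div_of_mapsTo_ball (f := fun z => F n.1 z - F n.2 z) (c := y)
        (R₁ := r) (R₂ := r * ε / 2)
        (((hF n.1).sub (hF n.2)).mono (hsub'.trans hsub)) (fun z hz => by
          rw [Metric.mem_closedBall, dist_eq_norm]
          refine (norm_sub_le _ _).trans ?_
          linarith [hbound z hz, hbound y (Metric.mem_ball_self hr0)]) hr0
      rw [fderiv_fun_sub (hdiff _ y hy) (hdiff _ y hy)] at h2
      rw [dist_eq_norm]
      refine h2.trans_lt ?_
      rw [div_lt_iff₀ hr0]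
      nlinarith
    have hlim : ∀ y : E, ∃ g : E →L[ℂ] ℂ, y ∈ Metric.ball x r →
        Tendsto (fun n => fderiv ℂ (F n) y) l (𝓝 g) := fun y => by
      by_cases hy : y ∈ Metric.ball x r
      · obtain ⟨g, hg⟩ := CompleteSpace.complete (hcauchy.cauchy_map hy)
        exact ⟨g, fun _ => hg⟩
      · exact ⟨0, fun hy' => absurd hy' hy⟩
    choose g hg using hlim
    have hgu := hcauchy.tendstoUniformlyOn_of_tendsto hg
    have hder : ∀ y ∈ Metric.ball x r, HasFDerivAt f (g y) y := fun y hy =>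
      hasFDerivAt_of_tendstoUniformlyOn Metric.isOpen_ball hgu
        (fun n z hz => (hdiff n z hz).hasFDerivAt)
        (fun z hz => hunif.tendsto_at (hball hz)) hy
    refine ⟨r, hr0, fun y hy => (hder y hy).differentiableAt, ?_⟩
    exact hgu.congr_right fun y hy => (hder y hy).fderiv.symm
  constructor
  · intro x hx
    obtain ⟨r, hr, h1, _⟩ := key x hx
    exact (h1 x (Metric.mem_ball_self hr)).differentiableWithinAt
  · intro u hu x hx
    obtain ⟨r, hr, _, h2⟩ := key x hx
    exact ⟨Metric.ball x r, mem_nhdsWithin_of_mem_nhds (Metric.ball_mem_nhds x hr), h2 u hu⟩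

/-! ### The `τ`-function equations for sums of transforms -/

variable {m : ℕ}

lemma differentiable_centralCharge (γ : Fin m → ℤ) :
    Differentiable ℂ fun z : Fin m → ℂ => centralCharge z γ := by
  unfold centralCharge; fun_prop

/-- The row `a` of the Gram matrix of the pairing, as a direction in the space of central
charges. -/
def gramRow (B : Data m) (a : Fin m) : Fin m → ℂ := fun b => (B.ω a b : ℂ)

/-- Moving z along row a of ω changes Z_γ at the rate ⟨γ^a, γ⟩. This is how the left-hand side of
the τ-equations produces the pairings of the TBA equations. -/
lemma centralCharge_gramRow (B : Data m) (a : Fin m) (γ : Fin m → ℤ) :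
    centralCharge (gramRow B a) γ = (B.pairing (Pi.single a 1) γ : ℂ) := by
  rw [Data.pairing, Finset.sum_eq_single a]
  · simp only [Pi.single_eq_same, one_mul, centralCharge, gramRow]
    push_cast
    exact Finset.sum_congr rfl fun b _ => mul_comm _ _
  · intro b _ hb
    simp [Pi.single_eq_of_ne hb]
  · simp

lemma centralCharge_add_smul (z d : Fin m → ℂ) (ε : ℂ) (γ : Fin m → ℤ) :
    centralCharge (z + ε • d) γ = centralCharge z γ + ε * centralCharge d γ := by
  simp only [centralCharge, Pi.add_apply, Pi.smul_apply, smul_eq_mul, Finset.mul_sum,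
    ← Finset.sum_add_distrib]
  exact Finset.sum_congr rfl fun b _ => by ring

lemma hasDerivAt_slitVar (Z : ℂ) {t : ℂ} (ht : t ≠ 0) :
    HasDerivAt (fun t => slitVar Z t) (-(slitVar Z t / t)) t := by
  have h := (((hasDerivAt_id t).inv ht).const_mul Z).const_mul (-I)
  have e : (fun t => slitVar Z t) = fun t => -I * (Z * (id t)⁻¹) := by
    ext t; rw [slitVar, div_eq_mul_inv]; rfl
  rw [e]
  convert! h using 1
  rw [slitVar]
  simp only [id]
  field_simp

/-- The `t`-derivative of a term of the TBA equation is a directional derivative of a term of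
`log τ`. -/
lemma hasDerivAt_tbaTerm (B : Data m) (a : Fin m) {γ : Fin m → ℤ} {c : ℂ} {φ : ℝ → ℂ}
    (hφ : IntegrableOn φ (Ioi 0)) (hφ' : IntegrableOn (fun v : ℝ => (v : ℂ) * φ v) (Ioi 0))
    {V : Set ((Fin m → ℂ) × ℂ)} (hV : IsOpen V) {f : (Fin m → ℂ) × ℂ → ℂ}
    (hf : ∀ p ∈ V, f p = 1 / (4 * (Real.pi : ℂ) ^ 2) * c
      * tauFn φ (slitVar (centralCharge p.1 γ) p.2))
    {p : (Fin m → ℂ) × ℂ} (hp : p ∈ V) (ht : p.2 ≠ 0)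
    (hq : c ≠ 0 → slitVar (centralCharge p.1 γ) p.2 ∈ slitPlane) :
    DifferentiableAt ℂ f p ∧
      HasDerivAt (fun t => c * (B.pairing (Pi.single a 1) γ : ℂ)
        * -stieltjes φ (slitVar (centralCharge p.1 γ) t))
        (2 * Real.pi * I * fderiv ℂ f p (gramRow B a, 0)) p.2 := by
  have hev : f =ᶠ[𝓝 p] fun p => 1 / (4 * (Real.pi : ℂ) ^ 2) * c
      * tauFn φ (slitVar (centralCharge p.1 γ) p.2) := by
    filter_upwards [hV.mem_nhds hp] with p hp using hf p hp
  -- An inactive charge may have q on the cut, where the transforms are not controlled; its term is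
  -- zero.
  by_cases hc : c = 0
  · subst hc
    simp only [mul_zero, zero_mul] at hev ⊢
    have h0 : HasFDerivAt f (0 : (Fin m → ℂ) × ℂ →L[ℂ] ℂ) p :=
      (hasFDerivAt_const (0 : ℂ) p).congr_of_eventuallyEq hev
    refine ⟨h0.differentiableAt, ?_⟩
    rw [h0.fderiv]
    simpa using hasDerivAt_const p.2 (0 : ℂ)
  · have hq := hq hc
    set q := slitVar (centralCharge p.1 γ) p.2 with hq_def
    set J := ∫ v in Ioi (0 : ℝ), φ v / (q + v) ^ 2 with hJ
    have hdq : DifferentiableAt ℂ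
        (fun p : (Fin m → ℂ) × ℂ => slitVar (centralCharge p.1 γ) p.2) p := by
      simp only [slitVar, div_eq_mul_inv]
      exact (((differentiable_centralCharge γ).differentiableAt.comp p
        differentiableAt_fst).mul (differentiableAt_snd.inv ht)).const_mul _
    have hdf : DifferentiableAt ℂ f p :=
      (((hasDerivAt_tauFn hφ hφ' hq).differentiableAt.comp p hdq).const_mul
        (1 / (4 * (Real.pi : ℂ) ^ 2) * c)).congr_of_eventuallyEq hev
    refine ⟨hdf, ?_⟩
    have hline : HasDerivAt (fun ε : ℂ => (p.1 + ε • gramRow B a, p.2)) (gramRow B a, 0) 0 := by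
      have h1 : HasDerivAt (fun ε : ℂ => p.1 + ε • gramRow B a) (gramRow B a) 0 := by
        simpa using! ((hasDerivAt_id (0 : ℂ)).smul_const (gramRow B a)).const_add p.1
      exact h1.prodMk (hasDerivAt_const _ _)
    have hp0 : (fun ε : ℂ => (p.1 + ε • gramRow B a, p.2)) 0 = p := by simp
    have hdir : HasDerivAt (fun ε : ℂ => f (p.1 + ε • gramRow B a, p.2))
        (fderiv ℂ f p (gramRow B a, 0)) 0 := by
      have h1 : HasFDerivAt f (fderiv ℂ f p) ((fun ε : ℂ => (p.1 + ε • gramRow B a, p.2)) 0) := by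
        rw [hp0]; exact hdf.hasFDerivAt
      exact h1.comp_hasDerivAt 0 hline
    have hdir' : HasDerivAt (fun ε : ℂ => f (p.1 + ε • gramRow B a, p.2))
        (1 / (4 * (Real.pi : ℂ) ^ 2) * c * (-(2 * Real.pi * (q * J))
          * (-I * ((B.pairing (Pi.single a 1) γ : ℂ) / p.2)))) 0 := by
      have hlin : HasDerivAt (fun ε : ℂ => slitVar (centralCharge (p.1 + ε • gramRow B a) γ) p.2)
          (-I * ((B.pairing (Pi.single a 1) γ : ℂ) / p.2)) 0 := by
        simp only [centralCharge_add_smul, centralCharge_gramRow, slitVar]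
        simpa using! ((((hasDerivAt_id (0 : ℂ)).mul_const
          (B.pairing (Pi.single a 1) γ : ℂ)).const_add
          (centralCharge p.1 γ)).div_const p.2).const_mul (-I)
      have h1 : HasDerivAt (tauFn φ) (-(2 * Real.pi * (q * J)))
          ((fun ε : ℂ => slitVar (centralCharge (p.1 + ε • gramRow B a) γ) p.2) 0) := by
        simpa using hasDerivAt_tauFn hφ hφ' hq
      have h2 := (h1.comp 0 hlin).const_mul (1 / (4 * (Real.pi : ℂ) ^ 2) * c)
      refine h2.congr_of_eventuallyEq ?_
      have hcont : Tendsto (fun ε : ℂ => (p.1 + ε • gramRow B a, p.2)) (𝓝 0) (𝓝 p) := by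
        have := hline.continuousAt.tendsto
        rwa [zero_smul, add_zero] at this
      exact hcont.eventually hev
    rw [hdir.unique hdir']
    -- Here q changes at rate -q/t with t, against -i⟨γ^a, γ⟩/t along the row. The factor q in the
    -- derivative of `tauFn` compensates, and both sides are -c⟨γ^a, γ⟩qJ/t.
    have h3 := ((hasDerivAt_stieltjes hφ hq).comp p.2
      (hasDerivAt_slitVar (centralCharge p.1 γ) ht)).neg.const_mul
      (c * (B.pairing (Pi.single a 1) γ : ℂ))
    convert! h3 using 1
    have hpi : (Real.pi : ℂ) ≠ 0 := by exact_mod_cast Real.pi_ne_zero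
    rw [← hq_def, ← hJ]
    field_simp
    rw [I_sq]
    ring

/-- The integrability of the `τ`-function equations and the integral formula, for modes whose
corrections are sums of Stieltjes transforms. -/
theorem isLogTau_iff_of_transform (B : Data m) (σ : (Fin m → ℤ) → ℂ) (θ : Fin m → ℂ)
    (L : SummationFilter (Fin m → ℤ)) [L.NeBot] {V : Set ((Fin m → ℂ) × ℂ)} (hV : IsOpen V)
    {c : (Fin m → ℤ) → ℂ} {φ : (Fin m → ℤ) → ℝ → ℂ} (hφ : ∀ γ, IntegrableOn (φ γ) (Ioi 0))
    (hφ' : ∀ γ, IntegrableOn (fun v : ℝ => (v : ℂ) * φ γ v) (Ioi 0))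
    (ht : ∀ p ∈ V, p.2 ≠ 0)
    (hslit : ∀ p ∈ V, ∀ γ, c γ ≠ 0 → slitVar (centralCharge p.1 γ) p.2 ∈ slitPlane)
    {X : (Fin m → ℤ) → (Fin m → ℂ) → ℂ → ℂ}
    (hX : ∀ p ∈ V, ∀ a : Fin m, ∃ s : ℂ,
      HasSum (fun γ => c γ * (B.pairing (Pi.single a 1) γ : ℂ)
        * -stieltjes (φ γ) (slitVar (centralCharge p.1 γ) p.2)) s L ∧
      X (Pi.single a 1) p.1 p.2 / Xsf σ θ (Pi.single a 1) p.1 p.2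
        = exp (s / (2 * Real.pi * I)))
    {f : (Fin m → ℤ) → (Fin m → ℂ) × ℂ → ℂ}
    (hf : ∀ γ, ∀ p ∈ V, f γ p = 1 / (4 * (Real.pi : ℂ) ^ 2) * c γ
      * tauFn (φ γ) (slitVar (centralCharge p.1 γ) p.2))
    {T : (Fin m → ℂ) × ℂ → ℂ} (hT : SumsLocallyUniformly L f T V)
    {t : ℂ} {W : Set (Fin m → ℂ)} (hW : IsOpen W) (hWc : IsPreconnected W)
    (hWV : ∀ z ∈ W, (z, t) ∈ V) (logτ : (Fin m → ℂ) → ℂ) :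
    IsLogTau B σ θ X t W logτ ↔ ∃ c : ℂ, ∀ z ∈ W, logτ z = T (z, t) + c := by
  have hterm := fun γ a p (hp : p ∈ V) => hasDerivAt_tbaTerm B a (hφ γ) (hφ' γ) hV (hf γ) hp
    (ht p hp) (hslit p hp γ)
  have hfd : ∀ γ, ∀ p ∈ V, DifferentiableAt ℂ (f γ) p := fun γ p hp => by
    by_cases hm : Nonempty (Fin m)
    · exact (hterm γ hm.some p hp).1
    · have : IsEmpty (Fin m) := not_nonempty_iff.1 hm
      have h0 : ∀ p ∈ V, f γ p = 0 := fun p hp => by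
        have hc : c γ = 0 := by
          by_contra hc
          exact ne_zero_of_slitVar_mem (hslit p hp γ hc) (by simp [centralCharge])
        rw [hf γ p hp, hc]; ring
      refine (differentiableAt_const (0 : ℂ)).congr_of_eventuallyEq ?_
      filter_upwards [hV.mem_nhds hp] with p hp using h0 p hp
  obtain ⟨hTd, hTu⟩ := tendstoLocallyUniformlyOn_fderiv hV (fun S => fun p hp =>
    (DifferentiableAt.fun_sum fun γ _ => hfd γ p hp).differentiableWithinAt) hT
  have hderiv : ∀ p ∈ V, ∀ a : Fin m,
      HasDerivAt (fun s => X (Pi.single a 1) p.1 s / Xsf σ θ (Pi.single a 1) p.1 s)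
        (X (Pi.single a 1) p.1 p.2 / Xsf σ θ (Pi.single a 1) p.1 p.2
          * fderiv ℂ T p (gramRow B a, 0)) p.2 ∧
      X (Pi.single a 1) p.1 p.2 / Xsf σ θ (Pi.single a 1) p.1 p.2 ≠ 0 := by
    intro p hp a
    set V' : Set ℂ := {s | (p.1, s) ∈ V} with hV'
    have hcont : Continuous fun s : ℂ => (p.1, s) := by fun_prop
    have hV'o : IsOpen V' := hV.preimage hcont
    have hex : ∀ s : ℂ, ∃ g : ℂ, s ∈ V' →
        HasSum (fun γ => c γ * (B.pairing (Pi.single a 1) γ : ℂ)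
          * -stieltjes (φ γ) (slitVar (centralCharge p.1 γ) s)) g L ∧
        X (Pi.single a 1) p.1 s / Xsf σ θ (Pi.single a 1) p.1 s
          = exp (g / (2 * Real.pi * I)) := fun s => by
      by_cases hs : s ∈ V'
      · obtain ⟨g, hg⟩ := hX (p.1, s) hs a
        exact ⟨g, fun _ => hg⟩
      · exact ⟨0, fun h => absurd h hs⟩
    choose g hg using hex
    -- Evaluation on a fixed vector is continuous linear, hence preserves locally uniform
    -- convergence. The differentiated TBA series therefore inherits its convergence from the
    -- derivatives of the partial sums of log τ.
    have hev : UniformContinuous fun A : (Fin m → ℂ) × ℂ →L[ℂ] ℂ =>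
        2 * Real.pi * I * A (gramRow B a, 0) :=
      ((2 * Real.pi * I) • ContinuousLinearMap.apply ℂ ℂ
        ((gramRow B a, 0) : (Fin m → ℂ) × ℂ)).uniformContinuous
    have hunif := hev.comp_tendstoLocallyUniformlyOn
      (hTu.comp (fun s : ℂ => (p.1, s)) (fun s (hs : s ∈ V') => hs) hcont.continuousOn)
    have hgd : HasDerivAt g (2 * Real.pi * I * fderiv ℂ T p (gramRow B a, 0)) p.2 := by
      refine hasDerivAt_of_tendstoLocallyUniformlyOn hV'o hunif
        (f := fun S s => ∑ γ ∈ S, c γ * (B.pairing (Pi.single a 1) γ : ℂ)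
          * -stieltjes (φ γ) (slitVar (centralCharge p.1 γ) s))
        (.of_forall fun S s hs => ?_) (fun s hs => (hg s hs).1) (show p.2 ∈ V' from hp)
      have h1 := HasDerivAt.fun_sum (u := S) fun γ _ => (hterm γ a (p.1, s) hs).2
      convert! h1 using 1
      simp only [Function.comp]
      rw [fderiv_fun_sum fun γ _ => hfd γ (p.1, s) hs, sum_apply,
        Finset.mul_sum]
    have hXg : (fun s => X (Pi.single a 1) p.1 s / Xsf σ θ (Pi.single a 1) p.1 s)
        =ᶠ[𝓝 p.2] fun s => exp (g s / (2 * Real.pi * I)) := by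
      filter_upwards [hV'o.mem_nhds (show p.2 ∈ V' from hp)] with s hs using (hg s hs).2
    have hval : X (Pi.single a 1) p.1 p.2 / Xsf σ θ (Pi.single a 1) p.1 p.2
        = exp (g p.2 / (2 * Real.pi * I)) := (hg p.2 hp).2
    refine ⟨?_, by rw [hval]; exact exp_ne_zero _⟩
    rw [hval]
    have h2 := ((hgd.div_const (2 * Real.pi * I)).cexp).congr_of_eventuallyEq hXg
    rwa [mul_div_cancel_left₀ _ two_pi_I_ne_zero] at h2
  have hTslice : ∀ z ∈ W, HasFDerivAt (fun z => T (z, t))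
      ((fderiv ℂ T (z, t)).comp (ContinuousLinearMap.inl ℂ (Fin m → ℂ) ℂ)) z := fun z hz => by
    have h1 : HasFDerivAt (fun z : Fin m → ℂ => (z, t))
        (ContinuousLinearMap.inl ℂ (Fin m → ℂ) ℂ) z := hasFDerivAt_prodMk_left z t
    exact ((hTd.differentiableAt (hV.mem_nhds (hWV z hz))).hasFDerivAt).comp z h1
  have hsum : ∀ (A : (Fin m → ℂ) →L[ℂ] ℂ) (a : Fin m),
      ∑ b, (B.ω a b : ℂ) * A (Pi.single b 1) = A (gramRow B a) := fun A a => by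
    have : gramRow B a = ∑ b, (B.ω a b : ℂ) • (Pi.single b 1 : Fin m → ℂ) := by
      ext b
      simp [gramRow, Finset.sum_apply, Pi.single_apply]
    rw [this, map_sum]
    simp
  have hlogDeriv : ∀ z ∈ W, ∀ a : Fin m,
      logDeriv (fun s => X (Pi.single a 1) z s / Xsf σ θ (Pi.single a 1) z s) t
        = fderiv ℂ T (z, t) (gramRow B a, 0) := fun z hz a => by
    obtain ⟨h1, h2⟩ := hderiv (z, t) (hWV z hz) a
    rw [logDeriv_apply, h1.deriv, mul_div_cancel_left₀ _ h2]
  constructor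
  · rintro ⟨hd, heq⟩
    have hTdW : DifferentiableOn ℂ (fun z => T (z, t)) W := fun z hz =>
      (hTslice z hz).differentiableAt.differentiableWithinAt
    obtain ⟨k, hk⟩ := hW.exists_eq_add_of_fderiv_eq hWc hd hTdW fun z hz => by
      rw [(hTslice z hz).fderiv]
      set A := fderiv ℂ logτ z with hA
      set A' := (fderiv ℂ T (z, t)).comp (ContinuousLinearMap.inl ℂ (Fin m → ℂ) ℂ) with hA'
      -- The difference of the two gradients is annihilated by ω, hence is zero.
      have hrow : ∀ a, ∑ b, (B.ω a b : ℂ) * (A - A') (Pi.single b 1) = 0 := fun a => by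
        have h1 := (heq z hz a).2
        rw [hlogDeriv z hz a, hsum] at h1
        rw [hsum, sub_apply, h1]
        simp [hA']
      have hdet : (B.ω.map (Int.cast : ℤ → ℂ)).det ≠ 0 := by
        have := Int.cast_det (R := ℂ) B.ω
        rw [← this]
        exact_mod_cast B.nondegenerate
      have hzero := Matrix.eq_zero_of_mulVec_eq_zero hdet
        (v := fun b => (A - A') (Pi.single b 1)) (by
          ext a
          simpa [Matrix.mulVec, dotProduct] using hrow a)
      have hlin : ((A - A' : (Fin m → ℂ) →L[ℂ] ℂ) : (Fin m → ℂ) →ₗ[ℂ] ℂ) = 0 := by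
        refine LinearMap.pi_ext' fun b => LinearMap.ext_ring ?_
        simpa using congrFun hzero b
      have : A - A' = 0 := ContinuousLinearMap.coe_injective (by simpa using hlin)
      exact sub_eq_zero.1 this
    exact ⟨k, hk⟩
  · rintro ⟨k, hk⟩
    have hder : ∀ z ∈ W, HasFDerivAt logτ
        ((fderiv ℂ T (z, t)).comp (ContinuousLinearMap.inl ℂ (Fin m → ℂ) ℂ)) z := fun z hz => by
      refine ((hTslice z hz).add_const k).congr_of_eventuallyEq ?_
      filter_upwards [hW.mem_nhds hz] with z hz using hk z hz
    refine ⟨fun z hz => (hder z hz).differentiableAt.differentiableWithinAt, fun z hz a =>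
      ⟨(hderiv (z, t) (hWV z hz) a).1.differentiableAt, ?_⟩⟩
    rw [(hder z hz).fderiv, hsum, hlogDeriv z hz a]
    simp

variable {m : ℕ}

/-! ### The uncoupled case -/

lemma Data.IsBPSAt.centralCharge_ne_zero {B : Data m} {z : Fin m → ℂ} (h : B.IsBPSAt z)
    {γ : Fin m → ℤ} (hγ : B.Ω γ ≠ 0) : centralCharge z γ ≠ 0 := by
  obtain ⟨ε, hε, h⟩ := h.1
  rw [← norm_pos_iff]
  exact lt_of_le_of_lt (by positivity) (h γ hγ)

lemma slitVar_mem_of_mem_domain {B : Data m} {p : (Fin m → ℂ) × ℂ} (hp : p ∈ B.domain)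
    {γ : Fin m → ℤ} (hγ : B.Ω γ ≠ 0) : slitVar (centralCharge p.1 γ) p.2 ∈ slitPlane :=
  slitVar_mem_slitPlane (hp.1.centralCharge_ne_zero hγ) hp.2.1 (hp.2.2 γ hγ)

lemma centralCharge_nsmul (z : Fin m → ℂ) (d : ℕ) (γ : Fin m → ℤ) :
    centralCharge z (d • γ) = d * centralCharge z γ := by
  simp only [centralCharge, Finset.mul_sum]
  exact Finset.sum_congr rfl fun a _ => by simp; ring

lemma angle_nsmul (θ : Fin m → ℂ) (d : ℕ) (γ : Fin m → ℤ) :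
    angle θ (d • γ) = d * angle θ γ := centralCharge_nsmul θ d γ

lemma pairing_nsmul_right (B : Data m) (d : ℕ) (γ γ' : Fin m → ℤ) :
    B.pairing γ (d • γ') = d * B.pairing γ γ' := by
  simp only [Data.pairing, Finset.mul_sum]
  exact Finset.sum_congr rfl fun a _ => Finset.sum_congr rfl fun b _ => by simp; ring

lemma pairing_nsmul_left (B : Data m) (d : ℕ) (γ γ' : Fin m → ℤ) :
    B.pairing (d • γ) γ' = d * B.pairing γ γ' := by
  simp only [Data.pairing, Finset.mul_sum]
  exact Finset.sum_congr rfl fun a _ => Finset.sum_congr rfl fun b _ => by simp; ring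

lemma slitVar_natCast_mul (d : ℕ) (Z t : ℂ) : slitVar (d * Z) t = d * slitVar Z t := by
  rw [slitVar, slitVar]; ring

lemma natCast_mul_mem_slitPlane {d : ℕ} (hd : 0 < d) {q : ℂ} (hq : q ∈ slitPlane) :
    (d : ℂ) * q ∈ slitPlane := by
  have hd' : (0 : ℝ) < d := by exact_mod_cast hd
  have e : ((d : ℂ) * q).re = d * q.re ∧ ((d : ℂ) * q).im = d * q.im := by
    simp
  rw [mem_slitPlane_iff, e.1, e.2]
  exact hq.imp (fun h => by positivity) (fun h => mul_ne_zero hd'.ne' h)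

lemma natCast_dvd_of_mem_divisors {γ : Fin m → ℤ} {d : ℕ}
    (hd : d ∈ (Finset.univ.gcd γ).natAbs.divisors) :
    0 < d ∧ γ = d • (fun a => γ a / (d : ℤ)) := by
  refine ⟨Nat.pos_of_mem_divisors hd, funext fun a => ?_⟩
  have h1 : (d : ℤ) ∣ γ a :=
    (Int.natCast_dvd.2 (Nat.dvd_of_mem_divisors hd)).trans (Finset.gcd_dvd (Finset.mem_univ a))
  simp [Int.mul_ediv_cancel' h1]

/-- Through this the conditions on active charges (off the rays, nonzero central charge, vanishing
pairings) pass to charges with nonzero rational invariant, since all of them are stable under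
positive multiples. -/
lemma exists_of_ratΩ_ne_zero {B : Data m} {γ : Fin m → ℤ} (h : B.ratΩ γ ≠ 0) :
    ∃ d : ℕ, 0 < d ∧ ∃ γ₀, B.Ω γ₀ ≠ 0 ∧ γ = d • γ₀ := by
  obtain ⟨d, hd, hne⟩ := Finset.exists_ne_zero_of_sum_ne_zero h
  obtain ⟨hd0, hγ⟩ := natCast_dvd_of_mem_divisors hd
  refine ⟨d, hd0, _, fun h0 => hne ?_, hγ⟩
  rw [h0]; simp

lemma slitVar_mem_of_ratΩ {B : Data m} {z : Fin m → ℂ} {t : ℂ}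
    (h : ∀ γ, B.Ω γ ≠ 0 → slitVar (centralCharge z γ) t ∈ slitPlane)
    {γ : Fin m → ℤ} (hγ : B.ratΩ γ ≠ 0) : slitVar (centralCharge z γ) t ∈ slitPlane := by
  obtain ⟨d, hd, γ₀, h0, rfl⟩ := exists_of_ratΩ_ne_zero hγ
  rw [centralCharge_nsmul, slitVar_natCast_mul]
  exact natCast_mul_mem_slitPlane hd (h γ₀ h0)

lemma centralCharge_ne_zero_of_ratΩ {B : Data m} {z : Fin m → ℂ} (h : B.IsBPSAt z)
    {γ : Fin m → ℤ} (hγ : B.ratΩ γ ≠ 0) : centralCharge z γ ≠ 0 := by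
  obtain ⟨d, hd, γ₀, h0, rfl⟩ := exists_of_ratΩ_ne_zero hγ
  rw [centralCharge_nsmul]
  exact mul_ne_zero (by exact_mod_cast hd.ne') (h.centralCharge_ne_zero h0)

lemma pairing_eq_zero_of_ratΩ {B : Data m} (hB : B.Uncoupled) {γ γ' : Fin m → ℤ}
    (hγ : B.ratΩ γ ≠ 0) (hγ' : B.ratΩ γ' ≠ 0) : B.pairing γ γ' = 0 := by
  obtain ⟨d, _, γ₀, h0, rfl⟩ := exists_of_ratΩ_ne_zero hγ
  obtain ⟨e, _, γ₁, h1, rfl⟩ := exists_of_ratΩ_ne_zero hγ'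
  rw [pairing_nsmul_left, pairing_nsmul_right]
  by_contra hne
  rcases hB γ₀ γ₁ (fun h => hne (by rw [h]; ring)) with h | h
  · exact h0 h
  · exact h1 h

lemma pairing_eq_zero_of_Ω {B : Data m} (hB : B.Uncoupled) {γ γ' : Fin m → ℤ}
    (hγ : B.Ω γ ≠ 0) (hγ' : B.Ω γ' ≠ 0) : B.pairing γ γ' = 0 := by
  by_contra hne
  exact (hB γ γ' hne).elim hγ hγ'

lemma rayIntegral_congr {Z : ℂ} (hZ : Z ≠ 0) {F G : ℂ → ℂ} (h : ∀ t, t ≠ 0 → F t = G t) :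
    rayIntegral Z F = rayIntegral Z G := by
  refine setIntegral_congr_fun measurableSet_Ioi fun r (hr : 0 < r) => ?_
  have hr' : (r : ℂ) ≠ 0 := by exact_mod_cast hr.ne'
  simp only [h _ (mul_ne_zero (mul_ne_zero I_ne_zero hZ) hr')]

/-- By uncoupledness no ray contributes to the equation of an active charge, so the equation holds
at every t ≠ 0, including on the charge's own ray, and its sum is zero. -/
lemma SolvesTBA.eq_Xsf {B : Data m} (hB : B.Uncoupled) {σ : (Fin m → ℤ) → ℂ} {θ : Fin m → ℂ}
    {L : SummationFilter (Fin m → ℤ)} [L.NeBot] {X : (Fin m → ℤ) → (Fin m → ℂ) → ℂ → ℂ}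
    {z : Fin m → ℂ} (h : SolvesTBA B σ θ L X z) {γ : Fin m → ℤ} (hγ : B.Ω γ ≠ 0) {t : ℂ}
    (ht : t ≠ 0) : X γ z t = Xsf σ θ γ z t := by
  obtain ⟨s, hs, hX⟩ := h γ t ht fun γ' h1 h2 => absurd (pairing_eq_zero_of_Ω hB hγ h1) h2
  have h0 : ∀ γ', (B.Ω γ' : ℂ) * (B.pairing γ γ' : ℂ) = 0 := fun γ' => by
    by_cases h1 : B.Ω γ' = 0
    · simp [h1]
    · simp [pairing_eq_zero_of_Ω hB hγ h1]
  simp only [h0, zero_mul] at hs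
  rw [hX, hs.unique hasSum_zero]
  simp

lemma SolvesTBARational.eq_Xsf {B : Data m} (hB : B.Uncoupled) {σ : (Fin m → ℤ) → ℂ}
    {θ : Fin m → ℂ} {L : SummationFilter (Fin m → ℤ)} [L.NeBot]
    {X : (Fin m → ℤ) → (Fin m → ℂ) → ℂ → ℂ} {z : Fin m → ℂ} (h : SolvesTBARational B σ θ L X z)
    {γ : Fin m → ℤ} (hγ : B.ratΩ γ ≠ 0) {t : ℂ} (ht : t ≠ 0) : X γ z t = Xsf σ θ γ z t := by
  obtain ⟨s, hs, hX⟩ := h γ t ht fun γ' h1 h2 => absurd (pairing_eq_zero_of_ratΩ hB hγ h1) h2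
  have h0 : ∀ γ', (B.ratΩ γ' : ℂ) * (B.pairing γ γ' : ℂ) = 0 := fun γ' => by
    by_cases h1 : B.ratΩ γ' = 0
    · simp [h1]
    · simp [pairing_eq_zero_of_ratΩ hB hγ h1]
  simp only [h0, zero_mul] at hs
  rw [hX, hs.unique hasSum_zero]
  simp

lemma tbaTerm_eq {B : Data m} {σ : (Fin m → ℤ) → ℂ} {θ : Fin m → ℂ}
    {X : (Fin m → ℤ) → (Fin m → ℂ) → ℂ → ℂ} {z : Fin m → ℂ} (hz : B.IsBPSAt z)
    (hX : ∀ γ, B.Ω γ ≠ 0 → ∀ t, t ≠ 0 → X γ z t = Xsf σ θ γ z t) (γ γ' : Fin m → ℤ) {t : ℂ}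
    (ht : t ≠ 0) :
    (B.Ω γ' : ℂ) * (B.pairing γ γ' : ℂ) * rayIntegral (centralCharge z γ')
        (fun t' => t / (t - t') * log (1 - X γ' z t'))
      = (B.Ω γ' : ℂ) * (B.pairing γ γ' : ℂ)
        * -stieltjes (logW (fugacity σ θ γ')) (slitVar (centralCharge z γ') t) := by
  by_cases h : B.Ω γ' = 0
  · simp [h]
  · have hZ := hz.centralCharge_ne_zero h
    rw [← rayIntegral_log σ θ γ' hZ ht]
    congr 1
    exact rayIntegral_congr hZ fun t' ht' => by rw [hX γ' h t' ht']

lemma tbaTermRational_eq {B : Data m} {σ : (Fin m → ℤ) → ℂ} {θ : Fin m → ℂ}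
    {X : (Fin m → ℤ) → (Fin m → ℂ) → ℂ → ℂ} {z : Fin m → ℂ} (hz : B.IsBPSAt z)
    (hX : ∀ γ, B.ratΩ γ ≠ 0 → ∀ t, t ≠ 0 → X γ z t = Xsf σ θ γ z t) (γ γ' : Fin m → ℤ) {t : ℂ}
    (ht : t ≠ 0) :
    (B.ratΩ γ' : ℂ) * (B.pairing γ γ' : ℂ) * rayIntegral (centralCharge z γ')
        (fun t' => t / (t' - t) * X γ' z t')
      = (B.ratΩ γ' : ℂ) * fugacity σ θ γ' * (B.pairing γ γ' : ℂ)
        * -stieltjes expW (slitVar (centralCharge z γ') t) := by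
  by_cases h : B.ratΩ γ' = 0
  · simp [h]
  · have hZ := centralCharge_ne_zero_of_ratΩ hz h
    have e : rayIntegral (centralCharge z γ') (fun t' => t / (t' - t) * X γ' z t')
        = rayIntegral (centralCharge z γ') (fun t' => t / (t' - t) * Xsf σ θ γ' z t') :=
      rayIntegral_congr hZ fun t' ht' => by rw [hX γ' h t' ht']
    rw [e, rayIntegral_Xsf σ θ γ' hZ ht]
    ring

lemma Xsf_ne_zero {B : Data m} {σ : (Fin m → ℤ) → ℂ} (hσ : B.IsQuadraticRefinement σ)
    (θ : Fin m → ℂ) (γ : Fin m → ℤ) (z : Fin m → ℂ) (t : ℂ) : Xsf σ θ γ z t ≠ 0 :=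
  mul_ne_zero (hσ.1 γ) (exp_ne_zero _)

/-- The integral formula in terms of the integer invariants. -/
theorem isLogTau_iff_of_solvesTBA {B : Data m} (hB : B.Uncoupled) {σ : (Fin m → ℤ) → ℂ}
    (hσ : B.IsQuadraticRefinement σ) (θ : Fin m → ℂ) (L : SummationFilter (Fin m → ℤ)) [L.NeBot]
    {V : Set ((Fin m → ℂ) × ℂ)} (hV : IsOpen V) (hVD : V ⊆ B.domain)
    {X : (Fin m → ℤ) → (Fin m → ℂ) → ℂ → ℂ} (hX : ∀ p ∈ V, SolvesTBA B σ θ L X p.1)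
    {T : (Fin m → ℂ) × ℂ → ℂ} (hT : SumsLocallyUniformly L (logTauTermResummed B σ θ) T V)
    {t : ℂ} {W : Set (Fin m → ℂ)} (hW : IsOpen W) (hWc : IsPreconnected W)
    (hWV : ∀ z ∈ W, (z, t) ∈ V) (logτ : (Fin m → ℂ) → ℂ) :
    IsLogTau B σ θ X t W logτ ↔ ∃ c : ℂ, ∀ z ∈ W, logτ z = T (z, t) + c := by
  have hslit : ∀ p ∈ V, ∀ γ, B.Ω γ ≠ 0 → slitVar (centralCharge p.1 γ) p.2 ∈ slitPlane :=
    fun p hp γ h => slitVar_mem_of_mem_domain (hVD hp) h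
  refine isLogTau_iff_of_transform B σ θ L hV (c := fun γ => (B.Ω γ : ℂ))
    (φ := fun γ => logW (fugacity σ θ γ)) (fun γ => integrableOn_logW _)
    (fun γ => integrableOn_mul_logW _) (fun p hp => (hVD hp).2.1)
    (fun p hp γ h => hslit p hp γ (by exact_mod_cast h)) (fun p hp a => ?_)
    (fun γ p hp => logTauTermResummed_eq B σ θ γ (hVD hp).2.1 (hslit p hp γ)) hT hW hWc hWV logτ
  have hp' := hVD hp
  obtain ⟨s, hs, he⟩ := hX p hp (Pi.single a 1) p.2 hp'.2.1 fun γ' h _ => hp'.2.2 γ' h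
  refine ⟨s, ?_, ?_⟩
  · simpa only [tbaTerm_eq hp'.1 (fun γ hγ t ht => (hX p hp).eq_Xsf hB hγ ht) _ _ hp'.2.1]
      using hs
  · rw [he, mul_div_cancel_left₀ _ (Xsf_ne_zero hσ _ _ _ _)]

/-- The integral formula in terms of the rational invariants. -/
theorem isLogTau_iff_of_solvesTBARational {B : Data m} (hB : B.Uncoupled)
    {σ : (Fin m → ℤ) → ℂ} (hσ : B.IsQuadraticRefinement σ) (θ : Fin m → ℂ)
    (L : SummationFilter (Fin m → ℤ)) [L.NeBot]
    {V : Set ((Fin m → ℂ) × ℂ)} (hV : IsOpen V) (hVD : V ⊆ B.domain)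
    {X : (Fin m → ℤ) → (Fin m → ℂ) → ℂ → ℂ} (hX : ∀ p ∈ V, SolvesTBARational B σ θ L X p.1)
    {T : (Fin m → ℂ) × ℂ → ℂ} (hT : SumsLocallyUniformly L (logTauTerm B σ θ) T V)
    {t : ℂ} {W : Set (Fin m → ℂ)} (hW : IsOpen W) (hWc : IsPreconnected W)
    (hWV : ∀ z ∈ W, (z, t) ∈ V) (logτ : (Fin m → ℂ) → ℂ) :
    IsLogTau B σ θ X t W logτ ↔ ∃ c : ℂ, ∀ z ∈ W, logτ z = T (z, t) + c := by
  have hslit : ∀ p ∈ V, ∀ γ, B.ratΩ γ ≠ 0 → slitVar (centralCharge p.1 γ) p.2 ∈ slitPlane :=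
    fun p hp γ h => slitVar_mem_of_ratΩ (fun γ h => slitVar_mem_of_mem_domain (hVD hp) h) h
  -- The phase goes into the coefficient, so one weight serves all charges; in the integer form it
  -- has to stay inside the logarithm.
  refine isLogTau_iff_of_transform B σ θ L hV (c := fun γ => (B.ratΩ γ : ℂ) * fugacity σ θ γ)
    (φ := fun _ => expW) (fun _ => integrableOn_expW)
    (fun _ => integrableOn_mul_expW) (fun p hp => (hVD hp).2.1)
    (fun p hp γ h => hslit p hp γ (by exact_mod_cast left_ne_zero_of_mul h)) (fun p hp a => ?_)
    (fun γ p hp => logTauTerm_eq B σ θ γ (hVD hp).2.1 (hslit p hp γ)) hT hW hWc hWV logτ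
  have hp' := hVD hp
  obtain ⟨s, hs, he⟩ := hX p hp (Pi.single a 1) p.2 hp'.2.1 fun γ' h _ =>
    notMem_ray_of_slitVar_mem (hslit p hp γ' h)
  refine ⟨s, ?_, ?_⟩
  · simpa only [tbaTermRational_eq hp'.1 (fun γ hγ t ht => (hX p hp).eq_Xsf hB hγ ht) _ _ hp'.2.1]
      using hs
  · rw [he, mul_div_cancel_left₀ _ (Xsf_ne_zero hσ _ _ _ _)]

/-! ### The finite uncoupled case -/

/-- For finitely many active charges any sufficiently small ε gives the support property, and the
exponential sum is finite. -/
lemma isBPSAt_of_isFinite {B : Data m} (hfin : B.IsFinite) {z : Fin m → ℂ}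
    (h : ∀ γ, B.Ω γ ≠ 0 → centralCharge z γ ≠ 0) : B.IsBPSAt z := by
  constructor
  · have h1 : ∀ᶠ ε : ℝ in 𝓝[>] 0, ∀ γ ∈ Function.support B.Ω, ε * ‖γ‖ < ‖centralCharge z γ‖ := by
      refine (eventually_all_finite hfin).2 fun γ hγ => nhdsWithin_le_nhds ?_
      have hc : Tendsto (fun ε : ℝ => ε * ‖γ‖) (𝓝 0) (𝓝 (0 * ‖γ‖)) := tendsto_id.mul_const _
      rw [zero_mul] at hc
      exact hc.eventually_lt_const (norm_pos_iff.2 (h γ hγ))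
    obtain ⟨ε, h2, h3⟩ := (h1.and self_mem_nhdsWithin).exists
    exact ⟨ε, h3, h2⟩
  · refine ⟨1, one_pos, summable_of_hasFiniteSupport (hfin.subset fun γ hγ h0 => hγ ?_)⟩
    simp [h0]

lemma mem_domain_iff {B : Data m} (hfin : B.IsFinite) {p : (Fin m → ℂ) × ℂ} :
    p ∈ B.domain ↔
      p.2 ≠ 0 ∧ ∀ γ, B.Ω γ ≠ 0 → slitVar (centralCharge p.1 γ) p.2 ∈ slitPlane := by
  constructor
  · exact fun hp => ⟨hp.2.1, fun γ hγ => slitVar_mem_of_mem_domain hp hγ⟩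
  · rintro ⟨ht, h⟩
    exact ⟨isBPSAt_of_isFinite hfin fun γ hγ => ne_zero_of_slitVar_mem (h γ hγ), ht,
      fun γ hγ => notMem_ray_of_slitVar_mem (h γ hγ)⟩

lemma continuousAt_slitVar (γ : Fin m → ℤ) {p : (Fin m → ℂ) × ℂ} (ht : p.2 ≠ 0) :
    ContinuousAt (fun p : (Fin m → ℂ) × ℂ => slitVar (centralCharge p.1 γ) p.2) p := by
  unfold slitVar
  exact continuousAt_const.mul
    ((((differentiable_centralCharge γ).continuous.comp continuous_fst).continuousAt).div
      continuousAt_snd ht)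

lemma isOpen_domain {B : Data m} (hfin : B.IsFinite) : IsOpen B.domain := by
  rw [isOpen_iff_mem_nhds]
  intro p hp
  have h := (mem_domain_iff hfin).1 hp
  have h1 : ∀ᶠ p' in 𝓝 p, ∀ γ ∈ Function.support B.Ω,
      slitVar (centralCharge p'.1 γ) p'.2 ∈ slitPlane :=
    (eventually_all_finite hfin).2 fun γ hγ =>
      (continuousAt_slitVar γ h.1).eventually (isOpen_slitPlane.mem_nhds (h.2 γ hγ))
  have h2 : ∀ᶠ p' in 𝓝 p, p'.2 ≠ 0 := continuousAt_snd.eventually_ne h.1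
  filter_upwards [h1, h2] with p' h1 h2 using (mem_domain_iff hfin).2 ⟨h2, h1⟩

/-- The explicit solution of the TBA equations in the finite uncoupled case. -/
lemma exists_solvesTBA {B : Data m} (hB : B.Uncoupled) (hfin : B.IsFinite)
    (σ : (Fin m → ℤ) → ℂ) (θ : Fin m → ℂ) :
    ∃ X : (Fin m → ℤ) → (Fin m → ℂ) → ℂ → ℂ,
      ∀ z, B.IsBPSAt z → SolvesTBA B σ θ (.unconditional _) X z := by
  set A : (Fin m → ℤ) → (Fin m → ℂ) → ℂ → (Fin m → ℤ) → ℂ := fun γ z t γ' =>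
    (B.Ω γ' : ℂ) * (B.pairing γ γ' : ℂ)
      * -stieltjes (logW (fugacity σ θ γ')) (slitVar (centralCharge z γ') t) with hA
  set X : (Fin m → ℤ) → (Fin m → ℂ) → ℂ → ℂ := fun γ z t =>
    Xsf σ θ γ z t * exp ((∑' γ', A γ z t γ') / (2 * Real.pi * I)) with hXdef
  refine ⟨X, fun z hz γ t ht _ => ⟨∑' γ', A γ z t γ', ?_, rfl⟩⟩
  -- The explicit formula is consistent: it leaves active modes semi-flat, and only active modes
  -- enter the right-hand side.
  have hX : ∀ γ, B.Ω γ ≠ 0 → ∀ t, t ≠ 0 → X γ z t = Xsf σ θ γ z t := fun γ hγ t _ => by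
    have h0 : ∀ γ', A γ z t γ' = 0 := fun γ' => by
      by_cases h1 : B.Ω γ' = 0
      · simp [hA, h1]
      · simp [hA, pairing_eq_zero_of_Ω hB hγ h1]
    simp [hXdef, h0]
  rw [funext fun γ' => tbaTerm_eq hz hX γ γ' ht]
  refine Summable.hasSum (summable_of_hasFiniteSupport (hfin.subset fun γ' hγ' h0 => hγ' ?_))
  simp [h0]

/-- The bracket has real part in [0,1) when Im x ≥ 0 and in (0,1] when Im x < 0. Thus Re = 1 occurs
for the reflected parameter only with nonpositive imaginary part, and Re = 0 only with positive
imaginary part. -/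
lemma admissible_one_sub_bracket (x : ℂ) : Admissible (1 - bracket x) := by
  rw [bracket]
  split_ifs with h
  · have h1 := Int.floor_le x.re
    have h2 := Int.lt_floor_add_one x.re
    rcases eq_or_lt_of_le h1 with h3 | h3
    · right; left
      simp only [sub_re, one_re, intCast_re, sub_im, one_im, intCast_im]
      constructor <;> linarith
    · left
      simp only [sub_re, one_re, intCast_re]
      constructor <;> linarith
  · have h1 := Int.floor_le (-x.re)
    have h2 := Int.lt_floor_add_one (-x.re)
    push Not at h
    rcases eq_or_lt_of_le h1 with h3 | h3
    · right; right
      simp only [sub_re, one_re, intCast_re, sub_im, one_im, intCast_im, add_re, add_im]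
      constructor <;> linarith
    · left
      simp only [sub_re, one_re, intCast_re, add_re]
      constructor <;> linarith

lemma exp_two_pi_bracket (x : ℂ) : exp (2 * Real.pi * I * bracket x) = exp (2 * Real.pi * I * x) := by
  rw [bracket]
  split_ifs
  · rw [exp_eq_exp_iff_exists_int]
    exact ⟨-⌊x.re⌋, by push_cast; ring⟩
  · rw [exp_eq_exp_iff_exists_int]
    exact ⟨⌊-x.re⌋ + 1, by push_cast; ring⟩

lemma exp_neg_one_sub_bracket (x : ℂ) :
    exp (2 * Real.pi * -I * (1 - bracket x)) = exp (2 * Real.pi * I * x) := by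
  rw [← exp_two_pi_bracket x, exp_eq_exp_iff_exists_int]
  exact ⟨-1, by push_cast; ring⟩

lemma exp_one_sub_bracket (x : ℂ) :
    exp (2 * Real.pi * I * (1 - bracket x)) = (exp (2 * Real.pi * I * x))⁻¹ := by
  rw [← exp_neg_one_sub_bracket x, ← exp_neg]
  congr 1; ring

/-- With k² = -1 one has (kw+v)² = -(w-kv)², which turns the rotated transform into an integral of
Binet type. -/
lemma hasDerivAt_tauFn_comp (y : ℂ) {k w : ℂ} (hk : k * k = -1) (hq : k * w ∈ slitPlane) :
    HasDerivAt (fun w => tauFn (logW y) (k * w))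
      (2 * Real.pi * (w * ∫ v in Ioi (0 : ℝ), -logW y v / (w - k * v) ^ 2)) w := by
  have h1 : HasDerivAt (fun w : ℂ => k * w) k w := by
    simpa using (hasDerivAt_id w).const_mul k
  have h2 := (hasDerivAt_tauFn (integrableOn_logW y) (integrableOn_mul_logW y) hq).comp w h1
  convert! h2 using 1
  have e : ∀ v : ℝ, logW y v / (k * w + v) ^ 2 = -logW y v / (w - k * v) ^ 2 := fun v => by
    have : (k * w + v) ^ 2 = -(w - k * v) ^ 2 := by linear_combination (w ^ 2 + v ^ 2) * hk
    rw [this, div_neg, neg_div]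
  simp only [e]
  linear_combination (2 * Real.pi * w * ∫ v in Ioi (0 : ℝ), -logW y v / (w - k * v) ^ 2) * hk

/-- The contributions of a charge and its opposite add up to the logarithm of a generalized Barnes
function. -/
lemma exists_tauFn_add_tauFn_eq {η : ℂ} (h : Admissible η) : ∃ k : ℂ, ∀ w : ℂ, 0 < w.re →
    1 / (4 * (Real.pi : ℂ) ^ 2) * (tauFn (logW (exp (2 * Real.pi * -I * η))) (-I * w)
      + tauFn (logW (exp (2 * Real.pi * I * η))) (I * w)) = logUpsilon η w + k := by
  have hU : IsOpen {w : ℂ | 0 < w.re} := isOpen_lt continuous_const continuous_re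
  have hc : IsPreconnected {w : ℂ | 0 < w.re} := (convex_halfSpace_re_gt 0).isPreconnected
  have hpi : (Real.pi : ℂ) ≠ 0 := by exact_mod_cast Real.pi_ne_zero
  have hder : ∀ w ∈ {w : ℂ | 0 < w.re}, HasDerivAt (fun w =>
      1 / (4 * (Real.pi : ℂ) ^ 2) * (tauFn (logW (exp (2 * Real.pi * -I * η))) (-I * w)
      + tauFn (logW (exp (2 * Real.pi * I * η))) (I * w)))
      (w * (psi (w + η) - log w) - (η - 1 / 2)) w := fun w (hw : 0 < w.re) => by
    have hw0 : w ≠ 0 := by rintro rfl; simp at hw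
    have hq1 : -I * w ∈ slitPlane := Or.inr (by simpa using hw.ne')
    have hq2 : I * w ∈ slitPlane := Or.inr (by simpa using hw.ne')
    have h1 := ((hasDerivAt_tauFn_comp (exp (2 * Real.pi * -I * η)) (by simp) hq1).add
      (hasDerivAt_tauFn_comp (exp (2 * Real.pi * I * η)) (by simp) hq2)).const_mul
      (1 / (4 * (Real.pi : ℂ) ^ 2))
    convert! h1 using 1
    -- The factors 2π from `tauFn` and from the Binet formula cancel against 1/(4π²).
    have h2 := integral_logW_add_integral_logW hw h
    simp only [neg_mul, sub_neg_eq_add] at h2 ⊢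
    rw [← mul_add, ← mul_add, h2]
    field_simp
    ring
  obtain ⟨k, hk⟩ := hU.exists_eq_add_of_fderiv_eq (𝕜 := ℂ) hc
    (fun w hw => (hder w hw).differentiableAt.differentiableWithinAt)
    (fun w hw => (hasDerivAt_logUpsilon h.re_nonneg hw).differentiableAt.differentiableWithinAt)
    (fun w hw => by
      rw [(hder w hw).hasFDerivAt.fderiv, (hasDerivAt_logUpsilon h.re_nonneg hw).hasFDerivAt.fderiv])
  exact ⟨k, fun w hw => hk hw⟩

lemma pairing_neg_right (B : Data m) (γ γ' : Fin m → ℤ) :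
    B.pairing γ (-γ') = -B.pairing γ γ' := by
  simp only [Data.pairing, Pi.neg_apply, mul_neg, Finset.sum_neg_distrib]

lemma pairing_self (B : Data m) (γ : Fin m → ℤ) : B.pairing γ γ = 0 := by
  have h : B.pairing γ γ = -B.pairing γ γ := by
    conv_lhs => rw [Data.pairing, Finset.sum_comm]
    rw [Data.pairing, ← Finset.sum_neg_distrib]
    refine Finset.sum_congr rfl fun a _ => ?_
    rw [← Finset.sum_neg_distrib]
    refine Finset.sum_congr rfl fun b _ => ?_
    have : B.ω b a = -B.ω a b := by
      have := congrFun (congrFun B.skew a) b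
      simpa using this
    rw [this]; ring
  omega

lemma centralCharge_neg (z : Fin m → ℂ) (γ : Fin m → ℤ) :
    centralCharge z (-γ) = -centralCharge z γ := by
  simp [centralCharge, Finset.sum_neg_distrib]

lemma Data.IsQuadraticRefinement.map_zero {B : Data m} {σ : (Fin m → ℤ) → ℂ}
    (hσ : B.IsQuadraticRefinement σ) : σ 0 = 1 := by
  have h := hσ.2 0 0
  rw [pairing_self, zpow_zero, one_mul, add_zero] at h
  exact mul_left_cancel₀ (hσ.1 0) (by rw [h, mul_one])

lemma fugacity_neg {B : Data m} {σ : (Fin m → ℤ) → ℂ} (hσ : B.IsQuadraticRefinement σ)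
    (θ : Fin m → ℂ) (γ : Fin m → ℤ) : fugacity σ θ (-γ) = (fugacity σ θ γ)⁻¹ := by
  have h := hσ.2 γ (-γ)
  rw [pairing_neg_right, pairing_self, neg_zero, zpow_zero, one_mul, add_neg_cancel,
    hσ.map_zero] at h
  have e : angle θ (-γ) = -angle θ γ := centralCharge_neg θ γ
  rw [fugacity, fugacity, e, mul_inv, ← exp_neg, mul_neg, eq_inv_of_mul_eq_one_right h]

lemma slitVar_neg (Z t : ℂ) : slitVar (-Z) t = I * (Z / t) := by
  rw [slitVar]; ring

/-- If Z_γ/t were imaginary, t would lie on the ray of γ or of -γ, and both charges are active. -/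
lemma re_div_ne_zero_of_mem_domain {B : Data m} {p : (Fin m → ℂ) × ℂ} (hp : p ∈ B.domain)
    {γ : Fin m → ℤ} (hγ : B.Ω γ ≠ 0) : (centralCharge p.1 γ / p.2).re ≠ 0 := by
  intro h0
  have h1 := slitVar_mem_of_mem_domain hp hγ
  have h2 := slitVar_mem_of_mem_domain hp (γ := -γ) (by rwa [B.Ω_neg])
  rw [centralCharge_neg, slitVar_neg] at h2
  rw [slitVar] at h1
  rw [mem_slitPlane_iff] at h1 h2
  simp [h0] at h1 h2
  linarith

lemma mem_rightCharges_neg {B : Data m} {p : (Fin m → ℂ) × ℂ} (hp : p ∈ B.domain)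
    {γ : Fin m → ℤ} (hγ : B.Ω γ ≠ 0) :
    γ ∉ B.rightCharges p.1 p.2 ↔ -γ ∈ B.rightCharges p.1 p.2 := by
  have h0 := re_div_ne_zero_of_mem_domain hp hγ
  simp only [Data.rightCharges, mem_ofPred_eq, B.Ω_neg, centralCharge_neg, neg_div, neg_re]
  constructor
  · intro h
    refine ⟨hγ, ?_⟩
    by_contra h1
    exact h ⟨hγ, lt_of_le_of_ne (by linarith) h0.symm⟩
  · rintro ⟨_, h1⟩ ⟨_, h2⟩
    linarith

/-- Evaluation of the resummed integral formula on a chamber. -/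
lemma exists_finsum_logTauTermResummed_eq {B : Data m} (hfin : B.IsFinite)
    {σ : (Fin m → ℤ) → ℂ} (hσ : B.IsQuadraticRefinement σ) {θ : Fin m → ℂ}
    {ϑ : (Fin m → ℤ) → ℂ} (hϑ : ∀ γ, exp (2 * Real.pi * I * ϑ γ) = fugacity σ θ γ)
    {ℓ : (Fin m → ℤ) → ℂ → ℂ} (hℓ : ∀ γ, B.Ω γ ≠ 0 → IsLogUpsilon (1 - bracket (ϑ γ)) (ℓ γ))
    (S : Set (Fin m → ℤ)) : ∃ c : ℂ, ∀ p ∈ B.domain, B.rightCharges p.1 p.2 = S →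
      ∑ᶠ γ, logTauTermResummed B σ θ γ p = barnesSum B ℓ p + c := by
  classical
  have hk : ∀ γ, ∃ k : ℂ, B.Ω γ ≠ 0 → ∀ w : ℂ, 0 < w.re →
      1 / (4 * (Real.pi : ℂ) ^ 2) * (tauFn (logW (fugacity σ θ γ)) (-I * w)
        + tauFn (logW (fugacity σ θ (-γ))) (I * w)) = ℓ γ w + k := fun γ => by
    by_cases hγ : B.Ω γ = 0
    · exact ⟨0, fun h => absurd hγ h⟩
    · have hadm := admissible_one_sub_bracket (ϑ γ)
      obtain ⟨k₁, h1⟩ := exists_tauFn_add_tauFn_eq hadm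
      obtain ⟨k₂, h2⟩ := (isLogUpsilon_logUpsilon hadm.re_nonneg).exists_const (hℓ γ hγ)
      refine ⟨k₂ + k₁, fun _ w hw => ?_⟩
      have h3 := h1 w hw
      -- For η = 1 - [ϑ_γ] the two exponentials of the Binet formula are the fugacities of γ and of
      -- -γ.
      rw [exp_neg_one_sub_bracket, exp_one_sub_bracket, hϑ, ← fugacity_neg hσ, h2 w hw] at h3
      rw [h3]; ring
  choose k hk using hk
  set S₀ := hfin.toFinset with hS₀
  refine ⟨∑ γ ∈ S₀ with γ ∈ S, (B.Ω γ : ℂ) * k γ, fun p hp hS => ?_⟩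
  have hmem : ∀ γ, γ ∈ S₀ ↔ B.Ω γ ≠ 0 := fun γ => hfin.mem_toFinset
  have hSset : S = ↑(S₀.filter (· ∈ S)) := by
    ext γ
    simp only [Finset.coe_filter, mem_ofPred_eq, hmem]
    refine ⟨fun h => ⟨?_, h⟩, fun h => h.2⟩
    rw [← hS] at h
    exact h.1
  have hterm : ∀ γ, logTauTermResummed B σ θ γ p = 1 / (4 * (Real.pi : ℂ) ^ 2) * (B.Ω γ : ℂ)
      * tauFn (logW (fugacity σ θ γ)) (slitVar (centralCharge p.1 γ) p.2) := fun γ =>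
    logTauTermResummed_eq B σ θ γ hp.2.1 fun h => slitVar_mem_of_mem_domain hp h
  rw [finsum_eq_sum_of_support_subset (s := S₀), barnesSum, hS]
  -- Active charges outside the chosen half-plane are the negatives of those inside, so the sum runs
  -- over pairs ±γ.
  · have hneg : ∑ γ ∈ S₀ with ¬ γ ∈ S, logTauTermResummed B σ θ γ p
        = ∑ γ ∈ S₀ with γ ∈ S, logTauTermResummed B σ θ (-γ) p := by
      refine Finset.sum_nbij' (fun γ => -γ) (fun γ => -γ) ?_ ?_ (by simp) (by simp) (by simp)
      · intro γ hγ
        rw [Finset.mem_filter, hmem] at hγ ⊢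
        rw [B.Ω_neg, ← hS]
        rw [← hS] at hγ
        exact ⟨hγ.1, (mem_rightCharges_neg hp hγ.1).1 hγ.2⟩
      · intro γ hγ
        rw [Finset.mem_filter, hmem] at hγ ⊢
        rw [← hS] at hγ ⊢
        have h1 : B.Ω (-γ) ≠ 0 := by rw [B.Ω_neg]; exact hγ.1
        refine ⟨h1, (mem_rightCharges_neg hp h1).2 ?_⟩
        rw [neg_neg]; exact hγ.2
    have hfs : ∑ᶠ γ ∈ S, (B.Ω γ : ℂ) * ℓ γ (centralCharge p.1 γ / p.2)
        = ∑ γ ∈ S₀ with γ ∈ S, (B.Ω γ : ℂ) * ℓ γ (centralCharge p.1 γ / p.2) := by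
      conv_lhs => rw [hSset]
      exact finsum_mem_coe_finset _ _
    rw [hfs, ← Finset.sum_filter_add_sum_filter_not S₀ (· ∈ S), hneg, ← Finset.sum_add_distrib,
      ← Finset.sum_add_distrib]
    refine Finset.sum_congr rfl fun γ hγ => ?_
    rw [Finset.mem_filter, hmem, ← hS] at hγ
    have h1 := hk γ hγ.1 (centralCharge p.1 γ / p.2) hγ.2.2
    rw [hterm, hterm, B.Ω_neg, centralCharge_neg, slitVar_neg, slitVar]
    linear_combination (B.Ω γ : ℂ) * h1
  · intro γ hγ
    rw [Finset.mem_coe, hmem]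
    intro h0
    exact hγ (by simp [logTauTermResummed, h0])

/-- Re(Z_γ/t) is continuous and never zero on W for active γ, so its sign cannot change. -/
lemma rightCharges_eq_of_isPreconnected {B : Data m} {t : ℂ} {W : Set (Fin m → ℂ)}
    (hWc : IsPreconnected W) (hW : ∀ z ∈ W, (z, t) ∈ B.domain) {z z' : Fin m → ℂ}
    (hz : z ∈ W) (hz' : z' ∈ W) : B.rightCharges z t = B.rightCharges z' t := by
  have key : ∀ z ∈ W, ∀ z' ∈ W, B.rightCharges z t ⊆ B.rightCharges z' t := by
    intro z hz z' hz' γ hγ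
    refine ⟨hγ.1, ?_⟩
    by_contra h
    have hcont : ContinuousOn (fun z => (centralCharge z γ / t).re) W :=
      (continuous_re.comp ((differentiable_centralCharge γ).continuous.div_const t)).continuousOn
    obtain ⟨x, hx, hx0⟩ := hWc.intermediate_value hz' hz hcont ⟨not_lt.1 h, hγ.2.le⟩
    exact re_div_ne_zero_of_mem_domain (hW x hx) hγ.1 hx0
  exact (key z hz z' hz').antisymm (key z' hz' z hz)

/-- The `τ`-function in the finite uncoupled case. -/
theorem isLogTau_iff_barnesSum {B : Data m} (hB : B.Uncoupled) (hfin : B.IsFinite)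
    {σ : (Fin m → ℤ) → ℂ} (hσ : B.IsQuadraticRefinement σ) {θ : Fin m → ℂ}
    {ϑ : (Fin m → ℤ) → ℂ} (hϑ : ∀ γ, exp (2 * Real.pi * I * ϑ γ) = fugacity σ θ γ)
    {ℓ : (Fin m → ℤ) → ℂ → ℂ} (hℓ : ∀ γ, B.Ω γ ≠ 0 → IsLogUpsilon (1 - bracket (ϑ γ)) (ℓ γ))
    {t : ℂ} {W : Set (Fin m → ℂ)} (hW : IsOpen W) (hWc : IsPreconnected W)
    (hWD : ∀ z ∈ W, (z, t) ∈ B.domain) {X : (Fin m → ℤ) → (Fin m → ℂ) → ℂ → ℂ}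
    (hX : ∀ z ∈ W, SolvesTBA B σ θ (.unconditional _) X z) (logτ : (Fin m → ℂ) → ℂ) :
    IsLogTau B σ θ X t W logτ ↔ ∃ c : ℂ, ∀ z ∈ W, logτ z = barnesSum B ℓ (z, t) + c := by
  have hconst : ∃ k : ℂ, ∀ z ∈ W,
      ∑ᶠ γ, logTauTermResummed B σ θ γ (z, t) = barnesSum B ℓ (z, t) + k := by
    rcases W.eq_empty_or_nonempty with rfl | ⟨z₀, hz₀⟩
    · exact ⟨0, fun z hz => absurd hz (notMem_empty z)⟩
    · obtain ⟨k, hk⟩ := exists_finsum_logTauTermResummed_eq hfin hσ hϑ hℓ (B.rightCharges z₀ t)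
      exact ⟨k, fun z hz => hk (z, t) (hWD z hz)
        (rightCharges_eq_of_isPreconnected hWc hWD hz hz₀)⟩
  obtain ⟨k, hk⟩ := hconst
  -- The partial sums are eventually equal to the full sum. The open set is cut down to W because
  -- the modes solve the equations only there.
  have hT : SumsLocallyUniformly (.unconditional _) (logTauTermResummed B σ θ)
      (fun p => ∑ᶠ γ, logTauTermResummed B σ θ γ p) (B.domain ∩ W ×ˢ univ) := by
    intro u hu p _
    refine ⟨univ, univ_mem, ?_⟩
    have : ∀ᶠ S : Finset (Fin m → ℤ) in atTop, hfin.toFinset ⊆ S := eventually_ge_atTop _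
    refine this.mono fun S hS p _ => ?_
    beta_reduce
    rw [finsum_eq_sum_of_support_subset (s := S)]
    · exact refl_mem_uniformity hu
    · intro γ hγ
      refine hS (hfin.mem_toFinset.2 fun h0 => hγ ?_)
      simp [logTauTermResummed, h0]
  rw [isLogTau_iff_of_solvesTBA hB hσ θ (.unconditional _)
    ((isOpen_domain hfin).inter (hW.prod isOpen_univ)) inter_subset_left
    (fun p hp => hX p.1 hp.2.1) hT hW hWc (fun z hz => ⟨hWD z hz, hz, mem_univ _⟩) logτ]
  constructor
  · rintro ⟨c, hc⟩
    exact ⟨k + c, fun z hz => by rw [hc z hz, hk z hz]; ring⟩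
  · rintro ⟨c, hc⟩
    exact ⟨c - k, fun z hz => by rw [hc z hz, hk z hz]; ring⟩

/-! ### Multiples of a charge -/

lemma Data.IsQuadraticRefinement.map_nsmul {B : Data m} {σ : (Fin m → ℤ) → ℂ}
    (hσ : B.IsQuadraticRefinement σ) (γ : Fin m → ℤ) (n : ℕ) : σ (n • γ) = σ γ ^ n := by
  induction n with
  | zero => simp [hσ.map_zero]
  | succ n ih =>
    have h := hσ.2 (n • γ) γ
    rw [pairing_nsmul_left, pairing_self, mul_zero, zpow_zero, one_mul] at h
    rw [succ_nsmul, ← h, ih, pow_succ]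

lemma fugacity_nsmul {B : Data m} {σ : (Fin m → ℤ) → ℂ} (hσ : B.IsQuadraticRefinement σ)
    (θ : Fin m → ℂ) (γ : Fin m → ℤ) (n : ℕ) :
    fugacity σ θ (n • γ) = fugacity σ θ γ ^ n := by
  rw [fugacity, fugacity, hσ.map_nsmul, angle_nsmul, mul_pow, ← exp_nat_mul]
  congr 2
  ring

lemma norm_exp_two_pi_of_im_eq_zero {x : ℂ} (hx : x.im = 0) : ‖exp (2 * Real.pi * I * x)‖ = 1 := by
  rw [norm_exp]
  simp [hx]

lemma succ_nsmul_injective {γ : Fin m → ℤ} (hγ : γ ≠ 0) :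
    Function.Injective fun n : ℕ => (n + 1) • γ := by
  intro a b h
  obtain ⟨i, hi⟩ := Function.ne_iff.1 hγ
  have h1 := congrFun h i
  simp only [Pi.smul_apply, nsmul_eq_mul] at h1
  have h2 := mul_right_cancel₀ hi h1
  have h3 : a + 1 = b + 1 := by exact_mod_cast h2
  omega

lemma Data.ne_zero_of_Ω_ne_zero {B : Data m} {γ : Fin m → ℤ} (h : B.Ω γ ≠ 0) : γ ≠ 0 := by
  rintro rfl
  exact h B.Ω_zero

lemma mem_divisors_gcd {γ₀ : Fin m → ℤ} (hγ₀ : γ₀ ≠ 0) {n : ℕ} (hn : 0 < n) :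
    n ∈ (Finset.univ.gcd (n • γ₀)).natAbs.divisors := by
  rw [Nat.mem_divisors]
  constructor
  · rw [← Int.natCast_dvd]
    refine Finset.dvd_gcd fun a _ => ?_
    simp
  · rw [Int.natAbs_ne_zero]
    intro h0
    rw [Finset.gcd_eq_zero_iff] at h0
    refine hγ₀ (funext fun a => ?_)
    have := h0 a (Finset.mem_univ a)
    simp only [Pi.smul_apply, nsmul_eq_mul, mul_eq_zero] at this
    exact this.resolve_left (by exact_mod_cast hn.ne')

/-- The rational invariants as a sum over the multiples of the active charges. -/
lemma ratΩ_mul_eq {B : Data m} (hfin : B.IsFinite) (a : (Fin m → ℤ) → ℂ) (γ : Fin m → ℤ) :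
    (B.ratΩ γ : ℂ) * a γ = ∑ γ₀ ∈ hfin.toFinset, (B.Ω γ₀ : ℂ)
      * Function.extend (fun n : ℕ => (n + 1) • γ₀)
        (fun n => 1 / ((n : ℂ) + 1) ^ 2 * a ((n + 1) • γ₀)) 0 γ := by
  classical
  set D := (Finset.univ.gcd γ).natAbs.divisors with hD
  have h1 : (B.ratΩ γ : ℂ) = ∑ d ∈ D, ∑ γ₀ ∈ hfin.toFinset,
      (B.Ω γ₀ : ℂ) * if γ = d • γ₀ then 1 / (d : ℂ) ^ 2 else 0 := by
    rw [Data.ratΩ]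
    push_cast
    refine Finset.sum_congr rfl fun d hd => ?_
    obtain ⟨hd0, hγ⟩ := natCast_dvd_of_mem_divisors hd
    have huniq : ∀ γ₀ : Fin m → ℤ, γ = d • γ₀ → γ₀ = fun a => γ a / (d : ℤ) := by
      rintro γ₀ h
      funext a
      rw [h]
      have : (d : ℤ) ≠ 0 := by exact_mod_cast hd0.ne'
      rw [Pi.smul_apply, nsmul_eq_mul, Int.mul_ediv_cancel_left _ this]
    rw [Finset.sum_eq_single (fun a => γ a / (d : ℤ))]
    · rw [if_pos hγ]; ring
    · intro γ₀ _ hne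
      rw [if_neg fun h => hne (huniq γ₀ h), mul_zero]
    · intro h
      rw [not_not.1 fun h1 => h (hfin.mem_toFinset.2 h1)]; simp
  rw [h1, Finset.sum_comm, Finset.sum_mul]
  refine Finset.sum_congr rfl fun γ₀ hγ₀ => ?_
  have h0 : γ₀ ≠ 0 := Data.ne_zero_of_Ω_ne_zero (B := B) (hfin.mem_toFinset.1 hγ₀)
  rw [← Finset.mul_sum, mul_assoc]
  congr 1
  by_cases hex : ∃ n : ℕ, (n + 1) • γ₀ = γ
  · obtain ⟨n, rfl⟩ := hex
    rw [(succ_nsmul_injective h0).extend_apply, Finset.sum_eq_single (n + 1)]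
    · simp
    · intro d hd hne
      rw [if_neg]
      intro h
      obtain ⟨e, rfl⟩ := Nat.exists_eq_succ_of_ne_zero (Nat.pos_of_mem_divisors hd).ne'
      exact hne (congrArg (· + 1) (succ_nsmul_injective h0 h)).symm
    · intro h
      exact absurd (mem_divisors_gcd h0 n.succ_pos) h
  · rw [Function.extend_apply' _ _ _ hex, Finset.sum_eq_zero]
    · simp
    · intro d hd
      rw [if_neg]
      intro h
      obtain ⟨e, rfl⟩ := Nat.exists_eq_succ_of_ne_zero (Nat.pos_of_mem_divisors hd).ne'
      exact hex ⟨e, h.symm⟩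

/-- A sum against the rational invariants is a finite sum, over the active charges, of series over
their multiples; nonzero charges have distinct multiples. -/
lemma hasSum_ratΩ_mul {B : Data m} (hfin : B.IsFinite) {a A : (Fin m → ℤ) → ℂ}
    (h : ∀ γ₀, B.Ω γ₀ ≠ 0 →
      HasSum (fun n : ℕ => 1 / ((n : ℂ) + 1) ^ 2 * a ((n + 1) • γ₀)) (A γ₀)) :
    HasSum (fun γ => (B.ratΩ γ : ℂ) * a γ) (∑ γ₀ ∈ hfin.toFinset, (B.Ω γ₀ : ℂ) * A γ₀) := by
  rw [funext (ratΩ_mul_eq hfin a)]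
  refine hasSum_sum fun γ₀ hγ₀ => HasSum.mul_left _ ?_
  have h1 : B.Ω γ₀ ≠ 0 := hfin.mem_toFinset.1 hγ₀
  exact (hasSum_extend_zero (succ_nsmul_injective (Data.ne_zero_of_Ω_ne_zero h1))).2 (h γ₀ h1)

/-- The majorant is fixed before the summand, so it may be used uniformly in (z, t). -/
lemma exists_summable_norm_ratΩ_mul_le {B : Data m} (hfin : B.IsFinite)
    {b : (Fin m → ℤ) → ℕ → ℝ} (hb : ∀ γ₀, B.Ω γ₀ ≠ 0 → Summable (b γ₀)) :
    ∃ M : (Fin m → ℤ) → ℝ, Summable M ∧ ∀ a : (Fin m → ℤ) → ℂ,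
      (∀ γ₀, B.Ω γ₀ ≠ 0 → ∀ n : ℕ, ‖1 / ((n : ℂ) + 1) ^ 2 * a ((n + 1) • γ₀)‖ ≤ b γ₀ n) →
      ∀ γ, ‖(B.ratΩ γ : ℂ) * a γ‖ ≤ M γ := by
  refine ⟨fun γ => ∑ γ₀ ∈ hfin.toFinset, ‖(B.Ω γ₀ : ℂ)‖
      * Function.extend (fun n : ℕ => (n + 1) • γ₀) (b γ₀) 0 γ, ?_, fun a ha γ => ?_⟩
  · refine summable_sum fun γ₀ hγ₀ => Summable.mul_left _ ?_
    have h1 : B.Ω γ₀ ≠ 0 := hfin.mem_toFinset.1 hγ₀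
    exact ((hasSum_extend_zero
      (succ_nsmul_injective (Data.ne_zero_of_Ω_ne_zero h1))).2 (hb γ₀ h1).hasSum).summable
  · rw [ratΩ_mul_eq hfin]
    refine (norm_sum_le _ _).trans (Finset.sum_le_sum fun γ₀ hγ₀ => ?_)
    have h1 : B.Ω γ₀ ≠ 0 := hfin.mem_toFinset.1 hγ₀
    rw [norm_mul]
    refine mul_le_mul_of_nonneg_left ?_ (norm_nonneg _)
    by_cases hex : ∃ n : ℕ, (n + 1) • γ₀ = γ
    · obtain ⟨n, rfl⟩ := hex
      have hinj := succ_nsmul_injective (Data.ne_zero_of_Ω_ne_zero h1)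
      rw [hinj.extend_apply, hinj.extend_apply]
      exact ha γ₀ h1 n
    · rw [Function.extend_apply' _ _ _ hex, Function.extend_apply' _ _ _ hex]
      simp

/-- Every active charge is a multiple of a charge with nonzero rational invariant. -/
lemma exists_ratΩ_ne_zero {B : Data m} {γ : Fin m → ℤ} (hγ : B.Ω γ ≠ 0) :
    ∃ d : ℕ, 0 < d ∧ ∃ γ', B.ratΩ γ' ≠ 0 ∧ γ = d • γ' := by
  -- The rational invariant of an active charge may vanish, but only by cancellation with some
  -- active γ/d, d ≥ 2, whose ℓ¹-norm is smaller.
  induction h : ∑ a, (γ a).natAbs using Nat.strong_induction_on generalizing γ with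
  | _ N ih =>
    by_cases h0 : B.ratΩ γ ≠ 0
    · exact ⟨1, one_pos, γ, h0, (one_nsmul γ).symm⟩
    push Not at h0
    have hne : γ ≠ 0 := Data.ne_zero_of_Ω_ne_zero hγ
    set D := (Finset.univ.gcd γ).natAbs.divisors with hD
    have h1D : 1 ∈ D := by
      have := mem_divisors_gcd hne one_pos
      rwa [one_nsmul] at this
    rw [Data.ratΩ, ← Finset.add_sum_erase _ _ h1D] at h0
    have hrest : ∑ d ∈ D.erase 1, (B.Ω (fun a => γ a / (d : ℤ)) : ℚ) / (d : ℚ) ^ 2 ≠ 0 := by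
      intro h2
      rw [h2] at h0
      simp at h0
      exact hγ h0
    obtain ⟨d, hd, hd'⟩ := Finset.exists_ne_zero_of_sum_ne_zero hrest
    rw [Finset.mem_erase] at hd
    obtain ⟨hd0, hγd⟩ := natCast_dvd_of_mem_divisors hd.2
    set γ₁ : Fin m → ℤ := fun a => γ a / (d : ℤ) with hγ₁
    have hΩ₁ : B.Ω γ₁ ≠ 0 := by
      intro h2
      rw [h2] at hd'
      simp at hd'
    have hsum : ∑ a, (γ a).natAbs = d * ∑ a, (γ₁ a).natAbs := by
      rw [Finset.mul_sum]
      refine Finset.sum_congr rfl fun a _ => ?_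
      conv_lhs => rw [hγd]
      simp [Int.natAbs_mul]
    have hpos : 0 < ∑ a, (γ₁ a).natAbs := by
      obtain ⟨i, hi⟩ := Function.ne_iff.1 (Data.ne_zero_of_Ω_ne_zero hΩ₁)
      exact (Int.natAbs_pos.2 hi).trans_le
        (Finset.single_le_sum (f := fun a => (γ₁ a).natAbs) (by simp) (Finset.mem_univ i))
    have hd2 : 2 ≤ d := by have := hd.1; omega
    obtain ⟨e, he, γ', h2, h3⟩ := ih (∑ a, (γ₁ a).natAbs) (by nlinarith) hΩ₁ rfl
    refine ⟨d * e, Nat.mul_pos hd0 he, γ', h2, ?_⟩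
    rw [mul_nsmul', ← h3]
    exact hγd

/-! ### Sums over the multiples of a charge -/

lemma le_norm_natCast_mul_add {q : ℂ} {δ : ℝ} (h : ∀ v : ℝ, 0 ≤ v → δ ≤ ‖q + v‖) (n : ℕ) {v : ℝ}
    (hv : 0 ≤ v) : ((n : ℝ) + 1) * δ ≤ ‖((n + 1 : ℕ) : ℂ) * q + v‖ := by
  have hn : (0 : ℝ) < n + 1 := by positivity
  have hn' : ((n : ℂ) + 1) ≠ 0 := by exact_mod_cast hn.ne'
  have e : ((n + 1 : ℕ) : ℂ) * q + v = ((n + 1 : ℝ) : ℂ) * (q + (v / (n + 1) : ℝ)) := by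
    push_cast
    field_simp
  rw [e, norm_mul, norm_real, Real.norm_of_nonneg hn.le]
  exact mul_le_mul_of_nonneg_left (h _ (by positivity)) hn.le

/-- The quotient is homogeneous of degree 0, and scaling shifts the logarithm by a real constant. -/
lemma kernelLog_natCast_mul {q : ℂ} (hq : q ∈ slitPlane) (n : ℕ) {v : ℝ} (hv : 0 ≤ v) :
    kernelLog ((n + 1 : ℕ) * q) ((n + 1) * v) = kernelLog q v + Real.log (n + 1) := by
  have hn : (0 : ℝ) < n + 1 := by positivity
  have hn' : ((n : ℂ) + 1) ≠ 0 := by exact_mod_cast hn.ne'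
  have hqv : q + v ≠ 0 := slitPlane_ne_zero (add_ofReal_mem_slitPlane hq hv)
  have e : ((n + 1 : ℕ) : ℂ) * q + (((n + 1) * v : ℝ) : ℂ) = ((n + 1 : ℝ) : ℂ) * (q + v) := by
    push_cast; ring
  rw [kernelLog, kernelLog, e, log_ofReal_mul hn hqv]
  push_cast
  field_simp
  ring

/-- The decay 1/(n+1) offsets the growth of the pairing with the (n+1)-st multiple of a charge. -/
lemma norm_stieltjes_expW_natCast_mul_le {q : ℂ} {δ : ℝ} (hδ : 0 < δ)
    (h : ∀ v : ℝ, 0 ≤ v → δ ≤ ‖q + v‖) (n : ℕ) :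
    ((n : ℝ) + 1) * ‖stieltjes expW ((n + 1 : ℕ) * q)‖ ≤ (∫ v in Ioi (0 : ℝ), ‖expW v‖) / δ := by
  have hn : (0 : ℝ) < n + 1 := by positivity
  have h1 : ‖stieltjes expW ((n + 1 : ℕ) * q)‖
      ≤ ∫ v in Ioi (0 : ℝ), ‖expW v‖ * (1 / (((n : ℝ) + 1) * δ)) := by
    refine norm_integral_le_of_norm_le (integrableOn_expW.norm.mul_const _) ?_
    refine (ae_restrict_iff' measurableSet_Ioi).2 (.of_forall fun v (hv : 0 < v) => ?_)
    rw [norm_div, div_eq_mul_one_div]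
    exact mul_le_mul_of_nonneg_left (one_div_le_one_div_of_le (by positivity)
      (le_norm_natCast_mul_add h n hv.le)) (norm_nonneg _)
  rw [integral_mul_const] at h1
  calc _ ≤ ((n : ℝ) + 1) * ((∫ v in Ioi (0 : ℝ), ‖expW v‖) * (1 / (((n : ℝ) + 1) * δ))) := by gcongr
    _ = _ := by field_simp

lemma log_le_two_mul_sqrt {x : ℝ} (hx : 0 < x) : Real.log x ≤ 2 * √x := by
  have h := Real.log_le_sub_one_of_pos (Real.sqrt_pos.2 hx)
  rw [Real.log_sqrt hx.le] at h
  linarith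

/-- The true growth is logarithmic, through the scaling of the kernel. A square root is enough, as
it stays summable against 1/(n+1)². -/
lemma norm_tauFn_expW_natCast_mul_le {q : ℂ} (hq : q ∈ slitPlane) {δ : ℝ} (hδ : 0 < δ)
    (h : ∀ v : ℝ, 0 ≤ v → δ ≤ ‖q + v‖) (n : ℕ) :
    ‖tauFn expW ((n + 1 : ℕ) * q)‖ ≤ (2 * Real.pi * ((1 / δ + ‖q‖ + 3 + Real.pi)
      * ∫ v in Ioi (0 : ℝ), (‖expW v‖ + ‖(v : ℂ) * expW v‖)) + Real.pi ^ 2 * ‖tail expW 0‖)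
      * √(n + 1) := by
  have hn : (0 : ℝ) < n + 1 := by positivity
  set C := 1 / δ + ‖q‖ + 1 + Real.pi with hC
  have hC0 : 0 ≤ C := by have := Real.pi_pos; positivity
  have hs : 1 ≤ √((n : ℝ) + 1) := Real.one_le_sqrt.2 (by linarith [(Nat.cast_nonneg n : (0 : ℝ) ≤ n)])
  have hint := integrableOn_expW.norm.add integrableOn_mul_expW.norm
  have h1 : ‖logStieltjes expW ((n + 1 : ℕ) * q)‖ ≤ ∫ v in Ioi (0 : ℝ),
      ((C + 2) * √(n + 1)) * (‖expW v‖ + ‖(v : ℂ) * expW v‖) := by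
    refine norm_integral_le_of_norm_le (hint.const_mul _) ?_
    refine (ae_restrict_iff' measurableSet_Ioi).2 (.of_forall fun v (hv : 0 < v) => ?_)
    have hv' : (0 : ℝ) ≤ v / (n + 1) := by positivity
    have e := kernelLog_natCast_mul hq n hv'
    rw [mul_div_cancel₀ v hn.ne'] at e
    have hk : ‖kernelLog ((n + 1 : ℕ) * q) v‖ ≤ ((C + 2) * √(n + 1)) * (1 + v) := by
      rw [e]
      have h2 := norm_kernelLog_le hδ hv' (h _ hv')
      have h3 := log_le_two_mul_sqrt hn
      have h4 : v / (n + 1) ≤ v := div_le_self hv.le (by linarith [(Nat.cast_nonneg n : (0 : ℝ) ≤ n)])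
      have h5 : 0 ≤ Real.log ((n : ℝ) + 1) :=
        Real.log_nonneg (by linarith [(Nat.cast_nonneg n : (0 : ℝ) ≤ n)])
      refine (norm_add_le _ _).trans ?_
      rw [norm_real, Real.norm_of_nonneg h5]
      calc _ ≤ C * (1 + v) + 2 * √(n + 1) * 1 := by
            rw [mul_one]
            refine add_le_add (h2.trans ?_) h3
            exact mul_le_mul_of_nonneg_left (by linarith) hC0
        _ ≤ C * √(n + 1) * (1 + v) + 2 * √(n + 1) * (1 + v) := by
            gcongr
            · exact le_mul_of_one_le_right hC0 hs
            · linarith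
        _ = _ := by ring
    rw [norm_mul, norm_mul, norm_real, Real.norm_of_nonneg hv.le]
    calc _ ≤ ‖expW v‖ * (((C + 2) * √(n + 1)) * (1 + v)) := by gcongr
      _ = _ := by ring
  rw [integral_const_mul] at h1
  rw [tauFn]
  refine (norm_sub_le _ _).trans ?_
  have e2 : ‖-(2 * Real.pi * logStieltjes expW ((n + 1 : ℕ) * q))‖
      = 2 * Real.pi * ‖logStieltjes expW ((n + 1 : ℕ) * q)‖ := by
    rw [norm_neg, norm_mul, norm_mul, norm_real, Real.norm_of_nonneg Real.pi_pos.le]; simp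
  have e3 : ‖(Real.pi : ℂ) ^ 2 * I * tail expW 0‖ = Real.pi ^ 2 * ‖tail expW 0‖ := by
    rw [norm_mul, norm_mul, norm_pow, norm_real, Real.norm_of_nonneg Real.pi_pos.le]; simp
  rw [e2, e3, add_mul]
  refine add_le_add ?_ (le_mul_of_one_le_right (by positivity) hs)
  calc _ ≤ 2 * Real.pi * ((C + 2) * √(n + 1)
        * ∫ v in Ioi (0 : ℝ), (‖expW v‖ + ‖(v : ℂ) * expW v‖)) := by
        have := Real.pi_pos
        gcongr
    _ = _ := by rw [hC]; ring

lemma expW_pow (v : ℝ) (n : ℕ) : expW v ^ n = expW (n * v) := by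
  rw [expW, expW, ← ofReal_pow, ← Real.exp_nat_mul]
  congr 2; ring

lemma integrableOn_pow_mul_kernelLog {q : ℂ} (hq : q ∈ slitPlane) (n : ℕ) :
    IntegrableOn (fun v => expW v ^ (n + 1) * kernelLog q v) (Ioi 0) := by
  refine Integrable.mono (integrableOn_mul_kernelLog integrableOn_expW integrableOn_mul_expW hq)
    ((continuous_expW.measurable.pow_const _).mul (measurable_kernelLog q)).aestronglyMeasurable ?_
  refine (ae_restrict_iff' measurableSet_Ioi).2 (.of_forall fun v (hv : 0 < v) => ?_)
  rw [norm_mul, norm_mul, norm_pow]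
  refine mul_le_mul_of_nonneg_right (pow_le_of_le_one (norm_nonneg _) ?_ n.succ_ne_zero)
    (norm_nonneg _)
  rw [norm_expW, Real.exp_le_one_iff]
  nlinarith [Real.pi_pos]

lemma tail_expW_zero : tail expW 0 = 1 / (2 * Real.pi) := by
  have h := tail_expW 0
  have hpi : (2 * Real.pi : ℂ) ≠ 0 := by exact_mod_cast Real.two_pi_pos.ne'
  rw [eq_div_iff hpi, mul_comm, h]
  simp [expW]

lemma logStieltjes_expW_natCast_mul {q : ℂ} (hq : q ∈ slitPlane) (n : ℕ) :
    logStieltjes expW ((n + 1 : ℕ) * q)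
      = ((n : ℂ) + 1) * (∫ v in Ioi (0 : ℝ), expW v ^ (n + 1) * kernelLog q v)
        + Real.log (n + 1) / (2 * Real.pi) := by
  have hn : (0 : ℝ) < n + 1 := by positivity
  have hn' : ((n : ℂ) + 1) ≠ 0 := by exact_mod_cast hn.ne'
  have h1 := integral_comp_mul_left_Ioi (fun v => expW v * kernelLog ((n + 1 : ℕ) * q) v) 0 hn
  have h2 := integral_comp_mul_left_Ioi expW 0 hn
  rw [mul_zero] at h1 h2
  have h3 : ∫ v in Ioi (0 : ℝ), expW ((n + 1) * v) * kernelLog ((n + 1 : ℕ) * q) ((n + 1) * v)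
      = (∫ v in Ioi (0 : ℝ), expW v ^ (n + 1) * kernelLog q v)
        + (∫ v in Ioi (0 : ℝ), expW ((n + 1) * v)) * Real.log (n + 1) := by
    rw [← integral_mul_const, ← integral_add (integrableOn_pow_mul_kernelLog hq n)
      (((integrableOn_Ioi_comp_mul_left_iff expW 0 hn).2
        (by simpa using integrableOn_expW)).mul_const _)]
    refine setIntegral_congr_fun measurableSet_Ioi fun v (hv : 0 < v) => ?_
    rw [kernelLog_natCast_mul hq n hv.le, expW_pow]
    push_cast
    ring
  rw [h3, h2] at h1
  have h4 : ∫ v in Ioi (0 : ℝ), expW v = 1 / (2 * Real.pi) := tail_expW_zero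
  rw [h4] at h1
  have h5 : logStieltjes expW ((n + 1 : ℕ) * q) = ((n : ℂ) + 1) * (((n : ℝ) + 1)⁻¹
      • ∫ v in Ioi (0 : ℝ), expW v * kernelLog ((n + 1 : ℕ) * q) v) := by
    rw [real_smul, logStieltjes]
    push_cast
    field_simp
  rw [h5, ← h1, real_smul]
  push_cast
  field_simp

lemma hasSum_pow_succ_div_neg_log {x : ℂ} (hx : ‖x‖ < 1) :
    HasSum (fun n : ℕ => x ^ (n + 1) / ((n : ℂ) + 1)) (-log (1 - x)) := by
  have h := (hasSum_nat_add_iff' 1).2 (hasSum_taylorSeries_neg_log hx)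
  simpa using h

lemma norm_mul_expW_lt_one {y : ℂ} (hy : ‖y‖ = 1) {v : ℝ} (hv : 0 < v) : ‖y * expW v‖ < 1 := by
  rw [norm_mul, hy, one_mul, norm_expW, Real.exp_lt_one_iff]
  nlinarith [Real.pi_pos]

/-- The logarithmic series is integrated termwise. For |y| = 1 the moduli of its terms sum to the
same series at y = 1, whose weight is integrable against the kernel. -/
lemma hasSum_integral_pow_mul_kernelLog {y : ℂ} (hy : ‖y‖ = 1) {q : ℂ} (hq : q ∈ slitPlane) :
    HasSum (fun n : ℕ => ∫ v in Ioi (0 : ℝ), (y * expW v) ^ (n + 1) / ((n : ℂ) + 1) * kernelLog q v)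
      (logStieltjes (logW y) q) := by
  have hsum : ∀ v : ℝ, 0 < v → HasSum (fun n : ℕ => Real.exp (-(2 * Real.pi) * v) ^ (n + 1)
      / ((n : ℝ) + 1) * ‖kernelLog q v‖) (‖logW 1 v * kernelLog q v‖) := fun v hv => by
    have hlt : Real.exp (-(2 * Real.pi) * v) < 1 := by
      rw [Real.exp_lt_one_iff]; nlinarith [Real.pi_pos]
    have h := Real.hasSum_pow_div_log_of_abs_lt_one
      (x := Real.exp (-(2 * Real.pi) * v)) (by rwa [abs_of_pos (Real.exp_pos _)])
    have e : ‖logW 1 v‖ = -Real.log (1 - Real.exp (-(2 * Real.pi) * v)) := by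
      have h0 : 0 ≤ 1 - Real.exp (-(2 * Real.pi) * v) := by linarith
      have h1 : logW 1 v = ((-Real.log (1 - Real.exp (-(2 * Real.pi) * v)) : ℝ) : ℂ) := by
        rw [logW, ofReal_neg, ofReal_log h0, expW]
        push_cast
        simp
      rw [h1, norm_real, Real.norm_of_nonneg]
      exact neg_nonneg.2 (Real.log_nonpos h0 (by linarith [Real.exp_pos (-(2 * Real.pi) * v)]))
    rw [norm_mul, e]
    exact h.mul_right _
  refine hasSum_integral_of_dominated_convergence
    (fun n v => Real.exp (-(2 * Real.pi) * v) ^ (n + 1) / ((n : ℝ) + 1) * ‖kernelLog q v‖)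
    (fun n => ?_) (fun n => ?_) ?_ ?_ ?_
  · exact ((((measurable_const.mul continuous_expW.measurable).pow_const _).div_const _).mul
      (measurable_kernelLog q)).aestronglyMeasurable
  · refine .of_forall fun v => ?_
    rw [norm_mul, norm_div, norm_pow, norm_mul, hy, one_mul, norm_expW]
    refine le_of_eq ?_
    congr 2
    have : ((n : ℂ) + 1) = ((n + 1 : ℝ) : ℂ) := by push_cast; rfl
    rw [this, norm_real, Real.norm_of_nonneg (by positivity)]
  · exact (ae_restrict_iff' measurableSet_Ioi).2 (.of_forall fun v hv => (hsum v hv).summable)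
  · exact (integrableOn_mul_kernelLog (integrableOn_logW 1) (integrableOn_mul_logW 1) hq).norm.congr
      ((ae_restrict_iff' measurableSet_Ioi).2 (.of_forall fun v hv => (hsum v hv).tsum_eq.symm))
  · exact (ae_restrict_iff' measurableSet_Ioi).2 (.of_forall fun v hv =>
      (hasSum_pow_succ_div_neg_log (norm_mul_expW_lt_one hy hv)).mul_right _)

lemma summable_sqrt_div_sq : Summable fun n : ℕ => 1 / ((n : ℝ) + 1) ^ 2 * √(n + 1) := by
  have h := (summable_nat_add_iff 1).2 (Real.summable_nat_rpow.2 (show (-(3 / 2) : ℝ) < -1 by norm_num))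
  refine h.congr fun n => ?_
  have hn : (0 : ℝ) < n + 1 := by positivity
  rw [Real.sqrt_eq_rpow, one_div, ← Real.rpow_natCast, ← Real.rpow_neg hn.le, ← Real.rpow_add hn]
  push_cast
  norm_num

lemma norm_one_div_natCast_add_one_sq (n : ℕ) : ‖1 / ((n : ℂ) + 1) ^ 2‖ = 1 / ((n : ℝ) + 1) ^ 2 := by
  have : ((n : ℂ) + 1) = ((n + 1 : ℝ) : ℂ) := by push_cast; rfl
  rw [norm_div, norm_pow, this, norm_real, Real.norm_of_nonneg (by positivity), norm_one]

/-- Resummation of the integral formula over the multiples of a charge. -/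
lemma exists_hasSum_tauFn {y : ℂ} (hy : ‖y‖ = 1) : ∃ k : ℂ, ∀ q ∈ slitPlane,
    HasSum (fun n : ℕ => 1 / ((n : ℂ) + 1) ^ 2 * (y ^ (n + 1) * tauFn expW ((n + 1 : ℕ) * q)))
      (tauFn (logW y) q + k) := by
  -- The part of each term independent of q: log(n+1) from rescaling the kernel and the constant in
  -- `tauFn`.
  set c : ℕ → ℂ := fun n => -(1 / ((n : ℂ) + 1) ^ 2
    * (y ^ (n + 1) * (Real.log (n + 1) + Real.pi ^ 2 * I * tail expW 0))) with hc
  have hsum : Summable c := by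
    refine Summable.of_norm_bounded (g := fun n : ℕ =>
      (2 + ‖(Real.pi : ℂ) ^ 2 * I * tail expW 0‖) * (1 / ((n : ℝ) + 1) ^ 2 * √(n + 1)))
      (summable_sqrt_div_sq.mul_left _) fun n => ?_
    have hn : (1 : ℝ) ≤ n + 1 := by linarith [(Nat.cast_nonneg n : (0 : ℝ) ≤ n)]
    rw [hc, norm_neg, norm_mul, norm_mul, norm_pow, hy, one_pow, one_mul,
      norm_one_div_natCast_add_one_sq]
    have h1 : ‖(Real.log (n + 1) : ℂ) + Real.pi ^ 2 * I * tail expW 0‖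
        ≤ (2 + ‖(Real.pi : ℂ) ^ 2 * I * tail expW 0‖) * √(n + 1) := by
      refine (norm_add_le _ _).trans ?_
      rw [norm_real, Real.norm_of_nonneg (Real.log_nonneg hn), add_mul]
      exact add_le_add (log_le_two_mul_sqrt (by linarith))
        (le_mul_of_one_le_right (norm_nonneg _) (Real.one_le_sqrt.2 hn))
    calc _ ≤ 1 / ((n : ℝ) + 1) ^ 2 * ((2 + ‖(Real.pi : ℂ) ^ 2 * I * tail expW 0‖) * √(n + 1)) := by
          gcongr
      _ = _ := by ring
  refine ⟨∑' n, c n + Real.pi ^ 2 * I * tail (logW y) 0, fun q hq => ?_⟩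
  have h := ((hasSum_integral_pow_mul_kernelLog hy hq).mul_left (-(2 * Real.pi : ℂ))).add hsum.hasSum
  convert! h using 1
  · funext n
    have hn' : ((n : ℂ) + 1) ≠ 0 := by exact_mod_cast n.succ_ne_zero
    have hpi : (Real.pi : ℂ) ≠ 0 := by exact_mod_cast Real.pi_ne_zero
    have e : ∫ v in Ioi (0 : ℝ), (y * expW v) ^ (n + 1) / ((n : ℂ) + 1) * kernelLog q v
        = y ^ (n + 1) / ((n : ℂ) + 1) * ∫ v in Ioi (0 : ℝ), expW v ^ (n + 1) * kernelLog q v := by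
      rw [← integral_const_mul]
      refine integral_congr_ae (.of_forall fun v => ?_)
      beta_reduce
      rw [mul_pow]; ring
    rw [e, tauFn, logStieltjes_expW_natCast_mul hq, hc]
    field_simp
    ring
  · rw [tauFn]; ring

/-! ### The finite uncoupled case: rational invariants -/

/-- The explicit solution of the TBA equations in terms of the rational invariants. -/
lemma exists_solvesTBARational {B : Data m} (hB : B.Uncoupled) (hfin : B.IsFinite)
    {σ : (Fin m → ℤ) → ℂ} (hσ : B.IsQuadraticRefinement σ) {θ : Fin m → ℂ}
    (hy : ∀ γ, B.Ω γ ≠ 0 → ‖fugacity σ θ γ‖ = 1) :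
    ∃ X : (Fin m → ℤ) → (Fin m → ℂ) → ℂ → ℂ,
      ∀ z, B.IsBPSAt z → SolvesTBARational B σ θ (.unconditional _) X z := by
  set A : (Fin m → ℤ) → (Fin m → ℂ) → ℂ → (Fin m → ℤ) → ℂ := fun γ z t γ' =>
    (B.ratΩ γ' : ℂ) * fugacity σ θ γ' * (B.pairing γ γ' : ℂ)
      * -stieltjes expW (slitVar (centralCharge z γ') t) with hA
  set X : (Fin m → ℤ) → (Fin m → ℂ) → ℂ → ℂ := fun γ z t =>
    Xsf σ θ γ z t * exp ((∑' γ', A γ z t γ') / (2 * Real.pi * I)) with hXdef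
  refine ⟨X, fun z hz γ t ht hray => ⟨∑' γ', A γ z t γ', ?_, rfl⟩⟩
  have hX : ∀ γ, B.ratΩ γ ≠ 0 → ∀ t, t ≠ 0 → X γ z t = Xsf σ θ γ z t := fun γ hγ t _ => by
    have h0 : ∀ γ', A γ z t γ' = 0 := fun γ' => by
      by_cases h1 : B.ratΩ γ' = 0
      · simp [hA, h1]
      · simp [hA, pairing_eq_zero_of_ratΩ hB hγ h1]
    simp [hXdef, h0]
  rw [funext fun γ' => tbaTermRational_eq hz hX γ γ' ht]
  refine Summable.hasSum ?_
  have hC : ∀ γ₀, ∃ C : ℝ, B.Ω γ₀ ≠ 0 → ∀ n : ℕ,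
      ‖fugacity σ θ ((n + 1) • γ₀) * (B.pairing γ ((n + 1) • γ₀) : ℂ)
        * -stieltjes expW (slitVar (centralCharge z ((n + 1) • γ₀)) t)‖ ≤ C := fun γ₀ => by
    by_cases h0 : B.pairing γ γ₀ = 0
    · exact ⟨0, fun _ n => by rw [pairing_nsmul_right, h0]; simp⟩
    by_cases hΩ : B.Ω γ₀ = 0
    · exact ⟨0, fun h => absurd hΩ h⟩
    -- Here t is only known to avoid rays of charges with nonzero rational invariant, so the active
    -- charge is written as a multiple of such a charge, which has the same ray.
    obtain ⟨d, hd, γ', hγ', rfl⟩ := exists_ratΩ_ne_zero hΩ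
    have hq : slitVar (centralCharge z (d • γ')) t ∈ slitPlane := by
      rw [centralCharge_nsmul, slitVar_natCast_mul]
      refine natCast_mul_mem_slitPlane hd (slitVar_mem_slitPlane
        (centralCharge_ne_zero_of_ratΩ hz hγ') ht (hray γ' hγ' fun h1 => h0 ?_))
      rw [pairing_nsmul_right, h1, mul_zero]
    obtain ⟨δ, hδ, h⟩ := exists_le_norm_add hq
    have h := (h _ (Metric.mem_ball_self hδ)).2
    refine ⟨‖(B.pairing γ (d • γ') : ℂ)‖ * ((∫ v in Ioi (0 : ℝ), ‖expW v‖) / δ), fun _ n => ?_⟩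
    have hb := norm_stieltjes_expW_natCast_mul_le hδ h n
    rw [fugacity_nsmul hσ, pairing_nsmul_right, centralCharge_nsmul z (n + 1), slitVar_natCast_mul,
      norm_mul, norm_mul, norm_pow, hy _ hΩ, one_pow, one_mul, norm_neg]
    have e : ‖(((n + 1 : ℕ) * B.pairing γ (d • γ') : ℤ) : ℂ)‖
        = ((n : ℝ) + 1) * ‖(B.pairing γ (d • γ') : ℂ)‖ := by
      rw [Int.cast_mul, norm_mul, Int.cast_natCast, Complex.norm_natCast]
      push_cast; rfl
    rw [e]
    calc _ = ‖(B.pairing γ (d • γ') : ℂ)‖ * (((n : ℝ) + 1)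
          * ‖stieltjes expW ((n + 1 : ℕ) * slitVar (centralCharge z (d • γ')) t)‖) := by ring
      _ ≤ _ := by gcongr
  choose C hC using hC
  obtain ⟨M, hM, hMle⟩ := exists_summable_norm_ratΩ_mul_le hfin
    (b := fun γ₀ n => 1 / ((n : ℝ) + 1) ^ 2 * C γ₀) fun γ₀ _ => by
      refine Summable.mul_right _ ?_
      have := (summable_nat_add_iff 1).2 (Real.summable_one_div_nat_pow.2 one_lt_two)
      simpa using this
  refine Summable.of_norm_bounded hM fun γ' => ?_
  have := hMle (fun γ' => fugacity σ θ γ' * (B.pairing γ γ' : ℂ)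
      * -stieltjes expW (slitVar (centralCharge z γ') t)) (fun γ₀ hγ₀ n => by
    rw [norm_mul, norm_one_div_natCast_add_one_sq]
    exact mul_le_mul_of_nonneg_left (hC γ₀ hγ₀ n) (by positivity)) γ'
  convert! this using 2
  ring

lemma logTauTerm_eq_of_mem_domain {B : Data m} (σ : (Fin m → ℤ) → ℂ) (θ : Fin m → ℂ)
    {p : (Fin m → ℂ) × ℂ} (hp : p ∈ B.domain) (γ : Fin m → ℤ) :
    logTauTerm B σ θ γ p = (B.ratΩ γ : ℂ) * (1 / (4 * (Real.pi : ℂ) ^ 2)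
      * (fugacity σ θ γ * tauFn expW (slitVar (centralCharge p.1 γ) p.2))) := by
  rw [logTauTerm_eq B σ θ γ hp.2.1
    (slitVar_mem_of_ratΩ fun γ hγ => slitVar_mem_of_mem_domain hp hγ)]
  ring

/-- Locally uniform convergence of the integral formula in terms of the rational invariants. -/
lemma sumsLocallyUniformly_logTauTerm {B : Data m} (hfin : B.IsFinite)
    {σ : (Fin m → ℤ) → ℂ} (hσ : B.IsQuadraticRefinement σ) {θ : Fin m → ℂ}
    (hy : ∀ γ, B.Ω γ ≠ 0 → ‖fugacity σ θ γ‖ = 1) :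
    SumsLocallyUniformly (.unconditional _) (logTauTerm B σ θ)
      (fun p => ∑' γ, logTauTerm B σ θ γ p) B.domain := by
  intro u hu p hp
  have hC : ∀ γ₀, ∃ C : ℝ, B.Ω γ₀ ≠ 0 → ∀ᶠ p' in 𝓝 p, ∀ n : ℕ,
      ‖1 / (4 * (Real.pi : ℂ) ^ 2) * (fugacity σ θ ((n + 1) • γ₀)
        * tauFn expW (slitVar (centralCharge p'.1 ((n + 1) • γ₀)) p'.2))‖
          ≤ C * √(n + 1) := fun γ₀ => by
    by_cases hΩ : B.Ω γ₀ = 0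
    · exact ⟨0, fun h => absurd hΩ h⟩
    obtain ⟨δ, hδ, h⟩ := exists_le_norm_add (slitVar_mem_of_mem_domain hp hΩ)
    set q := slitVar (centralCharge p.1 γ₀) p.2 with hq
    -- The neighbouring values of q stay within δ, so ‖q‖ + δ makes the constant uniform.
    refine ⟨‖1 / (4 * (Real.pi : ℂ) ^ 2)‖ * (2 * Real.pi * ((1 / δ + (‖q‖ + δ) + 3 + Real.pi)
      * ∫ v in Ioi (0 : ℝ), (‖expW v‖ + ‖(v : ℂ) * expW v‖)) + Real.pi ^ 2 * ‖tail expW 0‖),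
      fun _ => ?_⟩
    filter_upwards [(continuousAt_slitVar γ₀ hp.2.1).eventually (Metric.ball_mem_nhds q hδ)]
      with p' hp' n
    have h1 := norm_tauFn_expW_natCast_mul_le (h _ hp').1 hδ (h _ hp').2 n
    have h2 : ‖slitVar (centralCharge p'.1 γ₀) p'.2‖ ≤ ‖q‖ + δ :=
      (norm_le_norm_add_norm_sub' _ q).trans (by gcongr; exact (mem_ball_iff_norm.1 hp').le)
    have h3 : 0 ≤ ∫ v in Ioi (0 : ℝ), (‖expW v‖ + ‖(v : ℂ) * expW v‖) :=
      integral_nonneg fun v => by positivity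
    rw [fugacity_nsmul hσ, centralCharge_nsmul, slitVar_natCast_mul, norm_mul, norm_mul, norm_pow,
      hy _ hΩ, one_pow, one_mul, mul_assoc]
    refine mul_le_mul_of_nonneg_left (h1.trans ?_) (norm_nonneg _)
    have := Real.pi_pos
    gcongr
  choose C hC using hC
  obtain ⟨M, hM, hMle⟩ := exists_summable_norm_ratΩ_mul_le hfin
    (b := fun γ₀ n => C γ₀ * (1 / ((n : ℝ) + 1) ^ 2 * √(n + 1)))
    fun γ₀ _ => summable_sqrt_div_sq.mul_left _
  have hev : ∀ᶠ p' in 𝓝 p, ∀ γ₀ ∈ Function.support B.Ω, ∀ n : ℕ,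
      ‖1 / (4 * (Real.pi : ℂ) ^ 2) * (fugacity σ θ ((n + 1) • γ₀)
        * tauFn expW (slitVar (centralCharge p'.1 ((n + 1) • γ₀)) p'.2))‖ ≤ C γ₀ * √(n + 1) :=
    (eventually_all_finite hfin).2 fun γ₀ hγ₀ => hC γ₀ hγ₀
  refine ⟨_, inter_mem (nhdsWithin_le_nhds hev) self_mem_nhdsWithin,
    tendstoUniformlyOn_tsum hM (fun γ p' hp' => ?_) u hu⟩
  rw [logTauTerm_eq_of_mem_domain σ θ hp'.2]
  refine hMle (fun γ => 1 / (4 * (Real.pi : ℂ) ^ 2)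
    * (fugacity σ θ γ * tauFn expW (slitVar (centralCharge p'.1 γ) p'.2))) (fun γ₀ hγ₀ n => ?_) γ
  rw [norm_mul, norm_one_div_natCast_add_one_sq]
  calc _ ≤ 1 / ((n : ℝ) + 1) ^ 2 * (C γ₀ * √(n + 1)) :=
        mul_le_mul_of_nonneg_left (hp'.1 γ₀ hγ₀ n) (by positivity)
    _ = _ := by ring

/-- The multiples of each active charge resum to its logarithmic transform plus a constant depending
only on the fugacity, and there are finitely many such charges. -/
lemma exists_tsum_logTauTerm_eq {B : Data m} (hfin : B.IsFinite)
    {σ : (Fin m → ℤ) → ℂ} (hσ : B.IsQuadraticRefinement σ) {θ : Fin m → ℂ}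
    (hy : ∀ γ, B.Ω γ ≠ 0 → ‖fugacity σ θ γ‖ = 1) :
    ∃ c : ℂ, ∀ p ∈ B.domain,
      ∑' γ, logTauTerm B σ θ γ p = ∑ᶠ γ, logTauTermResummed B σ θ γ p + c := by
  have hk : ∀ γ₀, ∃ k : ℂ, B.Ω γ₀ ≠ 0 → ∀ q ∈ slitPlane,
      HasSum (fun n : ℕ => 1 / ((n : ℂ) + 1) ^ 2 * (fugacity σ θ γ₀ ^ (n + 1)
        * tauFn expW ((n + 1 : ℕ) * q))) (tauFn (logW (fugacity σ θ γ₀)) q + k) := fun γ₀ => by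
    by_cases hΩ : B.Ω γ₀ = 0
    · exact ⟨0, fun h => absurd hΩ h⟩
    · obtain ⟨k, hk⟩ := exists_hasSum_tauFn (hy γ₀ hΩ)
      exact ⟨k, fun _ => hk⟩
  choose k hk using hk
  refine ⟨∑ γ₀ ∈ hfin.toFinset, (B.Ω γ₀ : ℂ) * (1 / (4 * (Real.pi : ℂ) ^ 2) * k γ₀), fun p hp => ?_⟩
  have h := hasSum_ratΩ_mul hfin (a := fun γ => 1 / (4 * (Real.pi : ℂ) ^ 2)
      * (fugacity σ θ γ * tauFn expW (slitVar (centralCharge p.1 γ) p.2)))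
    (A := fun γ₀ => 1 / (4 * (Real.pi : ℂ) ^ 2)
      * (tauFn (logW (fugacity σ θ γ₀)) (slitVar (centralCharge p.1 γ₀) p.2) + k γ₀))
    fun γ₀ hγ₀ => by
      have h1 := (hk γ₀ hγ₀ _ (slitVar_mem_of_mem_domain hp hγ₀)).mul_left
        (1 / (4 * (Real.pi : ℂ) ^ 2))
      convert! h1 using 1
      funext n
      rw [fugacity_nsmul hσ, centralCharge_nsmul, slitVar_natCast_mul]
      ring
  rw [funext fun γ => logTauTerm_eq_of_mem_domain σ θ hp γ, h.tsum_eq,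
    finsum_eq_sum_of_support_subset (s := hfin.toFinset), ← Finset.sum_add_distrib]
  · refine Finset.sum_congr rfl fun γ _ => ?_
    rw [logTauTermResummed_eq B σ θ γ hp.2.1 fun h => slitVar_mem_of_mem_domain hp h]
    ring
  · intro γ hγ
    exact hfin.mem_toFinset.2 fun h0 => hγ (by simp [logTauTermResummed, h0])

end

end BPS

/-! ### The main theorem -/

theorem mainTheorem4 (m : ℕ) (B : BPS.Data m) (hB : B.Uncoupled)
    (σ : (Fin m → ℤ) → ℂ) (hσ : B.IsQuadraticRefinement σ) (θ : Fin m → ℂ) :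
    -- uncoupled case: integrability, and the integral formula (rational invariants)
    (∀ (L : SummationFilter (Fin m → ℤ)) [L.NeBot] [L.LeAtTop]
        (V : Set ((Fin m → ℂ) × ℂ)), IsOpen V → V ⊆ B.domain →
      ∀ X : (Fin m → ℤ) → (Fin m → ℂ) → ℂ → ℂ,
        (∀ p ∈ V, BPS.SolvesTBARational B σ θ L X p.1) →
      ∀ T : (Fin m → ℂ) × ℂ → ℂ,
        BPS.SumsLocallyUniformly L (BPS.logTauTerm B σ θ) T V →
      ∀ (t : ℂ) (W : Set (Fin m → ℂ)), IsOpen W → IsPreconnected W →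
        (∀ z ∈ W, (z, t) ∈ V) →
      ∀ logτ : (Fin m → ℂ) → ℂ,
        BPS.IsLogTau B σ θ X t W logτ ↔ ∃ c : ℂ, ∀ z ∈ W, logτ z = T (z, t) + c) ∧
    -- the same with integer invariants
    (∀ (L : SummationFilter (Fin m → ℤ)) [L.NeBot] [L.LeAtTop]
        (V : Set ((Fin m → ℂ) × ℂ)), IsOpen V → V ⊆ B.domain →
      ∀ X : (Fin m → ℤ) → (Fin m → ℂ) → ℂ → ℂ,
        (∀ p ∈ V, BPS.SolvesTBA B σ θ L X p.1) →
      ∀ T : (Fin m → ℂ) × ℂ → ℂ,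
        BPS.SumsLocallyUniformly L (BPS.logTauTermResummed B σ θ) T V →
      ∀ (t : ℂ) (W : Set (Fin m → ℂ)), IsOpen W → IsPreconnected W →
        (∀ z ∈ W, (z, t) ∈ V) →
      ∀ logτ : (Fin m → ℂ) → ℂ,
        BPS.IsLogTau B σ θ X t W logτ ↔ ∃ c : ℂ, ∀ z ∈ W, logτ z = T (z, t) + c) ∧
    -- finite uncoupled case
    (B.IsFinite →
      ∀ ϑ : (Fin m → ℤ) → ℂ,
        (∀ γ, Complex.exp (2 * Real.pi * Complex.I * ϑ γ)
          = σ γ * Complex.exp (2 * Real.pi * Complex.I * BPS.angle θ γ)) →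
      -- the branches of `log Υ` exist, and the TBA equations are solvable
      (∃ ℓ : (Fin m → ℤ) → ℂ → ℂ,
        ∀ γ, B.Ω γ ≠ 0 → BPS.IsLogUpsilon (1 - BPS.bracket (ϑ γ)) (ℓ γ)) ∧
      (∃ X : (Fin m → ℤ) → (Fin m → ℂ) → ℂ → ℂ,
        ∀ z, B.IsBPSAt z → BPS.SolvesTBA B σ θ (.unconditional _) X z) ∧
      ∀ ℓ : (Fin m → ℤ) → ℂ → ℂ,
        (∀ γ, B.Ω γ ≠ 0 → BPS.IsLogUpsilon (1 - BPS.bracket (ϑ γ)) (ℓ γ)) →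
        -- the `τ`-function is the product of generalized Barnes functions
        (∀ (t : ℂ) (W : Set (Fin m → ℂ)), IsOpen W → IsPreconnected W →
            (∀ z ∈ W, (z, t) ∈ B.domain) →
          ∀ X : (Fin m → ℤ) → (Fin m → ℂ) → ℂ → ℂ,
            (∀ z ∈ W, BPS.SolvesTBA B σ θ (.unconditional _) X z) →
          ∀ logτ : (Fin m → ℂ) → ℂ,
            BPS.IsLogTau B σ θ X t W logτ ↔
              ∃ c : ℂ, ∀ z ∈ W, logτ z = BPS.barnesSum B ℓ (z, t) + c) ∧
        -- evaluation of the integral formula, up to a function of `θ` on each chamber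
        (∀ S : Set (Fin m → ℤ), ∃ c : ℂ, ∀ p ∈ B.domain, B.rightCharges p.1 p.2 = S →
          ∑ᶠ γ, BPS.logTauTermResummed B σ θ γ p = BPS.barnesSum B ℓ p + c) ∧
        -- for real `ϑ` the series over the rational invariants converges to the same result
        ((∀ γ, B.Ω γ ≠ 0 → (ϑ γ).im = 0) →
          (∃ X : (Fin m → ℤ) → (Fin m → ℂ) → ℂ → ℂ,
            ∀ z, B.IsBPSAt z → BPS.SolvesTBARational B σ θ (.unconditional _) X z) ∧
          ∃ T : (Fin m → ℂ) × ℂ → ℂ,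
            BPS.SumsLocallyUniformly (.unconditional _) (BPS.logTauTerm B σ θ) T B.domain ∧
            ∀ S : Set (Fin m → ℤ), ∃ c : ℂ, ∀ p ∈ B.domain, B.rightCharges p.1 p.2 = S →
              T p = BPS.barnesSum B ℓ p + c)) := by
  refine ⟨fun L _ _ V hV hVD X hX T hT t W hW hWc hWV logτ =>
      BPS.isLogTau_iff_of_solvesTBARational hB hσ θ L hV hVD hX hT hW hWc hWV logτ,
    fun L _ _ V hV hVD X hX T hT t W hW hWc hWV logτ =>
      BPS.isLogTau_iff_of_solvesTBA hB hσ θ L hV hVD hX hT hW hWc hWV logτ,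
    fun hfin ϑ hϑ => ⟨⟨fun γ => BPS.logUpsilon (1 - BPS.bracket (ϑ γ)), fun γ _ =>
        BPS.isLogUpsilon_logUpsilon (BPS.admissible_one_sub_bracket _).re_nonneg⟩,
      BPS.exists_solvesTBA hB hfin σ θ, fun ℓ hℓ => ⟨?_, ?_, ?_⟩⟩⟩
  · exact fun t W hW hWc hWD X hX logτ =>
      BPS.isLogTau_iff_barnesSum hB hfin hσ hϑ hℓ hW hWc hWD hX logτ
  · exact BPS.exists_finsum_logTauTermResummed_eq hfin hσ hϑ hℓ
  · intro him
    -- Reality of ϑ enters only here: it places the fugacities on the unit circle, where the series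
    -- over multiples converge.
    have hy : ∀ γ, B.Ω γ ≠ 0 → ‖BPS.fugacity σ θ γ‖ = 1 := fun γ hγ => by
      rw [BPS.fugacity, ← hϑ γ]
      exact BPS.norm_exp_two_pi_of_im_eq_zero (him γ hγ)
    refine ⟨BPS.exists_solvesTBARational hB hfin hσ hy, _,
      BPS.sumsLocallyUniformly_logTauTerm hfin hσ hy, fun S => ?_⟩
    obtain ⟨c₁, h1⟩ := BPS.exists_finsum_logTauTermResummed_eq hfin hσ hϑ hℓ S
    obtain ⟨c₂, h2⟩ := BPS.exists_tsum_logTauTerm_eq hfin hσ hy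
    exact ⟨c₁ + c₂, fun p hp hS => by rw [h2 p hp, h1 p hp hS, add_assoc]⟩
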